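/- **Proposition 3.2 (Co-periodic stability).** Let $D=\mathrm{diag}(4,16)$ and, for $\varepsilon\ge 0$, $\omega\in[-\tfrac14,\tfrac14]$, put $b=\varepsilon^2$, $k=k(\varepsilon,\omega)=\tfrac12\bigl(2\varepsilon\omega+\sqrt{4\varepsilon^2\omega^2+1}\bigr)$ and $$f(u)=\begin{pmatrix}(b+3)u_1+4u_2+(\tfrac b2+2)u_1^2+4u_1u_2+u_1^2u_2\\ -(b+4)u_1-4u_2-(\tfrac b2+2)u_1^2-4u_1u_2-u_1^2u_2\end{pmatrix}$$ (the Brusselator reaction term centred at its equilibrium). Consider the profile equation $$k^2D\,\partial_\xi^2u+f(u)=0,\qquad u\in H^2_{per}([0,2\pi],\mathbb R^2). \tag{1}$$ There exist $\rho>0$ and $\varepsilon_0>0$ such that for all $\varepsilon\in[0,\varepsilon_0)$ and $\omega\in[-\tfrac14,\tfrac14]$ equation (1) has exactly one solution $u=\tilde u_{\varepsilon,\omega}$ with $\|u\|_{H^2}<\rho$ that is even in $\xi$ and, if $\varepsilon>0$ and $|\omega|<\tfrac14$, satisfies $u_1(0)>0$ (if $\varepsilon=0$ or $\omega=\pm\tfrac14$,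 it is $u\equiv0$); moreover $$\tilde u_{\varepsilon,\omega}=\varepsilon\sqrt{\tfrac23(1-16\omega^2)}\,\cos\xi\begin{pmatrix}2\\-1\end{pmatrix}+\mathcal O(\varepsilon^2)\quad\text{in }H^2,\text{ uniformly in }\omega.$$ Let $B(\varepsilon,\omega,\sigma)V=k^2D(\partial_\xi+i\sigma)^2V+df(\tilde u_{\varepsilon,\omega})V$ be the Bloch operators of the linearization, considered as unbounded operators on $L^2_{per}([0,2\pi],\mathbb C^2)$ with domain $H^2_{per}([0,2\pi],\mathbb C^2)$. Then there exist $\tilde\varepsilon_0\in(0,\varepsilon_0]$ and $\delta>0$ such that for all $\varepsilon\in[0,\tilde\varepsilon_0)$ and all $\omega\in[-\tfrac14,\tfrac14]$ the spectrum of $B(\varepsilon,\omega,0)$ has the decomposition $$\mathrm{Sp}(B(\varepsilon,\omega,0))=S\cup\{\lambda_1,\lambda_2\},$$ where $$\lambda_1(\varepsilon,\omega)=-\tfrac43(1-16\omega^2)\varepsilon^2+\mathcal O(\varepsilon^3)\ \text{ uniformly in }\omega,\qquad \lambda_2(\varepsilon,\omega)=0,$$ and $\mathrm{Re}\,\lambda<-\delta$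 for every $\lambda\in S$. -/

import Mathlib

open MeasureTheory Real
open scoped ENNReal

noncomputable section

namespace Brusselator

instance twoPiPos : Fact (0 < 2 * π) := ⟨Real.two_pi_pos⟩

/-- The circle `ℝ / 2πℤ`; functions on it are the `2π`-periodic functions of `ξ`. -/
abbrev Circ : Type := AddCircle (2 * π)

/-- Scalar complex `L²_per([0, 2π])` (with respect to `dξ / 2π`). -/
abbrev L2per : Type := Lp ℂ 2 (AddCircle.haarAddCircle : Measure Circ)

/-- Complex `L²_per([0, 2π], ℂ²)`, as pairs of components
(with the larger of the two component norms, equivalent to the Hilbert norm). -/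
abbrev L2perVec : Type := Fin 2 → L2per

/-- `H²_per([0, 2π])`: the `f ∈ L²_per` with `((1 + n²) f̂(n))_n ∈ ℓ²(ℤ)`. -/
def H2per : Submodule ℂ L2per where
  carrier := {f | Memℓp (fun n : ℤ => (1 + (n : ℂ) ^ 2) * fourierBasis.repr f n) 2}
  zero_mem' := by
    have h : Memℓp (0 : ℤ → ℂ) 2 := zero_memℓp
    have e : (fun n : ℤ => (1 + (n : ℂ) ^ 2) * fourierBasis.repr (0 : L2per) n) = 0 := by
      funext n
      simp
    rw [Set.mem_ofPred_eq, e]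
    exact h
  add_mem' := by
    intro f g hf hg
    have h := Memℓp.add hf hg
    simp only [Set.mem_ofPred_eq, map_add, lp.coeFn_add, Pi.add_apply, mul_add] at h ⊢
    exact h
  smul_mem' := by
    intro c f hf
    have h := Memℓp.const_smul hf c
    simp only [Set.mem_ofPred_eq, map_smul, lp.coeFn_smul, Pi.smul_apply, smul_eq_mul] at h ⊢
    convert h using 2
    simp only [Pi.smul_apply, smul_eq_mul]
    ring

theorem memℓp_symbol (σ : ℝ) {f : L2per} (hf : f ∈ H2per) :
    Memℓp (fun n : ℤ => -((n : ℂ) + σ) ^ 2 * fourierBasis.repr f n) 2 := by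
  have hf' : Memℓp (fun n : ℤ => (1 + (n : ℂ) ^ 2) * fourierBasis.repr f n) 2 := hf
  have h2 : (0 : ℝ) < (2 : ℝ≥0∞).toReal := by norm_num
  rw [memℓp_gen_iff h2] at hf' ⊢
  refine Summable.of_nonneg_of_le (fun n => by positivity) (fun n => ?_)
    (hf'.mul_left ((2 + 2 * σ ^ 2) ^ (2 : ℝ≥0∞).toReal))
  rw [← Real.mul_rpow (by positivity) (norm_nonneg _)]
  refine Real.rpow_le_rpow (norm_nonneg _) ?_ h2.le
  rw [norm_mul, norm_mul, ← mul_assoc]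
  refine mul_le_mul_of_nonneg_right ?_ (norm_nonneg _)
  have e1 : ‖-((n : ℂ) + σ) ^ 2‖ = ((n : ℝ) + σ) ^ 2 := by
    have : -((n : ℂ) + σ) ^ 2 = ((-((n : ℝ) + σ) ^ 2 : ℝ) : ℂ) := by push_cast; ring
    rw [this, Complex.norm_real, norm_neg, Real.norm_of_nonneg (by positivity)]
  have e2 : ‖1 + (n : ℂ) ^ 2‖ = 1 + (n : ℝ) ^ 2 := by
    have : 1 + (n : ℂ) ^ 2 = ((1 + (n : ℝ) ^ 2 : ℝ) : ℂ) := by push_cast; ring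
    rw [this, Complex.norm_real, Real.norm_of_nonneg (by positivity)]
  rw [e1, e2]
  nlinarith [sq_nonneg ((n : ℝ) - σ), sq_nonneg ((n : ℝ) * σ), sq_nonneg σ, sq_nonneg (n : ℝ)]

/-- The operator `(∂_ξ + iσ)² : H²_per → L²_per`, with Fourier symbol `(in + iσ)² = -(n + σ)²`.
For `σ = 0` it is the second derivative. -/
def blochD2 (σ : ℝ) : H2per →ₗ[ℂ] L2per where
  toFun f := fourierBasis.repr.symm
    ⟨fun n : ℤ => -((n : ℂ) + σ) ^ 2 * fourierBasis.repr (f : L2per) n, memℓp_symbol σ f.2⟩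
  map_add' f g := by
    rw [← map_add]
    congr 1
    ext n
    simp only [Submodule.coe_add, map_add, lp.coeFn_add, Pi.add_apply, mul_add]
  map_smul' c f := by
    rw [RingHom.id_apply, ← map_smul]
    congr 1
    ext n
    simp
    ring

/-- A real `ℝ²`-valued `2π`-periodic continuous function `u = (u₁, u₂)`. Every element of
`H²_per([0, 2π], ℝ²)` has exactly one such representative. -/
abbrev Profile : Type := Fin 2 → C(Circ, ℝ)

/-- A real continuous periodic function as a complex one. -/
def toComplex (c : C(Circ, ℝ)) : C(Circ, ℂ) :=
  ⟨fun x => (c x : ℂ), Complex.continuous_ofReal.comp c.continuous⟩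

/-- The `L²_per` class of a real continuous periodic function. -/
def toL2 (c : C(Circ, ℝ)) : L2per :=
  ContinuousMap.toLp 2 AddCircle.haarAddCircle ℂ (toComplex c)

/-- The `H²` norm `(∑_j ∑_n (1 + n²)² |û_j(n)|²)^{1/2}` (meaningful for components in `H²_per`). -/
def h2Norm (u : Profile) : ℝ :=
  √(∑ j, ∑' n : ℤ, ((1 + (n : ℝ) ^ 2) * ‖fourierBasis.repr (toL2 (u j)) n‖) ^ 2)

/-- The diffusion constants, `D = diag(4, 16)`. -/
def diffusion : Fin 2 → ℝ := ![4, 16]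

/-- The wave number `k(ε, ω) = (2εω + √(4ε²ω² + 1)) / 2`. -/
def waveNumber (ε ω : ℝ) : ℝ := (2 * ε * ω + √(4 * ε ^ 2 * ω ^ 2 + 1)) / 2

/-- The Brusselator reaction term with `a = 2`, `β = b + 4`, centred at the equilibrium. -/
def reaction (b : ℝ) (y : Fin 2 → ℝ) : Fin 2 → ℝ :=
  ![(b + 3) * y 0 + 4 * y 1 + (b / 2 + 2) * y 0 ^ 2 + 4 * y 0 * y 1 + y 0 ^ 2 * y 1,
    -(b + 4) * y 0 - 4 * y 1 - (b / 2 + 2) * y 0 ^ 2 - 4 * y 0 * y 1 - y 0 ^ 2 * y 1]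

/-- The Jacobian matrix of `reaction b` at `y`. -/
def reactionJacobian (b : ℝ) (y : Fin 2 → ℝ) : Matrix (Fin 2) (Fin 2) ℝ :=
  !![(b + 3) + ((b + 4) * y 0 + 4 * y 1 + 2 * y 0 * y 1), 4 + (4 * y 0 + y 0 ^ 2);
    -(b + 4) - ((b + 4) * y 0 + 4 * y 1 + 2 * y 0 * y 1), -4 - (4 * y 0 + y 0 ^ 2)]

/-- The `j`-th component of `ξ ↦ f(u(ξ))`. -/
def reactionAlong (b : ℝ) (u : Profile) (j : Fin 2) : C(Circ, ℝ) where
  toFun x := reaction b (fun i => u i x) j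
  continuous_toFun := by fin_cases j <;> simp [reaction] <;> fun_prop

/-- The `(j, i)` entry of `ξ ↦ df(u(ξ))`. -/
def jacobianAlong (b : ℝ) (u : Profile) (j i : Fin 2) : C(Circ, ℝ) where
  toFun x := reactionJacobian b (fun l => u l x) j i
  continuous_toFun := by fin_cases j <;> fin_cases i <;> simp [reactionJacobian] <;> fun_prop

/-- Multiplication by a real continuous periodic function on `L²_per`. -/
def mulL2 (c : C(Circ, ℝ)) : L2per →L[ℂ] L2per :=
  (ContinuousLinearMap.mul ℂ ℂ).holderL AddCircle.haarAddCircle ∞ 2 2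
    (ContinuousMap.toLp ∞ AddCircle.haarAddCircle ℂ (toComplex c))

/-- `u ∈ H²_per([0, 2π], ℝ²)` solves `k² D ∂_ξ² u + f(u) = 0` in `L²_per`,
with `b = ε²` and `k = k(ε, ω)`. -/
def IsSteady (ε ω : ℝ) (u : Profile) : Prop :=
  ∃ hu : ∀ j, toL2 (u j) ∈ H2per, ∀ j,
    ((waveNumber ε ω ^ 2 * diffusion j : ℝ) : ℂ) • blochD2 0 ⟨toL2 (u j), hu j⟩
      + toL2 (reactionAlong (ε ^ 2) u j) = 0

/-- `u` is a steady solution of `H²` norm less than `ρ`, even in `ξ`, and, unless the parameters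
are degenerate (`ε = 0` or `ω = ±1/4`), with positive first component at `ξ = 0`. -/
structure IsSmallEvenSteady (ρ ε ω : ℝ) (u : Profile) : Prop where
  steady : IsSteady ε ω u
  small : h2Norm u < ρ
  even : ∀ j x, u j (-x) = u j x
  pos : 0 < ε → |ω| < 1 / 4 → 0 < u 0 0

/-- The leading-order profile `ε √((2/3)(1 - 16ω²)) cos ξ (2, -1)`;
`cos ξ` is the real part of `fourier 1 ξ = e^{iξ}`. -/
def leadingProfile (ε ω : ℝ) : Profile := fun j =>
  ⟨fun x => ε * √(2 / 3 * (1 - 16 * ω ^ 2)) * (fourier 1 x : ℂ).re * (![2, -1] : Fin 2 → ℝ) j,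
    by fun_prop⟩

/-- The Bloch operator `B(ε, ω, σ) V = k² D (∂_ξ + iσ)² V + df(u) V` on `L²_per([0, 2π], ℂ²)`
with domain `H²_per([0, 2π], ℂ²)`, for the linearization about the profile `u`. -/
def blochOp (u : Profile) (ε ω σ : ℝ) : L2perVec →ₗ.[ℂ] L2perVec where
  domain := Submodule.pi Set.univ (fun _ : Fin 2 => H2per)
  toFun :=
    { toFun := fun V j =>
        ((waveNumber ε ω ^ 2 * diffusion j : ℝ) : ℂ) •
            blochD2 σ ⟨(V : L2perVec) j, V.2 j (Set.mem_univ j)⟩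
          + ∑ i, mulL2 (jacobianAlong (ε ^ 2) u j i) ((V : L2perVec) i)
      map_add' := by
        intro V W
        funext j
        have h : (⟨((V + W : _) : L2perVec) j, (V + W).2 j (Set.mem_univ j)⟩ : H2per)
            = ⟨(V : L2perVec) j, V.2 j (Set.mem_univ j)⟩
              + ⟨(W : L2perVec) j, W.2 j (Set.mem_univ j)⟩ := rfl
        rw [h]
        simp only [map_add, smul_add, Submodule.coe_add, Pi.add_apply, Finset.sum_add_distrib]
        exact add_add_add_comm _ _ _ _
      map_smul' := by
        intro c V
        funext j
        have h : (⟨((c • V : _) : L2perVec) j, (c • V).2 j (Set.mem_univ j)⟩ : H2per)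
            = c • ⟨(V : L2perVec) j, V.2 j (Set.mem_univ j)⟩ := rfl
        rw [h]
        simp only [map_smul, Submodule.coe_smul, Pi.smul_apply, RingHom.id_apply,
          smul_add, Finset.smul_sum]
        rw [smul_comm] }

/-- The spectrum of an unbounded operator `A`: the `z` for which `A - z` has no bounded
everywhere defined two-sided inverse. -/
def opSpectrum {E : Type*} [NormedAddCommGroup E] [NormedSpace ℂ E] (A : E →ₗ.[ℂ] E) : Set ℂ :=
  {z | ¬ ∃ R : E →L[ℂ] E,
    (∀ y, ∃ h : R y ∈ A.domain, A ⟨R y, h⟩ - z • R y = y) ∧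
    ∀ x : A.domain, R (A x - z • (x : E)) = x}

end Brusselator

end

noncomputable section

namespace Brusselator

/-! Steady states. The nonlinear terms enter the two components with opposite signs, so adding the
equations slaves the second component to the first in every nonzero mode and leaves one scalar
symbol `dSym` (`mode_iff`). Near onset it is invertible with quadratic decay for |n| ≥ 2, mode 0 is
solved directly, and at n = ±1 the choice of k makes it exactly μ = ε²(1 - 16ω²) (`dSym_one_eq`).
Lyapunov–Schmidt reduction is carried out for even functions in the sup norm; H² is recovered from
the equation. With u = a(φ + aψ) and φ = cos ξ (1, m), a contraction determines ψ
(`exists_isBranch`), and what remains is a(μ - a²T) = 0 with T close to 3/8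
(`branchProfile_reduced_eq`, `IsBranch.landau_mem`). Because a²T is strictly increasing for a ≥ 0,
exactly one a ≥ 0 satisfies a²T = μ (`exists_amplitude`, `OnBranch.unique`), and the sign of u₁(0)
is that of a. The quadratic term at φ carries the factor β + 4m = O(ε); hence ψ = O(ε) and the cubic
term alone fixes T at leading order.

Spectrum. At onset the kernel is spanned by an even and an odd vector in the modes ±1. Subtracting
the two corresponding rank-one projections gives an operator that is invertible for Re z ≥ -1/8,
with a bound independent of z; this survives a perturbation of size O(ε) (`OnBranch.almostKernel`).
Undoing the rank-one shifts, with parity removing one off-diagonal entry, shows that z lies in the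
spectrum iff z + φc(R_z A vc) = 0 or z + φs(R_z A vs) = 0 (`mem_opSpectrum_iff'`). Both corrections
are 1/2-Lipschitz in z, so each function has at most one zero in the half plane. The odd zero is 0:
differences of opposite translates of the profile are odd approximate kernel vectors of any accuracy
(`OnBranch.exists_odd_approx`). The even zero is located by testing with the rescaled profile Φ = φ
+ aψ, on which A has size O(ε²) and critical component -(4/3)μ + O(ε³) after normalization
(`norm_char_le`, `OnBranch.abs_coef_residual_add_le`). Working with Φ instead of u keeps every
estimate uniform down to a = 0, that is, up to ε = 0 and ω = ±1/4. -/

/-! ### Fourier coefficients of real continuous functions on the circle -/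

/-- The `n`-th Fourier coefficient of a real continuous periodic function. -/
def cc (c : C(Circ, ℝ)) (n : ℤ) : ℂ := fourierBasis.repr (toL2 c) n

theorem cc_eq_fourierCoeff (c : C(Circ, ℝ)) (n : ℤ) : cc c n = fourierCoeff (toComplex c) n := by
  rw [cc, fourierBasis_repr, toL2, fourierCoeff_toLp]

theorem cc_eq_integral (c : C(Circ, ℝ)) (n : ℤ) :
    cc c n = ∫ x : Circ, fourier (-n) x * (c x : ℂ) ∂AddCircle.haarAddCircle := by
  rw [cc_eq_fourierCoeff]; rfl

theorem toL2_add (c d : C(Circ, ℝ)) : toL2 (c + d) = toL2 c + toL2 d := by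
  have : toComplex (c + d) = toComplex c + toComplex d := by ext x; simp [toComplex]
  rw [toL2, this, map_add]; rfl

theorem toL2_smul (r : ℝ) (c : C(Circ, ℝ)) : toL2 (r • c) = (r : ℂ) • toL2 c := by
  have : toComplex (r • c) = (r : ℂ) • toComplex c := by ext x; simp [toComplex]
  rw [toL2, this, map_smul]; rfl

theorem toL2_neg (c : C(Circ, ℝ)) : toL2 (-c) = -toL2 c := by
  have := toL2_smul (-1) c
  simpa using this

theorem toL2_sub (c d : C(Circ, ℝ)) : toL2 (c - d) = toL2 c - toL2 d := by
  rw [sub_eq_add_neg, toL2_add, toL2_neg, sub_eq_add_neg]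

theorem cc_add (c d : C(Circ, ℝ)) (n : ℤ) : cc (c + d) n = cc c n + cc d n := by
  simp [cc, toL2_add]

theorem cc_sub (c d : C(Circ, ℝ)) (n : ℤ) : cc (c - d) n = cc c n - cc d n := by
  simp [cc, toL2_sub]

theorem cc_neg (c : C(Circ, ℝ)) (n : ℤ) : cc (-c) n = -cc c n := by
  simp [cc, toL2_neg]

theorem cc_smul (r : ℝ) (c : C(Circ, ℝ)) (n : ℤ) : cc (r • c) n = r * cc c n := by
  rw [cc, toL2_smul, map_smul]; rfl

theorem norm_toComplex_le (c : C(Circ, ℝ)) : ‖toComplex c‖ ≤ ‖c‖ := by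
  rw [ContinuousMap.norm_le _ (norm_nonneg _)]
  intro x
  simpa [toComplex] using c.norm_coe_le_norm x

theorem norm_toL2_le (c : C(Circ, ℝ)) : ‖toL2 c‖ ≤ ‖c‖ := by
  refine le_trans ?_ (norm_toComplex_le c)
  refine (ContinuousLinearMap.le_opNorm _ _).trans ?_
  have := ContinuousMap.toLp_norm_le (p := 2) (μ := (AddCircle.haarAddCircle : Measure Circ))
    (𝕜 := ℂ) (E := ℂ)
  refine (mul_le_mul_of_nonneg_right this (norm_nonneg _)).trans ?_
  have h1 : measureUnivNNReal (AddCircle.haarAddCircle : Measure Circ) = 1 := by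
    simp [measureUnivNNReal]
  simp [h1]

theorem toL2_injective : Function.Injective toL2 := by
  intro c d h
  have h1 := ContinuousMap.toLp_injective (p := 2) (𝕜 := ℂ)
    (μ := (AddCircle.haarAddCircle : Measure Circ)) h
  ext x
  have := DFunLike.congr_fun h1 x
  simpa [toComplex] using this

theorem ext_cc {c d : C(Circ, ℝ)} (h : ∀ n, cc c n = cc d n) : c = d := by
  apply toL2_injective
  apply fourierBasis.repr.injective
  ext n
  exact h n

theorem norm_repr_le (f : L2per) (n : ℤ) : ‖fourierBasis.repr f n‖ ≤ ‖f‖ := by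
  have := lp.norm_apply_le_norm (by norm_num : (2 : ℝ≥0∞) ≠ 0) (fourierBasis.repr f) n
  simpa using this

theorem norm_cc_le (c : C(Circ, ℝ)) (n : ℤ) : ‖cc c n‖ ≤ ‖c‖ :=
  (norm_repr_le _ n).trans (norm_toL2_le c)

theorem hasSum_sq_repr (f : L2per) :
    HasSum (fun n => ‖fourierBasis.repr f n‖ ^ 2) (‖f‖ ^ 2) := by
  have := lp.hasSum_norm (by norm_num : 0 < (2 : ℝ≥0∞).toReal) (fourierBasis.repr f)
  simpa using this

theorem summable_sq_cc (c : C(Circ, ℝ)) : Summable (fun n => ‖cc c n‖ ^ 2) :=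
  (hasSum_sq_repr (toL2 c)).summable

theorem tsum_sq_cc_le (c : C(Circ, ℝ)) : ∑' n, ‖cc c n‖ ^ 2 ≤ ‖c‖ ^ 2 := by
  rw [show ∑' n, ‖cc c n‖ ^ 2 = ‖toL2 c‖ ^ 2 from (hasSum_sq_repr (toL2 c)).tsum_eq]
  exact pow_le_pow_left₀ (norm_nonneg _) (norm_toL2_le c) 2

theorem cc_neg_index (c : C(Circ, ℝ)) (n : ℤ) : cc c (-n) = (starRingEnd ℂ) (cc c n) := by
  rw [cc_eq_integral, cc_eq_integral, ← integral_conj]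
  congr 1
  ext x
  rw [map_mul, Complex.conj_ofReal, ← fourier_neg, neg_neg]

/-- The composition of a function on the circle with `x ↦ -x`. -/
def reflect (c : C(Circ, ℝ)) : C(Circ, ℝ) := ⟨fun x => c (-x), by fun_prop⟩

theorem cc_reflect (c : C(Circ, ℝ)) (n : ℤ) : cc (reflect c) n = cc c (-n) := by
  rw [cc_eq_integral, cc_eq_integral,
    ← integral_neg_eq_self (fun x : Circ => fourier (-n) x * (reflect c x : ℂ))]
  congr 1
  ext x
  simp [reflect, fourier_apply]

/-- The real part of the `n`-th Fourier coefficient, i.e. the `n`-th cosine coefficient. -/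
def coef (n : ℤ) : C(Circ, ℝ) →L[ℝ] ℝ :=
  LinearMap.mkContinuous
    { toFun := fun c => (cc c n).re
      map_add' := fun c d => by simp [cc_add]
      map_smul' := fun r c => by simp [cc_smul] } 1
    (fun c => by
      rw [one_mul]
      exact (Complex.abs_re_le_norm _).trans (norm_cc_le c n))

theorem coef_apply (n : ℤ) (c : C(Circ, ℝ)) : coef n c = (cc c n).re := rfl

theorem abs_coef_le (n : ℤ) (c : C(Circ, ℝ)) : |coef n c| ≤ ‖c‖ :=
  (Complex.abs_re_le_norm _).trans (norm_cc_le c n)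

theorem coef_neg_index (n : ℤ) (c : C(Circ, ℝ)) : coef (-n) c = coef n c := by
  rw [coef_apply, coef_apply, cc_neg_index, Complex.conj_re]

theorem cc_eq_coef {c : C(Circ, ℝ)} (h : ∀ x, c (-x) = c x) (n : ℤ) : cc c n = coef n c := by
  have h1 : reflect c = c := by ext x; exact h x
  have h2 : (starRingEnd ℂ) (cc c n) = cc c n := by
    rw [← cc_neg_index, ← cc_reflect, h1]
  rw [coef_apply]
  exact (Complex.conj_eq_iff_re.mp h2).symm

/-! ### Cosines and smoothing Fourier multipliers on even functions -/

/-- `x ↦ cos (n x)` on the circle. -/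
def cosN (n : ℤ) : C(Circ, ℝ) := ⟨fun x => (fourier n x : ℂ).re, by fun_prop⟩

theorem norm_cosN_le (n : ℤ) : ‖cosN n‖ ≤ 1 := by
  rw [ContinuousMap.norm_le _ zero_le_one]
  intro x
  refine (Complex.abs_re_le_norm _).trans ?_
  rw [fourier_apply]
  exact (Circle.norm_coe _).le

theorem cosN_zero_apply (n : ℤ) : cosN n 0 = 1 := by simp [cosN]

theorem repr_fourierLp (n m : ℤ) :
    fourierBasis.repr (fourierLp 2 n : L2per) m = if m = n then 1 else 0 := by
  rw [← coe_fourierBasis, HilbertBasis.repr_self, lp.single_apply]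
  simp [Pi.single_apply]

theorem toL2_cosN (n : ℤ) :
    toL2 (cosN n) = (1 / 2 : ℂ) • (fourierLp 2 n + fourierLp 2 (-n)) := by
  have h : toComplex (cosN n) = (1 / 2 : ℂ) • (fourier n + fourier (-n)) := by
    ext x
    have := Complex.re_eq_add_conj (fourier n x)
    simp only [toComplex, cosN, ContinuousMap.coe_mk, ContinuousMap.coe_smul,
      ContinuousMap.coe_add, Pi.smul_apply, Pi.add_apply, fourier_neg, smul_eq_mul]
    rw [this]; ring
  rw [toL2, h, map_smul, map_add]

theorem cc_cosN (n m : ℤ) :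
    cc (cosN n) m = (1 / 2) * ((if m = n then 1 else 0) + (if m = -n then 1 else 0)) := by
  rw [cc, toL2_cosN, map_smul, map_add]
  simp only [lp.coeFn_smul, lp.coeFn_add, Pi.smul_apply, Pi.add_apply, smul_eq_mul,
    repr_fourierLp]

theorem coef_cosN (n m : ℤ) :
    coef m (cosN n) = (1 / 2) * ((if m = n then 1 else 0) + (if m = -n then 1 else 0)) := by
  rw [coef_apply, cc_cosN]
  split_ifs <;> norm_num

theorem cosN_mul_cosN (n m : ℤ) :
    cosN n * cosN m = (1 / 2 : ℝ) • (cosN (n + m) + cosN (n - m)) := by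
  ext x
  have h1 : (fourier (n + m) x : ℂ) = fourier n x * fourier m x := fourier_add
  have h2 : (fourier (n - m) x : ℂ) = fourier n x * (starRingEnd ℂ) (fourier m x) := by
    rw [sub_eq_add_neg, fourier_add, fourier_neg]
  simp only [cosN, ContinuousMap.coe_mul, Pi.mul_apply, ContinuousMap.coe_mk,
    ContinuousMap.coe_smul, ContinuousMap.coe_add, Pi.smul_apply, Pi.add_apply, h1, h2,
    Complex.mul_re, Complex.conj_re, Complex.conj_im, smul_eq_mul]
  ring

theorem summable_inv_one_add_sq : Summable (fun n : ℤ => 1 / (1 + (n : ℝ) ^ 2)) := by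
  have h := (Real.summable_one_div_int_pow (p := 2)).mpr (by norm_num)
  refine Summable.of_norm_bounded_eventually h ?_
  filter_upwards [(Set.finite_singleton (0 : ℤ)).compl_mem_cofinite] with n hn
  have hn' : (n : ℝ) ≠ 0 := by simpa using hn
  rw [Real.norm_of_nonneg (by positivity)]
  exact one_div_le_one_div_of_le (by positivity) (by linarith)

/-- The sum of `1 / (1 + n²)` over the integers. -/
def sumInv : ℝ := ∑' n : ℤ, 1 / (1 + (n : ℝ) ^ 2)

theorem one_le_sumInv : 1 ≤ sumInv := by
  have := summable_inv_one_add_sq.le_tsum 0 (fun n _ => by positivity)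
  simpa [sumInv] using this

/-- A symbol that is even and decays quadratically with constant `C`. -/
structure IsSmoothing (s : ℤ → ℝ) (C : ℝ) : Prop where
  even : ∀ n, s (-n) = s n
  bound : ∀ n, |s n| ≤ C / (1 + (n : ℝ) ^ 2)

theorem IsSmoothing.nonneg {s : ℤ → ℝ} {C : ℝ} (h : IsSmoothing s C) : 0 ≤ C := by
  have := (abs_nonneg _).trans (h.bound 0)
  simpa using this

theorem IsSmoothing.norm_term_le {s : ℤ → ℝ} {C : ℝ} (h : IsSmoothing s C) (f : C(Circ, ℝ))
    (n : ℤ) : ‖(s n * coef n f) • cosN n‖ ≤ C * ‖f‖ * (1 / (1 + (n : ℝ) ^ 2)) := by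
  rw [norm_smul, Real.norm_eq_abs, abs_mul]
  have h0 := h.nonneg
  calc |s n| * |coef n f| * ‖cosN n‖ ≤ C / (1 + (n : ℝ) ^ 2) * ‖f‖ * 1 := by
        gcongr
        · exact h.bound n
        · exact abs_coef_le n f
        · exact norm_cosN_le n
    _ = _ := by ring

theorem IsSmoothing.summable {s : ℤ → ℝ} {C : ℝ} (h : IsSmoothing s C) (f : C(Circ, ℝ)) :
    Summable (fun n => (s n * coef n f) • cosN n) :=
  Summable.of_norm_bounded (summable_inv_one_add_sq.mul_left (C * ‖f‖)) (h.norm_term_le f)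

/-- The Fourier multiplier with symbol `s`, composed with the projection onto even functions. -/
def evenMul {s : ℤ → ℝ} {C : ℝ} (h : IsSmoothing s C) : C(Circ, ℝ) →L[ℝ] C(Circ, ℝ) :=
  LinearMap.mkContinuous
    { toFun := fun f => ∑' n : ℤ, (s n * coef n f) • cosN n
      map_add' := fun f g => by
        rw [← (h.summable f).tsum_add (h.summable g)]
        congr 1; ext1 n
        rw [map_add, mul_add, add_smul]
      map_smul' := fun r f => by
        rw [RingHom.id_apply, ← (h.summable f).tsum_const_smul]
        congr 1; ext1 n
        rw [map_smul, smul_smul, smul_eq_mul, mul_left_comm] } (C * sumInv)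
    (fun f => by
      refine (tsum_of_norm_bounded (summable_inv_one_add_sq.hasSum.mul_left (C * ‖f‖))
        (h.norm_term_le f)).trans ?_
      rw [mul_right_comm]; rfl)

theorem norm_evenMul_le {s : ℤ → ℝ} {C : ℝ} (h : IsSmoothing s C) (f : C(Circ, ℝ)) :
    ‖evenMul h f‖ ≤ C * sumInv * ‖f‖ :=
  (ContinuousLinearMap.le_opNorm _ _).trans <| mul_le_mul_of_nonneg_right
    (LinearMap.mkContinuous_norm_le _ (mul_nonneg h.nonneg (zero_le_one.trans one_le_sumInv)) _)
    (norm_nonneg _)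

/-- The functions `cosN m` and `cosN (-m)` coincide, so frequency m receives one half from each of
the terms m and -m; this is where evenness of the symbol is needed. At m = 0 both halves fall on the
same term, and the formula needs no separate case. -/
theorem coef_evenMul {s : ℤ → ℝ} {C : ℝ} (h : IsSmoothing s C) (f : C(Circ, ℝ)) (m : ℤ) :
    coef m (evenMul h f) = s m * coef m f := by
  have h1 := (h.summable f).hasSum.mapL (coef m)
  have h2 : (fun n => coef m ((s n * coef n f) • cosN n)) = fun n =>
      (if n = m then (1 / 2) * (s m * coef m f) else 0)
        + (if n = -m then (1 / 2) * (s m * coef m f) else 0) := by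
    ext n
    rw [map_smul, coef_cosN, smul_eq_mul, mul_add, mul_add]
    congr 1
    · by_cases hn : n = m
      · subst hn; simp; ring
      · simp [hn, Ne.symm hn]
    · by_cases hn : n = -m
      · subst hn
        rw [if_pos (by simp), if_pos rfl, h.even, coef_neg_index]; ring
      · have : m ≠ -n := fun h => hn (by rw [h, neg_neg])
        simp [hn, this]
  have h2' : HasSum (fun n => coef m ((s n * coef n f) • cosN n)) (coef m (evenMul h f)) := h1
  rw [h2] at h2'
  have h3 := (hasSum_ite_eq m ((1 / 2) * (s m * coef m f))).add
    (hasSum_ite_eq (-m) ((1 / 2) * (s m * coef m f)))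
  rw [h2'.unique h3]
  ring

theorem evenMul_neg_apply {s : ℤ → ℝ} {C : ℝ} (h : IsSmoothing s C) (f : C(Circ, ℝ)) (x : Circ) :
    evenMul h f (-x) = evenMul h f x := by
  have h1 : ∀ y : Circ, HasSum (fun n => ((s n * coef n f) • cosN n) y) (evenMul h f y) := fun y =>
    (h.summable f).hasSum.mapL (ContinuousMap.evalCLM ℝ y)
  refine (h1 (-x)).unique ?_
  convert h1 x using 2 with n
  simp [cosN, fourier_apply]

/-! ### The H² norm and its comparison with the sup norm -/

theorem h2Norm_eq (u : Profile) :
    h2Norm u = √(∑ j, ∑' n : ℤ, ((1 + (n : ℝ) ^ 2) * ‖cc (u j) n‖) ^ 2) := rfl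

/-- Turns a modewise bound into an H² bound by Parseval, after which sup norms suffice because Haar
measure is normalized. This allows the nonlinear analysis to stay in spaces of continuous functions.
-/
theorem h2Norm_le_of_coeff_le {w f g : Profile} {A B F G : ℝ} (hA : 0 ≤ A) (hB : 0 ≤ B)
    (hF : ∀ j, ‖f j‖ ≤ F) (hG : ∀ j, ‖g j‖ ≤ G)
    (h : ∀ j (n : ℤ), (1 + (n : ℝ) ^ 2) * ‖cc (w j) n‖ ≤ A * ‖cc (f j) n‖ + B * ‖cc (g j) n‖) :
    h2Norm w ≤ 2 * (A * F + B * G) := by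
  have hF0 : 0 ≤ F := (norm_nonneg _).trans (hF 0)
  have hG0 : 0 ≤ G := (norm_nonneg _).trans (hG 0)
  rw [h2Norm_eq]
  refine Real.sqrt_le_iff.mpr ⟨by positivity, ?_⟩
  have key : ∀ j, ∑' n : ℤ, ((1 + (n : ℝ) ^ 2) * ‖cc (w j) n‖) ^ 2
      ≤ 2 * A ^ 2 * F ^ 2 + 2 * B ^ 2 * G ^ 2 := by
    intro j
    have hs : Summable (fun n => 2 * A ^ 2 * ‖cc (f j) n‖ ^ 2 + 2 * B ^ 2 * ‖cc (g j) n‖ ^ 2) :=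
      ((summable_sq_cc (f j)).mul_left _).add ((summable_sq_cc (g j)).mul_left _)
    have hle : ∀ n : ℤ, ((1 + (n : ℝ) ^ 2) * ‖cc (w j) n‖) ^ 2
        ≤ 2 * A ^ 2 * ‖cc (f j) n‖ ^ 2 + 2 * B ^ 2 * ‖cc (g j) n‖ ^ 2 := by
      intro n
      refine (pow_le_pow_left₀ (by positivity) (h j n) 2).trans ?_
      nlinarith [sq_nonneg (A * ‖cc (f j) n‖ - B * ‖cc (g j) n‖)]
    have hs' := Summable.of_nonneg_of_le (fun n => by positivity) hle hs
    refine (hs'.tsum_le_tsum hle hs).trans ?_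
    rw [((summable_sq_cc (f j)).mul_left _).tsum_add ((summable_sq_cc (g j)).mul_left _),
      tsum_mul_left, tsum_mul_left]
    have h1 := (tsum_sq_cc_le (f j)).trans (pow_le_pow_left₀ (norm_nonneg _) (hF j) 2)
    have h2 := (tsum_sq_cc_le (g j)).trans (pow_le_pow_left₀ (norm_nonneg _) (hG j) 2)
    gcongr
  rw [Fin.sum_univ_two]
  have h0 := key 0
  have h1 := key 1
  have : 0 ≤ (A * F) * (B * G) := by positivity
  nlinarith

theorem summable_h2 {c : C(Circ, ℝ)} (hc : toL2 c ∈ H2per) :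
    Summable (fun n : ℤ => ((1 + (n : ℝ) ^ 2) * ‖cc c n‖) ^ 2) := by
  have h : Memℓp (fun n : ℤ => (1 + (n : ℂ) ^ 2) * cc c n) 2 := hc
  rw [memℓp_gen_iff (by norm_num)] at h
  convert h using 2 with n
  have e2 : ‖1 + (n : ℂ) ^ 2‖ = 1 + (n : ℝ) ^ 2 := by
    have : 1 + (n : ℂ) ^ 2 = ((1 + (n : ℝ) ^ 2 : ℝ) : ℂ) := by push_cast; ring
    rw [this, Complex.norm_real, Real.norm_of_nonneg (by positivity)]
  rw [norm_mul, e2]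
  norm_num

theorem norm_le_of_summable_cc {c : C(Circ, ℝ)} (h : Summable (fun n => ‖cc c n‖)) :
    ‖c‖ ≤ ∑' n, ‖cc c n‖ := by
  have hs : Summable (fourierCoeff (toComplex c)) := by
    refine Summable.of_norm ?_
    simpa only [cc_eq_fourierCoeff] using h
  rw [ContinuousMap.norm_le _ (tsum_nonneg fun n => norm_nonneg _)]
  intro x
  have h1 := has_pointwise_sum_fourier_series_of_summable hs x
  have h2 : ‖c x‖ = ‖toComplex c x‖ := by simp [toComplex]
  rw [h2]
  refine h1.norm_le_of_bounded h.hasSum (fun n => ?_)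
  rw [smul_eq_mul, norm_mul, cc_eq_fourierCoeff, fourier_apply, Circle.norm_coe, mul_one]

/-- The Sobolev embedding of H² into continuous functions: the Fourier series converges absolutely.
It carries an H²-small solution into the sup-norm setting of the reduction. -/
theorem norm_le_of_h2Norm_lt {u : Profile} (hu : ∀ j, toL2 (u j) ∈ H2per) {ρ : ℝ}
    (h : h2Norm u < ρ) (j : Fin 2) : ‖u j‖ ≤ ρ * sumInv := by
  have hρ : 0 < ρ := (Real.sqrt_nonneg _).trans_lt h
  have h1 : ∑' n : ℤ, ((1 + (n : ℝ) ^ 2) * ‖cc (u j) n‖) ^ 2 ≤ ρ ^ 2 := by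
    have h2 : ∑ j, ∑' n : ℤ, ((1 + (n : ℝ) ^ 2) * ‖cc (u j) n‖) ^ 2 < ρ ^ 2 := by
      rw [h2Norm_eq, Real.sqrt_lt' hρ] at h
      exact h
    refine le_trans ?_ h2.le
    exact Finset.single_le_sum
      (f := fun j => ∑' n : ℤ, ((1 + (n : ℝ) ^ 2) * ‖cc (u j) n‖) ^ 2)
      (fun i _ => tsum_nonneg fun n => by positivity) (Finset.mem_univ j)
  -- Young's inequality with weight ρ replaces Cauchy–Schwarz for series; summing gives ρ/2 +
  -- (ρ/2)·`sumInv`, and `sumInv` ≥ 1.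
  have hb : ∀ n : ℤ, ‖cc (u j) n‖ ≤ 1 / (2 * ρ) * ((1 + (n : ℝ) ^ 2) * ‖cc (u j) n‖) ^ 2
      + ρ / 2 * (1 / (1 + (n : ℝ) ^ 2)) := by
    intro n
    have hN : (1 : ℝ) ≤ 1 + (n : ℝ) ^ 2 := by nlinarith [sq_nonneg (n : ℝ)]
    set N := 1 + (n : ℝ) ^ 2
    set x := ‖cc (u j) n‖
    have h3 : ρ / 2 * (1 / N) ≥ ρ / 2 * (1 / N) ^ 2 := by
      have : 1 / N ≤ 1 := by rw [div_le_one (by linarith)]; exact hN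
      have : 0 ≤ 1 / N := by positivity
      have : (1 / N) ^ 2 ≤ 1 / N := by nlinarith
      gcongr
    have h4 : 1 / (2 * ρ) * (N * x) ^ 2 + ρ / 2 * (1 / N) ^ 2 - x
        = 1 / (2 * ρ) * (N * x - ρ / N) ^ 2 := by
      field_simp; ring
    have h5 : 0 ≤ 1 / (2 * ρ) * (N * x - ρ / N) ^ 2 := by positivity
    linarith
  have hs : Summable (fun n : ℤ => 1 / (2 * ρ) * ((1 + (n : ℝ) ^ 2) * ‖cc (u j) n‖) ^ 2
      + ρ / 2 * (1 / (1 + (n : ℝ) ^ 2))) :=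
    ((summable_h2 (hu j)).mul_left _).add (summable_inv_one_add_sq.mul_left _)
  have hs' : Summable (fun n => ‖cc (u j) n‖) :=
    Summable.of_nonneg_of_le (fun n => norm_nonneg _) hb hs
  refine (norm_le_of_summable_cc hs').trans ((hs'.tsum_le_tsum hb hs).trans ?_)
  rw [((summable_h2 (hu j)).mul_left _).tsum_add (summable_inv_one_add_sq.mul_left _),
    tsum_mul_left, tsum_mul_left]
  have h6 : 1 / (2 * ρ) * ∑' n : ℤ, ((1 + (n : ℝ) ^ 2) * ‖cc (u j) n‖) ^ 2 ≤ ρ / 2 := by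
    calc _ ≤ 1 / (2 * ρ) * ρ ^ 2 := by gcongr
      _ = ρ / 2 := by field_simp
  have h7 := one_le_sumInv
  change _ + ρ / 2 * sumInv ≤ _
  nlinarith

/-! ### The wave number and the profile equation mode by mode -/

theorem waveNumber_pos (ε ω : ℝ) : 0 < waveNumber ε ω := by
  have h : |2 * ε * ω| < √(4 * ε ^ 2 * ω ^ 2 + 1) := by
    apply Real.lt_sqrt_of_sq_lt
    rw [sq_abs]; nlinarith
  have := neg_abs_le (2 * ε * ω)
  unfold waveNumber
  linarith

/-- The wave number is the positive root of 4k² - 8εωk - 1 = 0. All later information about k comes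
from this relation. -/
theorem four_mul_waveNumber_sq_sub_one (ε ω : ℝ) :
    4 * waveNumber ε ω ^ 2 - 1 = 8 * ε * ω * waveNumber ε ω := by
  have h := Real.sq_sqrt (show 0 ≤ 4 * ε ^ 2 * ω ^ 2 + 1 by positivity)
  unfold waveNumber
  nlinarith

theorem diffusion_pos (j : Fin 2) : 0 < diffusion j := by
  fin_cases j <;> simp [diffusion]

theorem repr_blochD2 (σ : ℝ) (f : H2per) (n : ℤ) :
    fourierBasis.repr (blochD2 σ f) n = -((n : ℂ) + σ) ^ 2 * fourierBasis.repr (f : L2per) n := by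
  simp [blochD2]

/-- Elliptic regularity at the level of coefficients: (1 + n²) times the coefficient of c is a
combination of the coefficients of c and g, both square summable. -/
theorem toL2_mem_H2per {c g : C(Circ, ℝ)} {r : ℝ} (hr : 0 < r)
    (h : ∀ n : ℤ, ((r * (n : ℝ) ^ 2 : ℝ) : ℂ) * cc c n = cc g n) : toL2 c ∈ H2per := by
  have h1 : Memℓp (fun n : ℤ => cc c n) 2 := lp.memℓp (fourierBasis.repr (toL2 c))
  have h2 : Memℓp (fun n : ℤ => cc g n) 2 := lp.memℓp (fourierBasis.repr (toL2 g))
  have h3 := h1.add (h2.const_mul (r : ℂ)⁻¹)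
  change Memℓp (fun n : ℤ => (1 + (n : ℂ) ^ 2) * cc c n) 2
  convert h3 using 1
  ext n
  simp only [Pi.add_apply]
  rw [← h n, Complex.ofReal_mul r ((n : ℝ) ^ 2), mul_assoc,
    inv_mul_cancel_left₀ (by exact_mod_cast hr.ne')]
  push_cast
  ring

theorem isSteady_iff (ε ω : ℝ) (u : Profile) : IsSteady ε ω u ↔ ∀ j (n : ℤ),
    ((waveNumber ε ω ^ 2 * diffusion j * (n : ℝ) ^ 2 : ℝ) : ℂ) * cc (u j) n
      = cc (reactionAlong (ε ^ 2) u j) n := by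
  have hcoef : ∀ (hu : ∀ j, toL2 (u j) ∈ H2per) (j : Fin 2) (n : ℤ), fourierBasis.repr
      (((waveNumber ε ω ^ 2 * diffusion j : ℝ) : ℂ) • blochD2 0 ⟨toL2 (u j), hu j⟩
      + toL2 (reactionAlong (ε ^ 2) u j)) n =
      cc (reactionAlong (ε ^ 2) u j) n
        - ((waveNumber ε ω ^ 2 * diffusion j * (n : ℝ) ^ 2 : ℝ) : ℂ) * cc (u j) n := by
    intro hu j n
    rw [map_add, map_smul]
    simp only [lp.coeFn_add, lp.coeFn_smul, Pi.add_apply, Pi.smul_apply, repr_blochD2,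
      smul_eq_mul]
    rw [show fourierBasis.repr (toL2 (u j)) n = cc (u j) n from rfl,
      show fourierBasis.repr (toL2 (reactionAlong (ε ^ 2) u j)) n
        = cc (reactionAlong (ε ^ 2) u j) n from rfl]
    push_cast
    ring
  constructor
  · rintro ⟨hu, h⟩ j n
    have h1 := hcoef hu j n
    rw [h j] at h1
    simp only [map_zero, lp.coeFn_zero, Pi.zero_apply] at h1
    linear_combination h1
  · intro h
    have hu : ∀ j, toL2 (u j) ∈ H2per := fun j => toL2_mem_H2per
      (mul_pos (pow_pos (waveNumber_pos ε ω) 2) (diffusion_pos j)) (h j)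
    refine ⟨hu, fun j => fourierBasis.repr.injective ?_⟩
    ext n
    rw [hcoef hu j n, h j n]
    simp

/-! ### Linear part at the trivial state and its partial inverse -/

/-- The quadratic part of the nonlinearity, with coefficient `β` in front of `u₁²`. -/
def quadPart (β : ℝ) (u : Profile) : C(Circ, ℝ) := β • (u 0 * u 0) + (4 : ℝ) • (u 0 * u 1)

/-- The cubic part of the nonlinearity. -/
def cubicPart (u : Profile) : C(Circ, ℝ) := u 0 * u 0 * u 1

theorem reactionAlong_zero (b : ℝ) (u : Profile) : reactionAlong b u 0 =
    (b + 3) • u 0 + (4 : ℝ) • u 1 + (quadPart (b / 2 + 2) u + cubicPart u) := by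
  ext x
  simp [reactionAlong, reaction, quadPart, cubicPart]
  ring

theorem reactionAlong_one (b : ℝ) (u : Profile) : reactionAlong b u 1 =
    -((b + 4) • u 0 + (4 : ℝ) • u 1 + (quadPart (b / 2 + 2) u + cubicPart u)) := by
  ext x
  simp [reactionAlong, reaction, quadPart, cubicPart]
  ring

/-- The parameters `b = ε²` and `t = k²` are close to their values `0` and `1 / 4` at onset. -/
structure NearOnset (b t : ℝ) : Prop where
  b_nonneg : 0 ≤ b
  b_le : b ≤ 1 / 100
  le_t : 24 / 100 ≤ t
  t_le : t ≤ 26 / 100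

/-- The reduced scalar symbol of the linearization at the trivial state. -/
def dSym (b t : ℝ) (n : ℤ) : ℝ := b + 2 - 4 * (t * (n : ℝ) ^ 2) - 1 / (4 * (t * (n : ℝ) ^ 2))

/-- The ratio of the second and the first component in the `n`-th mode. -/
def mSym (t : ℝ) (n : ℤ) : ℝ := -(1 / 4 + 1 / (16 * (t * (n : ℝ) ^ 2)))

/-- Adding the two equations cancels y and Q on the right and leaves 4κx + 16κy = -x, which
determines y from x. Substituting back gives the scalar equation. -/
theorem mode_iff {b κ x y Q : ℝ} (hκ : 0 < κ) :
    (4 * κ * x = (b + 3) * x + 4 * y + Q ∧ 16 * κ * y = -((b + 4) * x + 4 * y + Q)) ↔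
      y = -(1 / 4 + 1 / (16 * κ)) * x ∧ (b + 2 - 4 * κ - 1 / (4 * κ)) * x + Q = 0 := by
  have e1 : 1 / (16 * κ) * (16 * κ) = 1 := by field_simp
  have e2 : 1 / (4 * κ) = 4 * (1 / (16 * κ)) := by field_simp; norm_num
  rw [e2]
  set r := 1 / (16 * κ)
  constructor
  · rintro ⟨h1, h2⟩
    have hy : y = -(1 / 4 + r) * x := by
      have : 16 * κ * y = -(1 + 4 * κ) * x := by linarith
      linear_combination r * this + (-y - x / 4) * e1
    refine ⟨hy, ?_⟩
    rw [hy] at h1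
    linear_combination -h1
  · rintro ⟨hy, h⟩
    have h1 : 4 * κ * x = (b + 3) * x + 4 * y + Q := by rw [hy]; linear_combination -h
    refine ⟨h1, ?_⟩
    have : 16 * κ * y = -(1 + 4 * κ) * x := by
      rw [hy]; linear_combination (-x) * e1
    linarith

theorem four_le_sq {n : ℤ} (h0 : n ≠ 0) (h1 : n ≠ 1) (h2 : n ≠ -1) : (4 : ℝ) ≤ (n : ℝ) ^ 2 := by
  have : 2 ≤ |n| := by
    rcases abs_cases n with ⟨h, _⟩ | ⟨h, _⟩ <;> omega
  have h4 : (4 : ℤ) ≤ n ^ 2 := by rw [← sq_abs]; nlinarith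
  exact_mod_cast h4

/-- Even without the favourable term -1/(4tn²), the part -4tn² outweighs b + 2 once n² ≥ 4. The
constant 1/4 is the source of the smoothing constant 4 below. -/
theorem dSym_le {b t : ℝ} (h : NearOnset b t) {n : ℤ} (hn : (4 : ℝ) ≤ (n : ℝ) ^ 2) :
    dSym b t n ≤ -((1 + (n : ℝ) ^ 2) / 4) := by
  obtain ⟨hb0, hb, ht, ht'⟩ := h
  unfold dSym
  have h2 : 0 ≤ 1 / (4 * (t * (n : ℝ) ^ 2)) := by positivity
  have h3 : 24 / 100 * (n : ℝ) ^ 2 ≤ t * (n : ℝ) ^ 2 := by gcongr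
  have h4 : 4 * (t * (n : ℝ) ^ 2) * (1 / (4 * (t * (n : ℝ) ^ 2))) = 1 := by
    have : 0 < t * (n : ℝ) ^ 2 := by nlinarith
    exact mul_one_div_cancel (by positivity)
  nlinarith

theorem abs_mSym_le {b t : ℝ} (h : NearOnset b t) {n : ℤ} (hn : n ≠ 0) : |mSym t n| ≤ 1 := by
  obtain ⟨hb0, hb, ht, ht'⟩ := h
  have hn' : (1 : ℝ) ≤ (n : ℝ) ^ 2 := by
    have : (1 : ℤ) ≤ n ^ 2 := by have := sq_pos_of_ne_zero hn; omega
    exact_mod_cast this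
  have h2 : 0 ≤ 1 / (16 * (t * (n : ℝ) ^ 2)) := by positivity
  have h3 : 1 / (16 * (t * (n : ℝ) ^ 2)) ≤ 1 / 2 := by
    apply one_div_le_one_div_of_le (by norm_num)
    nlinarith
  rw [mSym, abs_neg, abs_of_nonneg (by linarith)]
  linarith

/-- The symbol of the partial inverse: first component. -/
def invSym₀ (b t : ℝ) (n : ℤ) : ℝ :=
  if n = 0 ∨ n = 1 ∨ n = -1 then 0 else -(1 / dSym b t n)

/-- The symbol of the partial inverse: second component. -/
def invSym₁ (b t : ℝ) (n : ℤ) : ℝ :=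
  if n = 0 then -(1 / 4) else if n = 1 ∨ n = -1 then 0 else -(mSym t n / dSym b t n)

theorem dSym_neg (b t : ℝ) (n : ℤ) : dSym b t (-n) = dSym b t n := by simp [dSym]

theorem mSym_neg (t : ℝ) (n : ℤ) : mSym t (-n) = mSym t n := by simp [mSym]

theorem isSmoothing_invSym₀ {b t : ℝ} (h : NearOnset b t) : IsSmoothing (invSym₀ b t) 4 where
  even n := by
    have : (-n = 0 ∨ -n = 1 ∨ -n = -1) ↔ (n = 0 ∨ n = 1 ∨ n = -1) := by omega
    simp only [invSym₀, this, dSym_neg]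
  bound n := by
    unfold invSym₀
    split_ifs with hn
    · simp; positivity
    · push Not at hn
      have h1 := dSym_le h (four_le_sq hn.1 hn.2.1 hn.2.2)
      have h2 : 0 < (1 + (n : ℝ) ^ 2) / 4 := by positivity
      rw [abs_neg, abs_div, abs_one, abs_of_neg (by linarith),
        show 4 / (1 + (n : ℝ) ^ 2) = 1 / ((1 + (n : ℝ) ^ 2) / 4) by field_simp]
      exact one_div_le_one_div_of_le h2 (by linarith)

theorem isSmoothing_invSym₁ {b t : ℝ} (h : NearOnset b t) : IsSmoothing (invSym₁ b t) 4 where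
  even n := by
    have : (-n = 1 ∨ -n = -1) ↔ (n = 1 ∨ n = -1) := by omega
    simp only [invSym₁, this, dSym_neg, mSym_neg, neg_eq_zero]
  bound n := by
    unfold invSym₁
    split_ifs with hn hn'
    · subst hn; norm_num
    · simp; positivity
    · push Not at hn'
      have h1 := dSym_le h (four_le_sq hn hn'.1 hn'.2)
      have h2 : 0 < (1 + (n : ℝ) ^ 2) / 4 := by positivity
      rw [abs_neg, abs_div, abs_of_neg (a := dSym b t n) (by linarith),
        show 4 / (1 + (n : ℝ) ^ 2) = 1 / ((1 + (n : ℝ) ^ 2) / 4) by field_simp]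
      exact div_le_div₀ zero_le_one (abs_mSym_le h hn) h2 (by linarith)

/-- The partial inverse of the linearization at the trivial state, acting on `(1, -1)`-directed
right-hand sides, on the modes other than `±1`. -/
def partialInv {b t : ℝ} (h : NearOnset b t) : C(Circ, ℝ) →L[ℝ] Profile :=
  ContinuousLinearMap.pi (Fin.cons (evenMul (isSmoothing_invSym₀ h))
    (fun _ => evenMul (isSmoothing_invSym₁ h)))

theorem partialInv_zero {b t : ℝ} (h : NearOnset b t) (f : C(Circ, ℝ)) :
    partialInv h f 0 = evenMul (isSmoothing_invSym₀ h) f := rfl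

theorem partialInv_one {b t : ℝ} (h : NearOnset b t) (f : C(Circ, ℝ)) :
    partialInv h f 1 = evenMul (isSmoothing_invSym₁ h) f := rfl

theorem norm_partialInv_le {b t : ℝ} (h : NearOnset b t) (f : C(Circ, ℝ)) :
    ‖partialInv h f‖ ≤ 4 * sumInv * ‖f‖ := by
  have h0 : 0 ≤ 4 * sumInv * ‖f‖ := by
    have := one_le_sumInv
    positivity
  rw [pi_norm_le_iff_of_nonneg h0]
  intro j
  fin_cases j
  · exact norm_evenMul_le (isSmoothing_invSym₀ h) f
  · exact norm_evenMul_le (isSmoothing_invSym₁ h) f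

/-! ### Lyapunov–Schmidt reduction on even profiles -/

/-- The critical mode `cos x (1, m)`. -/
def critMode (m : ℝ) : Profile := ![cosN 1, m • cosN 1]

theorem coef_cosN_one (n : ℤ) : coef n (cosN 1) = if n = 1 ∨ n = -1 then 1 / 2 else 0 := by
  rw [coef_cosN]
  by_cases h1 : n = 1
  · subst h1; norm_num
  · by_cases h2 : n = -1
    · subst h2; norm_num
    · simp [h1, h2]

theorem cosN_neg_apply (n : ℤ) (x : Circ) : cosN n (-x) = cosN n x := by
  simp [cosN, fourier_apply]

/-- The mode equations of the profile equation with `b = ε²`, `t = k²`. -/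
def ModeEq (b t : ℝ) (u : Profile) : Prop := ∀ j (n : ℤ),
    ((t * diffusion j * (n : ℝ) ^ 2 : ℝ) : ℂ) * cc (u j) n = cc (reactionAlong b u j) n

/-- Evenness makes all Fourier coefficients real, so the complex system is equivalent to its real
part. -/
theorem modeEq_iff_of_even {b t : ℝ} {u : Profile} (hu : ∀ j x, u j (-x) = u j x) :
    ModeEq b t u ↔ ∀ n : ℤ,
      (4 * (t * (n : ℝ) ^ 2) * coef n (u 0) = (b + 3) * coef n (u 0) + 4 * coef n (u 1)
        + coef n (quadPart (b / 2 + 2) u + cubicPart u) ∧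
      16 * (t * (n : ℝ) ^ 2) * coef n (u 1) = -((b + 4) * coef n (u 0) + 4 * coef n (u 1)
        + coef n (quadPart (b / 2 + 2) u + cubicPart u))) := by
  have hq : ∀ x, (quadPart (b / 2 + 2) u + cubicPart u) (-x)
      = (quadPart (b / 2 + 2) u + cubicPart u) x := by
    intro x; simp [quadPart, cubicPart, hu]
  have e0 : ∀ n, cc (reactionAlong b u 0) n = (((b + 3) * coef n (u 0) + 4 * coef n (u 1)
        + coef n (quadPart (b / 2 + 2) u + cubicPart u) : ℝ) : ℂ) := by
    intro n
    rw [reactionAlong_zero, cc_add, cc_add, cc_smul, cc_smul, cc_eq_coef (hu 0),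
      cc_eq_coef (hu 1), cc_eq_coef hq]
    push_cast; ring
  have e1 : ∀ n, cc (reactionAlong b u 1) n = ((-((b + 4) * coef n (u 0) + 4 * coef n (u 1)
        + coef n (quadPart (b / 2 + 2) u + cubicPart u)) : ℝ) : ℂ) := by
    intro n
    rw [reactionAlong_one, cc_neg, cc_add, cc_add, cc_smul, cc_smul, cc_eq_coef (hu 0),
      cc_eq_coef (hu 1), cc_eq_coef hq]
    push_cast; ring
  unfold ModeEq
  rw [Fin.forall_fin_two, ← forall_and]
  refine forall_congr' fun n => ?_
  rw [e0, e1, cc_eq_coef (hu 0), cc_eq_coef (hu 1), ← Complex.ofReal_mul, ← Complex.ofReal_mul,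
    Complex.ofReal_inj, Complex.ofReal_inj]
  have d0 : diffusion 0 = 4 := rfl
  have d1 : diffusion 1 = 16 := rfl
  rw [d0, d1, show t * 4 * (n : ℝ) ^ 2 = 4 * (t * (n : ℝ) ^ 2) by ring,
    show t * 16 * (n : ℝ) ^ 2 = 16 * (t * (n : ℝ) ^ 2) by ring]

/-- The forced linear mode equations for an even profile, solved by Lyapunov–Schmidt reduction. -/
theorem forced_modes_iff {b t : ℝ} (h : NearOnset b t) {u : Profile}
    (hu : ∀ j x, u j (-x) = u j x) (q : C(Circ, ℝ)) :
    (∀ n : ℤ,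
      (4 * (t * (n : ℝ) ^ 2) * coef n (u 0) = (b + 3) * coef n (u 0) + 4 * coef n (u 1)
        + coef n q ∧
      16 * (t * (n : ℝ) ^ 2) * coef n (u 1) = -((b + 4) * coef n (u 0) + 4 * coef n (u 1)
        + coef n q))) ↔ ∃ a : ℝ,
      u = a • critMode (mSym t 1) + partialInv h q ∧ dSym b t 1 * a + 2 * coef 1 q = 0 := by
  have hc0 : ∀ (a : ℝ) n, coef n ((a • critMode (mSym t 1) + partialInv h q) 0)
      = a * (if n = 1 ∨ n = -1 then 1 / 2 else 0) + invSym₀ b t n * coef n q := by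
    intro a n
    simp only [Pi.add_apply, Pi.smul_apply, map_add, map_smul, partialInv_zero, coef_evenMul,
      critMode, Matrix.cons_val_zero, coef_cosN_one, smul_eq_mul]
  have hc1 : ∀ (a : ℝ) n, coef n ((a • critMode (mSym t 1) + partialInv h q) 1)
      = a * (mSym t 1 * (if n = 1 ∨ n = -1 then 1 / 2 else 0)) + invSym₁ b t n * coef n q := by
    intro a n
    simp only [Pi.add_apply, Pi.smul_apply, map_add, map_smul, partialInv_one, coef_evenMul,
      critMode, Matrix.cons_val_one, Matrix.cons_val_fin_one, coef_cosN_one, smul_eq_mul]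
  have hne : ∀ n : ℤ, n ≠ 0 → 0 < t * (n : ℝ) ^ 2 := by
    intro n hn
    have : (0 : ℝ) < (n : ℝ) ^ 2 := by positivity
    have := h.le_t
    positivity
  constructor
  -- The amplitude is twice the first coefficient because cos ξ has coefficient 1/2 at n = ±1; the
  -- same factor 2 multiplies the forcing in the reduced equation.
  · intro H
    refine ⟨2 * coef 1 (u 0), ?_, ?_⟩
    · have heven : ∀ j x, (((2 * coef 1 (u 0)) • critMode (mSym t 1) + partialInv h q) j) (-x)
          = (((2 * coef 1 (u 0)) • critMode (mSym t 1) + partialInv h q) j) x := by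
        intro j x
        fin_cases j
        · simp [critMode, partialInv_zero, evenMul_neg_apply, cosN_neg_apply]
        · simp [critMode, partialInv_one, evenMul_neg_apply, cosN_neg_apply]
      have hmain : ∀ n : ℤ,
          coef n (u 0) = coef n (((2 * coef 1 (u 0)) • critMode (mSym t 1) + partialInv h q) 0) ∧
          coef n (u 1)
            = coef n (((2 * coef 1 (u 0)) • critMode (mSym t 1) + partialInv h q) 1) := by
        intro n
        rw [hc0, hc1]
        obtain ⟨H1, H2⟩ := H n
        by_cases hn : n = 0
        · subst hn
          simp only [invSym₀, invSym₁]
          norm_num at H1 H2 ⊢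
          -- In mode 0 the sum of the two equations kills the first component, and the second is
          -- minus a quarter of the forcing; this is the value -1/4 in `invSym₁`.
          have H6 : coef 0 (u 0) = 0 := by linarith
          rw [H6] at H1
          exact ⟨H6, by linarith⟩
        · obtain ⟨H3, H4⟩ := (mode_iff (hne n hn)).mp ⟨H1, H2⟩
          by_cases hn1 : n = 1 ∨ n = -1
          · have e1 : coef n (u 0) = coef 1 (u 0) := by
              rcases hn1 with h | h
              · rw [h]
              · rw [h, coef_neg_index]
            have e2 : mSym t 1 = -(1 / 4 + 1 / (16 * (t * (n : ℝ) ^ 2))) := by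
              rcases hn1 with h | h <;> simp [mSym, h]
            rw [if_pos hn1, invSym₀, if_pos (Or.inr hn1), invSym₁, if_neg hn, if_pos hn1, ← e1]
            refine ⟨by ring, ?_⟩
            rw [H3, e2]; ring
          · have hn2 := hn1
            push Not at hn2
            have hd := dSym_le h (four_le_sq hn hn2.1 hn2.2)
            have hd0 : dSym b t n ≠ 0 := by
              have : 0 < (1 + (n : ℝ) ^ 2) / 4 := by positivity
              linarith
            rw [if_neg hn1, invSym₀, if_neg (by tauto), invSym₁, if_neg hn, if_neg hn1]
            have H5 : coef n (u 0) = -(1 / dSym b t n) * coef n q := by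
              have : dSym b t n * coef n (u 0) + coef n q = 0 := H4
              field_simp
              linarith
            refine ⟨by rw [H5]; ring, ?_⟩
            rw [show coef n (u 1) = mSym t n * coef n (u 0) from H3, H5]
            ring
      funext j
      refine ext_cc fun n => ?_
      rw [cc_eq_coef (hu j), cc_eq_coef (heven j)]
      fin_cases j
      · exact congrArg _ (hmain n).1
      · exact congrArg _ (hmain n).2
    · obtain ⟨_, H4⟩ := (mode_iff (hne 1 one_ne_zero)).mp (H 1)
      have : dSym b t 1 * coef 1 (u 0) + coef 1 q = 0 := H4
      linarith
  · rintro ⟨a, H, Hr⟩ n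
    have h0 : coef n (u 0) = a * (if n = 1 ∨ n = -1 then 1 / 2 else 0)
        + invSym₀ b t n * coef n q := by rw [← hc0, ← H]
    have h1 : coef n (u 1) = a * (mSym t 1 * (if n = 1 ∨ n = -1 then 1 / 2 else 0))
        + invSym₁ b t n * coef n q := by rw [← hc1, ← H]
    rw [h0, h1]
    by_cases hn : n = 0
    · subst hn
      simp only [invSym₀, invSym₁]
      norm_num
      constructor <;> ring
    · rw [mode_iff (hne n hn)]
      by_cases hn1 : n = 1 ∨ n = -1
      · have e2 : mSym t 1 = -(1 / 4 + 1 / (16 * (t * (n : ℝ) ^ 2))) := by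
          rcases hn1 with h | h <;> simp [mSym, h]
        have e3 : dSym b t 1 = b + 2 - 4 * (t * (n : ℝ) ^ 2) - 1 / (4 * (t * (n : ℝ) ^ 2)) := by
          rcases hn1 with h | h <;> simp [dSym, h]
        have e4 : coef n q = coef 1 q := by
          rcases hn1 with h | h
          · rw [h]
          · rw [h, coef_neg_index]
        rw [if_pos hn1, invSym₀, if_pos (Or.inr hn1), invSym₁, if_neg hn, if_pos hn1, ← e2, ← e3,
          e4]
        refine ⟨by ring, by linarith⟩
      · have hn2 := hn1
        push Not at hn2
        have hd := dSym_le h (four_le_sq hn hn2.1 hn2.2)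
        have hd0 : dSym b t n ≠ 0 := by
          have : 0 < (1 + (n : ℝ) ^ 2) / 4 := by positivity
          linarith
        rw [if_neg hn1, invSym₀, if_neg (by tauto), invSym₁, if_neg hn, if_neg hn1]
        change _ = mSym t n * _ ∧ dSym b t n * _ + _ = 0
        refine ⟨by ring, ?_⟩
        field_simp
        ring

/-- Lyapunov–Schmidt reduction: an even profile solves the mode equations iff it solves the fixed
point equation and the reduced equation with amplitude `a`. -/
theorem modeEq_iff_reduced {b t : ℝ} (h : NearOnset b t) {u : Profile}
    (hu : ∀ j x, u j (-x) = u j x) : ModeEq b t u ↔ ∃ a : ℝ,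
      u = a • critMode (mSym t 1) + partialInv h (quadPart (b / 2 + 2) u + cubicPart u) ∧
      dSym b t 1 * a + 2 * coef 1 (quadPart (b / 2 + 2) u + cubicPart u) = 0 := by
  rw [modeEq_iff_of_even hu, forced_modes_iff h hu]

/-! ### The contraction principle and estimates for the nonlinearity -/

/-- Banach's theorem on a ball about the origin. It is used for the correction ψ of the branch and
again for the nonzero-parity-selected eigenvalue equation in `AlmostKernel.spectrum_eq`. -/
theorem exists_fixedPoint_of_norm_le {E : Type*} [NormedAddCommGroup E] [CompleteSpace E]
    (F : E → E) {r : ℝ} (hr : 0 ≤ r) (hmaps : ∀ x, ‖x‖ ≤ r → ‖F x‖ ≤ r)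
    (hlip : ∀ x y, ‖x‖ ≤ r → ‖y‖ ≤ r → ‖F x - F y‖ ≤ 1 / 2 * ‖x - y‖) :
    ∃ x, ‖x‖ ≤ r ∧ F x = x := by
  have hm : Set.MapsTo F (Metric.closedBall 0 r) (Metric.closedBall 0 r) := by
    intro x hx
    rw [mem_closedBall_zero_iff] at hx ⊢
    exact hmaps x hx
  have hc : ContractingWith (1 / 2) (hm.restrict F _ _) := by
    refine ⟨by rw [← NNReal.coe_lt_coe]; norm_num, LipschitzWith.of_dist_le_mul fun x y => ?_⟩
    have := hlip x y (mem_closedBall_zero_iff.mp x.2) (mem_closedBall_zero_iff.mp y.2)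
    rw [Subtype.dist_eq, Subtype.dist_eq, dist_eq_norm, dist_eq_norm]
    simpa using this
  obtain ⟨y, hy, hfix, -⟩ := ContractingWith.exists_fixedPoint' Metric.isClosed_closedBall.isComplete
    hm hc (x := 0) (mem_closedBall_zero_iff.mpr (by simpa using hr)) (edist_ne_top _ _)
  exact ⟨y, mem_closedBall_zero_iff.mp hy, hfix⟩

/-- The polarization of the quadratic part of the nonlinearity. -/
def polarPart (β : ℝ) (u w : Profile) : C(Circ, ℝ) :=
  (2 * β) • (u 0 * w 0) + (4 : ℝ) • (u 0 * w 1 + u 1 * w 0)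

theorem quadPart_add_smul (β a : ℝ) (u w : Profile) :
    quadPart β (u + a • w) = quadPart β u + a • polarPart β u w + a ^ 2 • quadPart β w := by
  ext x
  simp [quadPart, polarPart]
  ring

theorem quadPart_smul (β a : ℝ) (u : Profile) : quadPart β (a • u) = a ^ 2 • quadPart β u := by
  ext x
  simp [quadPart]
  ring

theorem cubicPart_smul (a : ℝ) (u : Profile) : cubicPart (a • u) = a ^ 3 • cubicPart u := by
  ext x
  simp [cubicPart]
  ring

theorem polarPart_sub (β : ℝ) (u w w' : Profile) :
    polarPart β u w - polarPart β u w' = polarPart β u (w - w') := by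
  ext x
  simp [polarPart]
  ring

theorem norm_mul_le_of_le' {f g : C(Circ, ℝ)} {A B : ℝ} (hf : ‖f‖ ≤ A) (hg : ‖g‖ ≤ B) :
    ‖f * g‖ ≤ A * B :=
  (norm_mul_le _ _).trans (mul_le_mul hf hg (norm_nonneg _) ((norm_nonneg _).trans hf))

theorem norm_polarPart_le {β : ℝ} (hβ : |β| ≤ 3) {u w : Profile} {A B : ℝ} (hu : ‖u‖ ≤ A)
    (hw : ‖w‖ ≤ B) : ‖polarPart β u w‖ ≤ 14 * (A * B) := by
  have hu' := fun j => (norm_le_pi_norm u j).trans hu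
  have hw' := fun j => (norm_le_pi_norm w j).trans hw
  have h1 := norm_mul_le_of_le' (hu' 0) (hw' 0)
  have h2 := norm_mul_le_of_le' (hu' 0) (hw' 1)
  have h3 := norm_mul_le_of_le' (hu' 1) (hw' 0)
  refine (norm_add_le _ _).trans ?_
  rw [norm_smul, norm_smul, Real.norm_eq_abs, Real.norm_eq_abs, abs_mul]
  have h4 := norm_add_le (u 0 * w 1) (u 1 * w 0)
  have h5 : |(2 : ℝ)| * |β| * ‖u 0 * w 0‖ ≤ 6 * (A * B) := by
    rw [abs_two]
    exact mul_le_mul (by linarith) h1 (norm_nonneg _) (by norm_num)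
  rw [abs_of_pos (by norm_num : (0 : ℝ) < 4)]
  linarith

theorem norm_quadPart_sub_le {β : ℝ} (hβ : |β| ≤ 3) {u w : Profile} {r : ℝ} (hu : ‖u‖ ≤ r)
    (hw : ‖w‖ ≤ r) : ‖quadPart β u - quadPart β w‖ ≤ 14 * r * ‖u - w‖ := by
  have h : quadPart β u - quadPart β w = polarPart β ((1 / 2 : ℝ) • (u + w)) (u - w) := by
    ext x
    simp [quadPart, polarPart]
    ring
  rw [h, mul_assoc]
  refine norm_polarPart_le hβ ?_ le_rfl
  rw [norm_smul]
  have := norm_add_le u w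
  norm_num
  linarith

theorem norm_cubicPart_sub_le {u w : Profile} {r : ℝ} (hu : ‖u‖ ≤ r) (hw : ‖w‖ ≤ r) :
    ‖cubicPart u - cubicPart w‖ ≤ 3 * r ^ 2 * ‖u - w‖ := by
  have h : cubicPart u - cubicPart w = (u 0 * u 0) * ((u - w) 1)
      + (u 0 * w 1) * ((u - w) 0) + (w 0 * w 1) * ((u - w) 0) := by
    ext x
    simp [cubicPart]
    ring
  have hu' := fun j => (norm_le_pi_norm u j).trans hu
  have hw' := fun j => (norm_le_pi_norm w j).trans hw
  have h1 := norm_mul_le_of_le' (norm_mul_le_of_le' (hu' 0) (hu' 0)) (norm_le_pi_norm (u - w) 1)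
  have h2 := norm_mul_le_of_le' (norm_mul_le_of_le' (hu' 0) (hw' 1)) (norm_le_pi_norm (u - w) 0)
  have h3 := norm_mul_le_of_le' (norm_mul_le_of_le' (hw' 0) (hw' 1)) (norm_le_pi_norm (u - w) 0)
  rw [h]
  refine (norm_add₃_le).trans ?_
  linarith

theorem norm_quadPart_le {β : ℝ} (hβ : |β| ≤ 3) {u : Profile} {r : ℝ} (hu : ‖u‖ ≤ r) :
    ‖quadPart β u‖ ≤ 7 * r ^ 2 := by
  have h : quadPart β u = polarPart β ((1 / 2 : ℝ) • u) u := by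
    ext x
    simp [quadPart, polarPart]
    ring
  rw [h]
  have := norm_polarPart_le (u := (1 / 2 : ℝ) • u) (A := r / 2) hβ
    (by rw [norm_smul]; norm_num; linarith) hu
  linarith

theorem norm_cubicPart_le {u : Profile} {r : ℝ} (hu : ‖u‖ ≤ r) : ‖cubicPart u‖ ≤ r ^ 3 := by
  have hu' := fun j => (norm_le_pi_norm u j).trans hu
  have := norm_mul_le_of_le' (norm_mul_le_of_le' (hu' 0) (hu' 0)) (hu' 1)
  rw [cubicPart]
  linarith

theorem norm_critMode_le {m : ℝ} (hm : |m| ≤ 1) : ‖critMode m‖ ≤ 1 := by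
  rw [pi_norm_le_iff_of_nonneg zero_le_one]
  intro j
  fin_cases j
  · exact norm_cosN_le 1
  · change ‖m • cosN 1‖ ≤ 1
    rw [norm_smul, Real.norm_eq_abs]
    exact mul_le_one₀ hm (norm_nonneg _) (norm_cosN_le 1)

/-- The scalar factor β + 4m vanishes at onset, where β = 2 and m = -1/2. This degeneracy makes the
correction ψ small and removes the quadratic contribution to the leading cubic coefficient. -/
theorem quadPart_critMode (β m : ℝ) :
    quadPart β (critMode m) = (β + 4 * m) • (cosN 1 * cosN 1) := by
  ext x
  simp [quadPart, critMode]
  ring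

theorem norm_quadPart_critMode_le (β m : ℝ) : ‖quadPart β (critMode m)‖ ≤ |β + 4 * m| := by
  rw [quadPart_critMode, norm_smul, Real.norm_eq_abs]
  have := norm_mul_le_of_le' (norm_cosN_le 1) (norm_cosN_le 1)
  exact mul_le_of_le_one_right (abs_nonneg _) (by linarith)

theorem coef_one_quadPart_critMode (β m : ℝ) : coef 1 (quadPart β (critMode m)) = 0 := by
  rw [quadPart_critMode, cosN_mul_cosN]
  simp only [map_smul, map_add, coef_cosN]
  norm_num

/-- From cos³ = (3/4) cos ξ + (1/4) cos 3ξ, with coefficient 1/2 for cos ξ. -/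
theorem coef_one_cubicPart_critMode (m : ℝ) : coef 1 (cubicPart (critMode m)) = 3 / 8 * m := by
  have h : cubicPart (critMode m)
      = m • ((1 / 4 : ℝ) • (cosN 3 + cosN 1) + (1 / 4 : ℝ) • (cosN 1 + cosN (-1))) := by
    have e1 : cosN 1 * cosN 1 = (1 / 2 : ℝ) • (cosN 2 + cosN 0) := cosN_mul_cosN 1 1
    have e2 : cosN 2 * cosN 1 = (1 / 2 : ℝ) • (cosN 3 + cosN 1) := cosN_mul_cosN 2 1
    have e3 : cosN 0 * cosN 1 = (1 / 2 : ℝ) • (cosN 1 + cosN (-1)) := cosN_mul_cosN 0 1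
    have e4 : cubicPart (critMode m) = m • (cosN 1 * cosN 1 * cosN 1) := by
      ext x
      simp [cubicPart, critMode]
    rw [e4, e1, smul_mul_assoc, add_mul, e2, e3, smul_add, smul_smul, smul_smul]
    norm_num
  rw [h]
  simp only [map_smul, map_add, coef_cosN]
  norm_num
  ring

/-! ### Rescaling by the amplitude and the cubic coefficient -/

/-- The rescaled nonlinearity at amplitude `a` and correction `ψ`. -/
def scaledNonlin (β m a : ℝ) (ψ : Profile) : C(Circ, ℝ) :=
  quadPart β (critMode m + a • ψ) + a • cubicPart (critMode m + a • ψ)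

/-- The coefficient of the cubic term in the reduced equation. -/
def landau (β m a : ℝ) (ψ : Profile) : ℝ :=
  -(2 * coef 1 (polarPart β (critMode m) ψ + a • quadPart β ψ + cubicPart (critMode m + a • ψ)))

theorem norm_critMode_add_le {m a : ℝ} {ψ : Profile} (hm : |m| ≤ 1) (ha : |a| ≤ 1)
    (hψ : ‖ψ‖ ≤ 1) : ‖critMode m + a • ψ‖ ≤ 2 := by
  refine (norm_add_le _ _).trans ?_
  rw [norm_smul, Real.norm_eq_abs]
  have := mul_le_one₀ ha (norm_nonneg _) hψ
  have := norm_critMode_le hm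
  linarith

theorem norm_smul_sub_smul_le {F : Type*} [NormedAddCommGroup F] [NormedSpace ℝ F] (a a' : ℝ)
    (x x' : F) : ‖a • x - a' • x'‖ ≤ |a - a'| * ‖x‖ + |a'| * ‖x - x'‖ := by
  have : a • x - a' • x' = (a - a') • x + a' • (x - x') := by module
  rw [this]
  refine (norm_add_le _ _).trans ?_
  rw [norm_smul, norm_smul, Real.norm_eq_abs, Real.norm_eq_abs]

theorem norm_scaledNonlin_sub_le {β m a a' : ℝ} {ψ ψ' : Profile} (hβ : |β| ≤ 3) (hm : |m| ≤ 1)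
    (ha : |a| ≤ 1) (ha' : |a'| ≤ 1) (hψ : ‖ψ‖ ≤ 1) (hψ' : ‖ψ'‖ ≤ 1) :
    ‖scaledNonlin β m a ψ - scaledNonlin β m a' ψ'‖
      ≤ 48 * |a - a'| + 40 * |a'| * ‖ψ - ψ'‖ := by
  have hU := norm_critMode_add_le hm ha hψ
  have hU' := norm_critMode_add_le hm ha' hψ'
  set U := critMode m + a • ψ with hUdef
  set U' := critMode m + a' • ψ' with hUdef'
  have hD : ‖U - U'‖ ≤ |a - a'| + |a'| * ‖ψ - ψ'‖ := by
    have : U - U' = a • ψ - a' • ψ' := by rw [hUdef, hUdef']; abel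
    rw [this]
    refine (norm_smul_sub_smul_le _ _ _ _).trans ?_
    have := mul_le_of_le_one_right (abs_nonneg (a - a')) hψ
    linarith
  have h1 := norm_quadPart_sub_le hβ hU hU'
  have h2 := norm_smul_sub_smul_le a a' (cubicPart U) (cubicPart U')
  have h3 := norm_cubicPart_sub_le hU hU'
  have h4 := norm_cubicPart_le hU
  have e : scaledNonlin β m a ψ - scaledNonlin β m a' ψ'
      = (quadPart β U - quadPart β U') + (a • cubicPart U - a' • cubicPart U') := by
    rw [scaledNonlin, scaledNonlin]; abel
  rw [e]
  refine (norm_add_le _ _).trans ?_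
  have h5 : |a - a'| * ‖cubicPart U‖ ≤ |a - a'| * 8 := by
    gcongr; linarith
  have h6 : |a'| * ‖cubicPart U - cubicPart U'‖ ≤ 1 * (12 * ‖U - U'‖) :=
    mul_le_mul ha' (by linarith) (norm_nonneg _) zero_le_one
  linarith

theorem abs_landau_sub_le {β m a a' : ℝ} {ψ ψ' : Profile} (hβ : |β| ≤ 3) (hm : |m| ≤ 1)
    (ha : |a| ≤ 1) (ha' : |a'| ≤ 1) (hψ : ‖ψ‖ ≤ 1) (hψ' : ‖ψ'‖ ≤ 1) :
    |landau β m a ψ - landau β m a' ψ'| ≤ 80 * ‖ψ - ψ'‖ + 38 * |a - a'| := by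
  have hU := norm_critMode_add_le hm ha hψ
  have hU' := norm_critMode_add_le hm ha' hψ'
  have e : landau β m a ψ - landau β m a' ψ' = -(2 * coef 1
      (polarPart β (critMode m) (ψ - ψ') + (a • quadPart β ψ - a' • quadPart β ψ')
        + (cubicPart (critMode m + a • ψ) - cubicPart (critMode m + a' • ψ')))) := by
    rw [landau, landau, ← polarPart_sub]
    simp only [map_add, map_sub]
    ring
  rw [e, abs_neg, abs_mul, abs_two]
  set U := critMode m + a • ψ with hUdef
  set U' := critMode m + a' • ψ' with hUdef'
  have hD : ‖U - U'‖ ≤ |a - a'| + ‖ψ - ψ'‖ := by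
    have : U - U' = a • ψ - a' • ψ' := by rw [hUdef, hUdef']; abel
    rw [this]
    refine (norm_smul_sub_smul_le _ _ _ _).trans ?_
    have := mul_le_of_le_one_right (abs_nonneg (a - a')) hψ
    have := mul_le_of_le_one_left (norm_nonneg (ψ - ψ')) ha'
    linarith
  have h1 := norm_polarPart_le hβ (norm_critMode_le hm) (le_refl ‖ψ - ψ'‖)
  have h2 := norm_smul_sub_smul_le a a' (quadPart β ψ) (quadPart β ψ')
  have h3 := norm_quadPart_sub_le hβ hψ hψ'
  have h4 := norm_quadPart_le hβ hψ
  have h5 := norm_cubicPart_sub_le hU hU'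
  have h6 : |a - a'| * ‖quadPart β ψ‖ ≤ |a - a'| * 7 := by
    gcongr; linarith
  have h7 : |a'| * ‖quadPart β ψ - quadPart β ψ'‖ ≤ 1 * (14 * ‖ψ - ψ'‖) :=
    mul_le_mul ha' (by linarith) (norm_nonneg _) zero_le_one
  refine (mul_le_mul_of_nonneg_left ((abs_coef_le 1 _).trans norm_add₃_le)
    (by norm_num)).trans ?_
  linarith

/-- At m = -1/2 this is 3/8, which produces the factor 2/3 in the squared leading amplitude. -/
theorem landau_zero (β m : ℝ) : landau β m 0 0 = -(3 / 4 * m) := by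
  have h : polarPart β (critMode m) 0 = 0 := by ext x; simp [polarPart]
  simp only [landau, h, zero_smul, add_zero, zero_add, coef_one_cubicPart_critMode]
  ring

theorem nonlin_eq_scaled (β m a : ℝ) (ψ : Profile) :
    quadPart β (a • (critMode m + a • ψ)) + cubicPart (a • (critMode m + a • ψ))
      = a ^ 2 • scaledNonlin β m a ψ := by
  rw [quadPart_smul, cubicPart_smul, scaledNonlin]
  module

/-- The square of cos ξ has no first harmonic, so the pure φ-term drops out and one factor a can be
extracted. -/
theorem coef_one_quadPart_add (β m a : ℝ) (ψ : Profile) :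
    coef 1 (quadPart β (critMode m + a • ψ))
      = a * coef 1 (polarPart β (critMode m) ψ + a • quadPart β ψ) := by
  rw [quadPart_add_smul]
  simp only [map_add, map_smul, coef_one_quadPart_critMode, smul_eq_mul]
  ring

/-- The extra factor a extracted here is what makes the reduced equation cubic instead of quadratic,
without dividing by a. -/
theorem two_mul_coef_one_scaledNonlin (β m a : ℝ) (ψ : Profile) :
    2 * coef 1 (scaledNonlin β m a ψ) = -(a * landau β m a ψ) := by
  rw [scaledNonlin, map_add, coef_one_quadPart_add, landau]
  simp only [map_add, map_smul, smul_eq_mul]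
  ring

/-! ### The solution branch for fixed b and t -/

/-- The largest amplitude considered. -/
def ampMax : ℝ := 1 / (400000 * sumInv)

theorem ampMax_pos : 0 < ampMax := by
  have := one_le_sumInv
  unfold ampMax; positivity

theorem sumInv_mul_ampMax : sumInv * ampMax = 1 / 400000 := by
  have := one_le_sumInv
  unfold ampMax; field_simp

theorem ampMax_le : ampMax ≤ 1 / 400000 := by
  have := one_le_sumInv
  have := ampMax_pos
  nlinarith [sumInv_mul_ampMax]

/-- The parameters are so close to onset that the reduction applies. -/
structure Close (b t : ℝ) : Prop extends NearOnset b t where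
  quad_small : sumInv * |b / 2 + 2 + 4 * mSym t 1| ≤ 1 / 64000
  m_near : |mSym t 1 + 1 / 2| ≤ 1 / 30
  mu_nonneg : 0 ≤ dSym b t 1
  mu_le : dSym b t 1 ≤ ampMax ^ 2 / 4

theorem NearOnset.abs_beta_le {b t : ℝ} (h : NearOnset b t) : |b / 2 + 2| ≤ 3 := by
  have := h.b_nonneg
  have := h.b_le
  rw [abs_of_nonneg] <;> linarith

/-- `a (φ + a ψ)` solves the fixed point equation of the reduction. -/
structure IsBranch {b t : ℝ} (h : NearOnset b t) (a : ℝ) (ψ : Profile) : Prop where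
  abs_le : |a| ≤ ampMax
  norm_le : ‖ψ‖ ≤ 1
  fixed : partialInv h (scaledNonlin (b / 2 + 2) (mSym t 1) a ψ) = ψ

/-- The ψ-Lipschitz constant of the nonlinearity is 40|a'| and the partial inverse costs 4·`sumInv`;
the size of `ampMax` keeps their product far below 1/2. -/
theorem norm_partialInv_scaledNonlin_sub_le {b t : ℝ} (h : NearOnset b t) {a a' : ℝ}
    {ψ ψ' : Profile} (ha : |a| ≤ ampMax) (ha' : |a'| ≤ ampMax) (hψ : ‖ψ‖ ≤ 1) (hψ' : ‖ψ'‖ ≤ 1) :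
    ‖partialInv h (scaledNonlin (b / 2 + 2) (mSym t 1) a ψ)
      - partialInv h (scaledNonlin (b / 2 + 2) (mSym t 1) a' ψ')‖
      ≤ 192 * sumInv * |a - a'| + 1 / 2 * ‖ψ - ψ'‖ := by
  have hA := ampMax_le
  have h1 := norm_scaledNonlin_sub_le h.abs_beta_le (abs_mSym_le h one_ne_zero)
    (ha.trans (hA.trans (by norm_num))) (ha'.trans (hA.trans (by norm_num))) hψ hψ'
  have hS := one_le_sumInv
  rw [← map_sub]
  refine (norm_partialInv_le h _).trans ?_
  refine (mul_le_mul_of_nonneg_left h1 (by linarith)).trans ?_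
  have h2 : sumInv * |a'| ≤ 1 / 400000 := by
    rw [← sumInv_mul_ampMax]
    gcongr
  have h3 : sumInv * |a'| * ‖ψ - ψ'‖ ≤ 1 / 400000 * ‖ψ - ψ'‖ := by gcongr
  nlinarith [norm_nonneg (ψ - ψ')]

/-- Absorbing half of the difference into the left-hand side gives Lipschitz dependence on the
amplitude; for a = a' it is uniqueness of ψ. -/
theorem IsBranch.norm_sub_le {b t : ℝ} {h : NearOnset b t} {a a' : ℝ} {ψ ψ' : Profile}
    (hψ : IsBranch h a ψ) (hψ' : IsBranch h a' ψ') :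
    ‖ψ - ψ'‖ ≤ 384 * sumInv * |a - a'| := by
  have := norm_partialInv_scaledNonlin_sub_le h hψ.abs_le hψ'.abs_le hψ.norm_le hψ'.norm_le
  rw [hψ.fixed, hψ'.fixed] at this
  linarith

theorem norm_partialInv_scaledNonlin_zero_le {b t : ℝ} (h : NearOnset b t) :
    ‖partialInv h (scaledNonlin (b / 2 + 2) (mSym t 1) 0 0)‖
      ≤ 4 * sumInv * |b / 2 + 2 + 4 * mSym t 1| := by
  refine (norm_partialInv_le h _).trans ?_
  have := norm_quadPart_critMode_le (b / 2 + 2) (mSym t 1)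
  have hS := one_le_sumInv
  have e : scaledNonlin (b / 2 + 2) (mSym t 1) 0 0 = quadPart (b / 2 + 2) (critMode (mSym t 1)) := by
    simp [scaledNonlin]
  rw [e]
  gcongr

/-- Comparison with the image of (a, ψ) = (0, 0), which contains only the nearly degenerate
quadratic term. -/
theorem IsBranch.norm_le' {b t : ℝ} {h : NearOnset b t} {a : ℝ} {ψ : Profile}
    (hψ : IsBranch h a ψ) :
    ‖ψ‖ ≤ 8 * sumInv * |b / 2 + 2 + 4 * mSym t 1| + 384 * sumInv * |a| := by
  have h1 := norm_partialInv_scaledNonlin_sub_le h (a' := 0) (ψ' := 0) hψ.abs_le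
    (by simpa using ampMax_pos.le) hψ.norm_le (by simp)
  have h2 := norm_partialInv_scaledNonlin_zero_le h
  rw [hψ.fixed, sub_zero, sub_zero] at h1
  have h3 := norm_sub_norm_le ψ (partialInv h (scaledNonlin (b / 2 + 2) (mSym t 1) 0 0))
  linarith

theorem exists_isBranch {b t : ℝ} (h : Close b t) {a : ℝ} (ha : |a| ≤ ampMax) :
    ∃ ψ, IsBranch h.toNearOnset a ψ := by
  have h2 := norm_partialInv_scaledNonlin_zero_le h.toNearOnset
  have hq := h.quad_small
  have hS := one_le_sumInv
  have hsa : sumInv * |a| ≤ 1 / 400000 := by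
    rw [← sumInv_mul_ampMax]; gcongr
  obtain ⟨ψ, h3, h4⟩ := exists_fixedPoint_of_norm_le
    (fun ψ => partialInv h.toNearOnset (scaledNonlin (b / 2 + 2) (mSym t 1) a ψ)) zero_le_one
    (fun ψ hψ => by
      have h1 := norm_partialInv_scaledNonlin_sub_le h.toNearOnset (a' := 0) (ψ' := 0) ha
        (by simpa using ampMax_pos.le) hψ (by simp)
      rw [sub_zero, sub_zero] at h1
      have h3 := norm_sub_norm_le
        (partialInv h.toNearOnset (scaledNonlin (b / 2 + 2) (mSym t 1) a ψ))
        (partialInv h.toNearOnset (scaledNonlin (b / 2 + 2) (mSym t 1) 0 0))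
      linarith)
    (fun ψ ψ' hψ hψ' => by
      have := norm_partialInv_scaledNonlin_sub_le h.toNearOnset ha ha hψ hψ'
      simpa using this)
  exact ⟨ψ, ha, h3, h4⟩

theorem IsBranch.abs_landau_sub_le' {b t : ℝ} {h : NearOnset b t} {a : ℝ} {ψ : Profile}
    (hψ : IsBranch h a ψ) : |landau (b / 2 + 2) (mSym t 1) a ψ + 3 / 4 * mSym t 1|
      ≤ 640 * (sumInv * |b / 2 + 2 + 4 * mSym t 1|) + 31000 * (sumInv * |a|) := by
  have hA := ampMax_le
  have h1 := abs_landau_sub_le h.abs_beta_le (abs_mSym_le h one_ne_zero) (a' := 0) (ψ' := 0)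
    (hψ.abs_le.trans (hA.trans (by norm_num))) (by simp) hψ.norm_le (by simp)
  rw [landau_zero, sub_neg_eq_add, sub_zero, sub_zero] at h1
  have h2 := hψ.norm_le'
  have hS := one_le_sumInv
  have : |a| ≤ sumInv * |a| := le_mul_of_one_le_left (abs_nonneg _) hS
  have := abs_nonneg a
  linarith

/-- The errors 1/100 from the quadratic factor, 31000/400000 from the amplitude and (3/4)/30 from m
still leave the value 3/8 inside [1/4, 1/2]. -/
theorem IsBranch.landau_mem {b t : ℝ} (h : Close b t) {a : ℝ} {ψ : Profile}
    (hψ : IsBranch h.toNearOnset a ψ) :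
    1 / 4 ≤ landau (b / 2 + 2) (mSym t 1) a ψ ∧ landau (b / 2 + 2) (mSym t 1) a ψ ≤ 1 / 2 := by
  have h1 := _root_.abs_le.mp hψ.abs_landau_sub_le'
  have h2 := _root_.abs_le.mp h.m_near
  have h3 := h.quad_small
  have hS := one_le_sumInv
  have hsa : sumInv * |a| ≤ 1 / 400000 := by
    rw [← sumInv_mul_ampMax]
    have := hψ.abs_le
    gcongr
  constructor <;> linarith

theorem IsBranch.abs_landau_sub_le {b t : ℝ} {h : NearOnset b t} {a a' : ℝ} {ψ ψ' : Profile}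
    (hψ : IsBranch h a ψ) (hψ' : IsBranch h a' ψ') :
    |landau (b / 2 + 2) (mSym t 1) a ψ - landau (b / 2 + 2) (mSym t 1) a' ψ'|
      ≤ 31000 * sumInv * |a - a'| := by
  have hA := ampMax_le
  have h1 := Brusselator.abs_landau_sub_le h.abs_beta_le (abs_mSym_le h one_ne_zero)
    (hψ.abs_le.trans (hA.trans (by norm_num))) (hψ'.abs_le.trans (hA.trans (by norm_num)))
    hψ.norm_le hψ'.norm_le
  have h2 := hψ.norm_sub_le hψ'
  have hS := one_le_sumInv
  have : |a - a'| ≤ sumInv * |a - a'| := le_mul_of_one_le_left (abs_nonneg _) hS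
  have := abs_nonneg (a - a')
  linarith

/-- Strict monotonicity of `a ↦ a² T(a)` along the branch. -/
theorem IsBranch.amp_le_of_sq_mul_le {b t : ℝ} (h : Close b t) {a a' : ℝ} {ψ ψ' : Profile}
    (hψ : IsBranch h.toNearOnset a ψ) (hψ' : IsBranch h.toNearOnset a' ψ')
    (ha' : 0 ≤ a')
    (hle : a ^ 2 * landau (b / 2 + 2) (mSym t 1) a ψ
      ≤ a' ^ 2 * landau (b / 2 + 2) (mSym t 1) a' ψ') : a ≤ a' := by
  by_contra! hlt
  have h1 := hψ.abs_landau_sub_le hψ'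
  have h2 := hψ.landau_mem h
  rw [abs_of_pos (by linarith : 0 < a - a')] at h1
  have hS := one_le_sumInv
  have hsa : sumInv * a' ≤ 1 / 400000 := by
    rw [← sumInv_mul_ampMax]
    have := hψ'.abs_le
    rw [abs_of_nonneg ha'] at this
    gcongr
  have h3 := (_root_.abs_le.mp h1).1
  set T := landau (b / 2 + 2) (mSym t 1) a ψ
  set T' := landau (b / 2 + 2) (mSym t 1) a' ψ'
  -- The variation of T costs at most 31000·`sumInv`·a'²(a - a'), which is too small to offset the
  -- gain (a² - a'²)/4.
  have h4 : a' ^ 2 * (T' - T) ≤ a' ^ 2 * (31000 * sumInv * (a - a')) := by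
    apply mul_le_mul_of_nonneg_left _ (sq_nonneg _)
    linarith
  have h5 : a' ^ 2 * (31000 * sumInv * (a - a')) ≤ 31000 / 400000 * a' * (a - a') := by
    have : a' * (a - a') * (sumInv * a') ≤ a' * (a - a') * (1 / 400000) :=
      mul_le_mul_of_nonneg_left hsa (mul_nonneg ha' (by linarith))
    nlinarith
  have h6 : (a - a') * (a + a') * (1 / 4) ≤ (a - a') * (a + a') * T :=
    mul_le_mul_of_nonneg_left h2.1 (mul_nonneg (by linarith) (by linarith))
  nlinarith

theorem exists_amplitude {b t : ℝ} (h : Close b t) : ∃ a ψ, 0 ≤ a ∧ IsBranch h.toNearOnset a ψ ∧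
    a ^ 2 * landau (b / 2 + 2) (mSym t 1) a ψ = dSym b t 1 := by
  have hA := ampMax_pos
  have hex : ∀ a : ℝ, ∃ ψ, a ∈ Set.Icc 0 ampMax → IsBranch h.toNearOnset a ψ := by
    intro a
    by_cases ha : a ∈ Set.Icc 0 ampMax
    · obtain ⟨ψ, hψ⟩ := exists_isBranch h (a := a) (by rw [abs_of_nonneg ha.1]; exact ha.2)
      exact ⟨ψ, fun _ => hψ⟩
    · exact ⟨0, fun h => absurd h ha⟩
  choose Ψ hΨ using hex
  -- The corrections are chosen separately for each amplitude, but the Lipschitz bound holds for any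
  -- two points of the branch, so the choice does no harm to continuity.
  have hcont : ContinuousOn (fun a => landau (b / 2 + 2) (mSym t 1) a (Ψ a))
      (Set.Icc 0 ampMax) := by
    have hS := one_le_sumInv
    have : LipschitzOnWith (Real.toNNReal (31000 * sumInv))
        (fun a => landau (b / 2 + 2) (mSym t 1) a (Ψ a)) (Set.Icc 0 ampMax) := by
      refine LipschitzOnWith.of_dist_le_mul fun x hx y hy => ?_
      rw [Real.coe_toNNReal _ (by positivity), Real.dist_eq, Real.dist_eq]
      exact (hΨ x hx).abs_landau_sub_le (hΨ y hy)
    exact this.continuousOn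
  have hcont2 : ContinuousOn (fun a => a ^ 2 * landau (b / 2 + 2) (mSym t 1) a (Ψ a))
      (Set.Icc 0 ampMax) := (continuousOn_id.pow 2).mul hcont
  -- At the right endpoint T ≥ 1/4, so the bound ampMax²/4 in `Close` places dSym in the range of
  -- a²T.
  have hmem : dSym b t 1 ∈ Set.Icc ((0 : ℝ) ^ 2 * landau (b / 2 + 2) (mSym t 1) 0 (Ψ 0))
      (ampMax ^ 2 * landau (b / 2 + 2) (mSym t 1) ampMax (Ψ ampMax)) := by
    refine ⟨by simpa using h.mu_nonneg, ?_⟩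
    have := ((hΨ ampMax ⟨hA.le, le_rfl⟩).landau_mem h).1
    have h2 := h.mu_le
    nlinarith [sq_nonneg ampMax]
  obtain ⟨a, ha, hval⟩ := intermediate_value_Icc hA.le hcont2 hmem
  exact ⟨a, Ψ a, ha.1, hΨ a ha, hval⟩

theorem critMode_even (m : ℝ) (j : Fin 2) (x : Circ) : critMode m j (-x) = critMode m j x := by
  fin_cases j <;> simp [critMode, cosN_neg_apply]

theorem partialInv_even {b t : ℝ} (h : NearOnset b t) (f : C(Circ, ℝ)) (j : Fin 2) (x : Circ) :
    partialInv h f j (-x) = partialInv h f j x := by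
  fin_cases j
  · exact evenMul_neg_apply (isSmoothing_invSym₀ h) f x
  · exact evenMul_neg_apply (isSmoothing_invSym₁ h) f x

/-- The profile of amplitude `a` with correction `ψ`. -/
def branchProfile (t a : ℝ) (ψ : Profile) : Profile := a • (critMode (mSym t 1) + a • ψ)

theorem IsBranch.even {b t : ℝ} {h : NearOnset b t} {a : ℝ} {ψ : Profile}
    (hψ : IsBranch h a ψ) (j : Fin 2) (x : Circ) :
    branchProfile t a ψ j (-x) = branchProfile t a ψ j x := by
  have h1 : ψ j (-x) = ψ j x := by rw [← hψ.fixed]; exact partialInv_even h _ j x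
  simp [branchProfile, critMode_even, h1]

theorem IsBranch.branchProfile_eq {b t : ℝ} {h : NearOnset b t} {a : ℝ} {ψ : Profile}
    (hψ : IsBranch h a ψ) : branchProfile t a ψ = a • critMode (mSym t 1) + partialInv h
      (quadPart (b / 2 + 2) (branchProfile t a ψ) + cubicPart (branchProfile t a ψ)) := by
  rw [branchProfile, nonlin_eq_scaled, map_smul, hψ.fixed]
  module

/-- The bifurcation equation with its trivial factor a split off: nontrivial solutions satisfy a²T =
μ. -/
theorem branchProfile_reduced_eq (b t a : ℝ) (ψ : Profile) :
    dSym b t 1 * a + 2 * coef 1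
      (quadPart (b / 2 + 2) (branchProfile t a ψ) + cubicPart (branchProfile t a ψ))
      = a * (dSym b t 1 - a ^ 2 * landau (b / 2 + 2) (mSym t 1) a ψ) := by
  rw [branchProfile, nonlin_eq_scaled, map_smul, smul_eq_mul]
  linear_combination (a ^ 2) * two_mul_coef_one_scaledNonlin (b / 2 + 2) (mSym t 1) a ψ

theorem IsBranch.modeEq {b t : ℝ} {h : NearOnset b t} {a : ℝ} {ψ : Profile}
    (hψ : IsBranch h a ψ)
    (ha : a ^ 2 * landau (b / 2 + 2) (mSym t 1) a ψ = dSym b t 1) :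
    ModeEq b t (branchProfile t a ψ) := by
  rw [modeEq_iff_reduced h hψ.even]
  refine ⟨a, hψ.branchProfile_eq, ?_⟩
  rw [branchProfile_reduced_eq, ha, sub_self, mul_zero]

theorem norm_branchProfile_le {b t : ℝ} {h : NearOnset b t} {a : ℝ} {ψ : Profile}
    (hψ : IsBranch h a ψ) : ‖branchProfile t a ψ‖ ≤ 2 * |a| := by
  have hA := ampMax_le
  have := norm_critMode_add_le (abs_mSym_le h one_ne_zero)
    (hψ.abs_le.trans (hA.trans (by norm_num))) hψ.norm_le
  rw [branchProfile, norm_smul, Real.norm_eq_abs]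
  nlinarith [abs_nonneg a]

/-- Every small even solution lies on the branch. -/
theorem exists_branch_of_modeEq {b t : ℝ} (h : Close b t) {u : Profile}
    (hu : ∀ j x, u j (-x) = u j x) (hm : ModeEq b t u) (hsmall : ‖u‖ ≤ ampMax / 2) :
    ∃ a ψ, IsBranch h.toNearOnset a ψ ∧ u = branchProfile t a ψ ∧
      a * (dSym b t 1 - a ^ 2 * landau (b / 2 + 2) (mSym t 1) a ψ) = 0 := by
  obtain ⟨a, h1, h2⟩ := (modeEq_iff_reduced h.toNearOnset hu).mp hm
  have hA := ampMax_pos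
  have hcoef : coef 1 (u 0) = a / 2 := by
    rw [h1]
    simp only [Pi.add_apply, Pi.smul_apply, map_add, map_smul, partialInv_zero, coef_evenMul,
      critMode, Matrix.cons_val_zero, coef_cosN_one, smul_eq_mul, invSym₀]
    norm_num
    ring
  have ha : |a| ≤ ampMax := by
    have h3 := (abs_coef_le 1 (u 0)).trans ((norm_le_pi_norm u 0).trans hsmall)
    rw [hcoef, abs_div, abs_two] at h3
    linarith
  obtain ⟨ψ, hψ⟩ := exists_isBranch h ha
  -- For the same a, both profiles solve u = aφ + K N(u), where K is the partial inverse and N the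
  -- nonlinearity. On the ball of radius 2·`ampMax` the map K ∘ N has Lipschitz constant at most
  -- 160/400000, so they agree.
  have heq : u = branchProfile t a ψ := by
    have h3 := hψ.branchProfile_eq
    have h4 := norm_branchProfile_le hψ
    have hu2 : ‖u‖ ≤ 2 * ampMax := by linarith
    have hw2 : ‖branchProfile t a ψ‖ ≤ 2 * ampMax := by linarith
    have hd : u - branchProfile t a ψ = partialInv h.toNearOnset
        ((quadPart (b / 2 + 2) u - quadPart (b / 2 + 2) (branchProfile t a ψ))
          + (cubicPart u - cubicPart (branchProfile t a ψ))) := by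
      conv_lhs => rw [h1, h3]
      simp only [map_add, map_sub]
      abel
    have h5 := norm_quadPart_sub_le h.toNearOnset.abs_beta_le hu2 hw2
    have h6 := norm_cubicPart_sub_le hu2 hw2
    have h7 := norm_partialInv_le h.toNearOnset
        ((quadPart (b / 2 + 2) u - quadPart (b / 2 + 2) (branchProfile t a ψ))
          + (cubicPart u - cubicPart (branchProfile t a ψ)))
    rw [← hd] at h7
    have hS := one_le_sumInv
    have hAle := ampMax_le
    have h8 := (norm_add_le (quadPart (b / 2 + 2) u - quadPart (b / 2 + 2) (branchProfile t a ψ))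
      (cubicPart u - cubicPart (branchProfile t a ψ))).trans (add_le_add h5 h6)
    have h9 : (3 * (2 * ampMax) ^ 2) ≤ 12 * ampMax := by nlinarith
    have h10 := norm_nonneg (u - branchProfile t a ψ)
    have h11 : ‖(quadPart (b / 2 + 2) u - quadPart (b / 2 + 2) (branchProfile t a ψ))
        + (cubicPart u - cubicPart (branchProfile t a ψ))‖
        ≤ 40 * ampMax * ‖u - branchProfile t a ψ‖ := by nlinarith
    have h12 : ‖u - branchProfile t a ψ‖
        ≤ 4 * sumInv * (40 * ampMax * ‖u - branchProfile t a ψ‖) :=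
      h7.trans (mul_le_mul_of_nonneg_left h11 (by linarith))
    have h13 : 4 * sumInv * (40 * ampMax * ‖u - branchProfile t a ψ‖)
        = 160 / 400000 * ‖u - branchProfile t a ψ‖ := by
      linear_combination (160 * ‖u - branchProfile t a ψ‖) * sumInv_mul_ampMax
    rw [h13] at h12
    have : ‖u - branchProfile t a ψ‖ = 0 := by linarith
    exact sub_eq_zero.mp (norm_eq_zero.mp this)
  refine ⟨a, ψ, hψ, heq, ?_⟩
  rw [← branchProfile_reduced_eq, ← heq]
  exact h2

/-! ### The parameters ε and ω near onset -/

/-- The admissible range of the parameters `ε` and `ω`. -/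
structure Admissible (ε ω : ℝ) : Prop where
  eps_nonneg : 0 ≤ ε
  eps_le : ε ≤ ampMax / 2
  omega_le : |ω| ≤ 1 / 4

theorem Admissible.eps_le' {ε ω : ℝ} (h : Admissible ε ω) : ε ≤ 1 / 800000 := by
  have := ampMax_le
  have := h.eps_le
  linarith

theorem Admissible.waveNumber_le {ε ω : ℝ} (h : Admissible ε ω) : waveNumber ε ω ≤ 1 := by
  have h1 := h.eps_nonneg
  have h2 := h.eps_le'
  have h3 := abs_le.mp h.omega_le
  have h4 : √(4 * ε ^ 2 * ω ^ 2 + 1) ≤ 3 / 2 := by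
    rw [Real.sqrt_le_iff]
    refine ⟨by norm_num, ?_⟩
    have h5 : ε ^ 2 ≤ 1 := by nlinarith
    have h6 : ω ^ 2 ≤ 1 := by nlinarith
    have := mul_le_mul h5 h6 (sq_nonneg _) zero_le_one
    nlinarith
  have h7 : ε * ω ≤ 1 / 4 := by nlinarith
  unfold waveNumber
  linarith

theorem Admissible.abs_sub_le {ε ω : ℝ} (h : Admissible ε ω) :
    |waveNumber ε ω ^ 2 - 1 / 4| ≤ ε / 2 := by
  have h1 := four_mul_waveNumber_sq_sub_one ε ω
  have h2 : waveNumber ε ω ^ 2 - 1 / 4 = 2 * ε * (ω * waveNumber ε ω) := by linarith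
  have h3 : |ω * waveNumber ε ω| ≤ 1 / 4 * 1 := by
    rw [abs_mul, abs_of_pos (waveNumber_pos ε ω)]
    exact mul_le_mul h.omega_le h.waveNumber_le (waveNumber_pos ε ω).le (by norm_num)
  have h4 := h.eps_nonneg
  rw [h2, abs_mul, abs_of_nonneg (by linarith)]
  nlinarith

/-- The symbol equals ε² - (4k² - 1)²/(4k²), and the quadratic relation for k turns the square into
64ε²ω²k². The identity is exact, so no remainder spoils uniformity at ω = ±1/4. -/
theorem dSym_one_eq (ε ω : ℝ) :
    dSym (ε ^ 2) (waveNumber ε ω ^ 2) 1 = ε ^ 2 * (1 - 16 * ω ^ 2) := by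
  have h1 := four_mul_waveNumber_sq_sub_one ε ω
  have h2 := (waveNumber_pos ε ω).ne'
  unfold dSym
  set k := waveNumber ε ω
  have h3 : (4 * k ^ 2 - 1) ^ 2 = 64 * ε ^ 2 * ω ^ 2 * k ^ 2 := by rw [h1]; ring
  norm_num
  field_simp
  linear_combination (-1) * h3

theorem NearOnset.mSym_add_half {b t : ℝ} (h : NearOnset b t) :
    mSym t 1 + 1 / 2 = (t - 1 / 4) / (4 * t) := by
  have := h.le_t
  have : t ≠ 0 := by linarith
  unfold mSym
  norm_num
  field_simp
  ring

theorem Admissible.nearOnset {ε ω : ℝ} (h : Admissible ε ω) :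
    NearOnset (ε ^ 2) (waveNumber ε ω ^ 2) := by
  have h1 := h.eps_nonneg
  have h2 := h.eps_le'
  have h3 := abs_le.mp h.abs_sub_le
  exact ⟨sq_nonneg _, by nlinarith, by linarith, by linarith⟩

theorem Admissible.abs_mSym_add_le {ε ω : ℝ} (h : Admissible ε ω) :
    |mSym (waveNumber ε ω ^ 2) 1 + 1 / 2| ≤ ε := by
  have h1 := h.nearOnset
  have h2 := h1.le_t
  rw [h1.mSym_add_half, abs_div, abs_of_pos (by linarith : 0 < 4 * waveNumber ε ω ^ 2),
    div_le_iff₀ (by linarith)]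
  have := h.abs_sub_le
  have := h.eps_nonneg
  nlinarith

/-- Quantifies the quadratic degeneracy: the constants 2 and 4·(-1/2) cancel, leaving ε²/2 and four
times the deviation of m. -/
theorem Admissible.abs_quad_le {ε ω : ℝ} (h : Admissible ε ω) :
    |ε ^ 2 / 2 + 2 + 4 * mSym (waveNumber ε ω ^ 2) 1| ≤ 5 * ε := by
  have h1 := abs_le.mp h.abs_mSym_add_le
  have h2 := h.eps_nonneg
  have h3 := h.eps_le'
  rw [abs_le]
  constructor <;> nlinarith

theorem Admissible.sumInv_mul_le {ε ω : ℝ} (h : Admissible ε ω) : sumInv * ε ≤ 1 / 800000 := by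
  have h1 := mul_le_mul_of_nonneg_left h.eps_le (zero_le_one.trans one_le_sumInv)
  linarith [sumInv_mul_ampMax]

theorem Admissible.omega_sq_le {ε ω : ℝ} (h : Admissible ε ω) : 16 * ω ^ 2 ≤ 1 := by
  have := abs_le.mp h.omega_le
  nlinarith

theorem Admissible.close {ε ω : ℝ} (h : Admissible ε ω) :
    Close (ε ^ 2) (waveNumber ε ω ^ 2) where
  toNearOnset := h.nearOnset
  quad_small := by
    have h1 := mul_le_mul_of_nonneg_left h.abs_quad_le (zero_le_one.trans one_le_sumInv)
    have h2 := h.sumInv_mul_le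
    linarith
  m_near := by
    have := h.abs_mSym_add_le
    have := h.eps_le'
    linarith
  mu_nonneg := by
    rw [dSym_one_eq]
    have := h.omega_sq_le
    exact mul_nonneg (sq_nonneg _) (by linarith)
  mu_le := by
    rw [dSym_one_eq]
    have h1 := h.eps_le
    have h2 := h.eps_nonneg
    have h3 : ε ^ 2 * (1 - 16 * ω ^ 2) ≤ ε ^ 2 :=
      mul_le_of_le_one_right (sq_nonneg _) (by nlinarith [sq_nonneg ω])
    nlinarith

/-- `u` is the profile on the bifurcating branch, with amplitude `a` and correction `ψ`. -/
structure OnBranch {ε ω : ℝ} (h : Admissible ε ω) (u : Profile) (a : ℝ) (ψ : Profile) : Prop where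
  branch : IsBranch h.nearOnset a ψ
  eq : u = branchProfile (waveNumber ε ω ^ 2) a ψ
  nonneg : 0 ≤ a
  amp : a ^ 2 * landau (ε ^ 2 / 2 + 2) (mSym (waveNumber ε ω ^ 2) 1) a ψ
    = ε ^ 2 * (1 - 16 * ω ^ 2)

theorem OnBranch.amp_le {ε ω : ℝ} {h : Admissible ε ω} {u : Profile} {a : ℝ} {ψ : Profile}
    (hu : OnBranch h u a ψ) : a ≤ 2 * ε := by
  have h1 := (hu.branch.landau_mem h.close).1
  have h2 := hu.amp
  have h3 : ε ^ 2 * (1 - 16 * ω ^ 2) ≤ ε ^ 2 :=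
    mul_le_of_le_one_right (sq_nonneg _) (by nlinarith [sq_nonneg ω])
  have h4 : a ^ 2 * (1 / 4) ≤ ε ^ 2 := by
    refine le_trans ?_ h3
    rw [← h2]
    exact mul_le_mul_of_nonneg_left h1 (sq_nonneg _)
  refine abs_le_of_sq_le_sq' ?_ (by linarith [h.eps_nonneg]) |>.2
  linarith

/-- Both sources of ψ, the nearly degenerate quadratic term and the amplitude, are O(ε). The
improvement over the bound 1 gives the ε³ error of the eigenvalue. -/
theorem OnBranch.norm_correction_le {ε ω : ℝ} {h : Admissible ε ω} {u : Profile} {a : ℝ}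
    {ψ : Profile} (hu : OnBranch h u a ψ) : ‖ψ‖ ≤ 1000 * sumInv * ε := by
  have h1 := hu.branch.norm_le'
  have h2 := h.abs_quad_le
  have h3 := hu.amp_le
  have hS := one_le_sumInv
  rw [abs_of_nonneg hu.nonneg] at h1
  have h4 := mul_le_mul_of_nonneg_left h2 (by linarith : 0 ≤ 8 * sumInv)
  have h5 := mul_le_mul_of_nonneg_left h3 (by linarith : 0 ≤ 384 * sumInv)
  have h6 := mul_nonneg (zero_le_one.trans hS) h.eps_nonneg
  linarith

theorem OnBranch.norm_le {ε ω : ℝ} {h : Admissible ε ω} {u : Profile} {a : ℝ}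
    {ψ : Profile} (hu : OnBranch h u a ψ) : ‖u‖ ≤ 4 * ε := by
  have h1 := norm_branchProfile_le hu.branch
  rw [← hu.eq, abs_of_nonneg hu.nonneg] at h1
  linarith [hu.amp_le]

theorem OnBranch.even {ε ω : ℝ} {h : Admissible ε ω} {u : Profile} {a : ℝ}
    {ψ : Profile} (hu : OnBranch h u a ψ) (j : Fin 2) (x : Circ) : u j (-x) = u j x := by
  rw [hu.eq]
  exact hu.branch.even j x

theorem OnBranch.modeEq {ε ω : ℝ} {h : Admissible ε ω} {u : Profile} {a : ℝ}
    {ψ : Profile} (hu : OnBranch h u a ψ) : ModeEq (ε ^ 2) (waveNumber ε ω ^ 2) u := by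
  rw [hu.eq]
  exact hu.branch.modeEq (by rw [hu.amp, dSym_one_eq])

/-- Monotonicity of a²T, applied in both directions, forces equal amplitudes; equal amplitudes force
equal corrections. -/
theorem OnBranch.unique {ε ω : ℝ} {h : Admissible ε ω} {u u' : Profile} {a a' : ℝ}
    {ψ ψ' : Profile} (hu : OnBranch h u a ψ) (hu' : OnBranch h u' a' ψ') : u = u' := by
  have h1 := hu.branch.amp_le_of_sq_mul_le h.close hu'.branch hu'.nonneg
    (by rw [hu.amp, hu'.amp])
  have h2 := hu'.branch.amp_le_of_sq_mul_le h.close hu.branch hu.nonneg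
    (by rw [hu.amp, hu'.amp])
  have h3 : a = a' := le_antisymm h1 h2
  subst h3
  have h4 := hu.branch.norm_sub_le hu'.branch
  simp only [sub_self, abs_zero, mul_zero] at h4
  have h5 : ψ = ψ' := sub_eq_zero.mp (norm_le_zero_iff.mp h4)
  rw [hu.eq, hu'.eq, h5]

theorem exists_onBranch {ε ω : ℝ} (h : Admissible ε ω) : ∃ u a ψ, OnBranch h u a ψ := by
  obtain ⟨a, ψ, h1, h2, h3⟩ := exists_amplitude h.close
  exact ⟨_, a, ψ, h2, rfl, h1, by rw [h3, dSym_one_eq]⟩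

/-! ### Classification of the small even steady states and their expansion -/

theorem branchProfile_apply_zero (t a : ℝ) (ψ : Profile) :
    branchProfile t a ψ 0 0 = a * (1 + a * ψ 0 0) := by
  have h : critMode (mSym t 1) 0 0 = 1 := cosN_zero_apply 1
  simp only [branchProfile, Pi.smul_apply, Pi.add_apply, ContinuousMap.coe_smul,
    ContinuousMap.coe_add, h, smul_eq_mul]

/-- Together with the formula for the value at ξ = 0, this identifies the sign of the first
component there with the sign of a. -/
theorem IsBranch.one_add_pos {b t : ℝ} {h : NearOnset b t} {a : ℝ} {ψ : Profile}
    (hψ : IsBranch h a ψ) : 0 < 1 + a * ψ 0 0 := by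
  have h1 : |ψ 0 0| ≤ 1 := ((ψ 0).norm_coe_le_norm 0).trans ((norm_le_pi_norm ψ 0).trans hψ.norm_le)
  have h2 : |a| ≤ 1 / 400000 := hψ.abs_le.trans ampMax_le
  have h3 : |a * ψ 0 0| ≤ 1 / 400000 * 1 := by
    rw [abs_mul]
    exact mul_le_mul h2 h1 (abs_nonneg _) (by norm_num)
  linarith [neg_abs_le (a * ψ 0 0)]

/-- The radius of the ball in `H²` in which the steady solutions are classified. -/
def radius : ℝ := ampMax / (2 * sumInv)

theorem radius_pos : 0 < radius := by
  have := one_le_sumInv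
  have := ampMax_pos
  unfold radius; positivity

theorem IsSmallEvenSteady.exists_onBranch {ε ω : ℝ} (h : Admissible ε ω) {u : Profile}
    (hu : IsSmallEvenSteady radius ε ω u) : ∃ a ψ, OnBranch h u a ψ := by
  have hmode : ModeEq (ε ^ 2) (waveNumber ε ω ^ 2) u := (isSteady_iff ε ω u).mp hu.steady
  have hS := one_le_sumInv
  have hA := ampMax_pos
  -- The Sobolev constant is `sumInv`, and `radius` was chosen so that their product is ampMax/2.
  have hsmall : ‖u‖ ≤ ampMax / 2 := by
    rw [pi_norm_le_iff_of_nonneg (by linarith)]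
    intro j
    obtain ⟨hH, -⟩ := hu.steady
    refine (norm_le_of_h2Norm_lt hH hu.small j).trans (le_of_eq ?_)
    unfold radius
    field_simp
  obtain ⟨a, ψ, h1, h2, h3⟩ := exists_branch_of_modeEq h.close hu.even hmode hsmall
  rw [dSym_one_eq] at h3
  have hT := (h1.landau_mem h.close).1
  by_cases hdeg : 0 < ε ∧ |ω| < 1 / 4
  · have h4 := hu.pos hdeg.1 hdeg.2
    rw [h2, branchProfile_apply_zero] at h4
    have ha : 0 < a := pos_of_mul_pos_left h4 h1.one_add_pos.le
    refine ⟨a, ψ, h1, h2, ha.le, ?_⟩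
    rcases mul_eq_zero.mp h3 with h5 | h5
    · exact absurd h5 ha.ne'
    · linarith
  -- In the degenerate cases μ = 0, and since T ≥ 1/4 the reduced equation leaves only a = 0; no
  -- sign condition is needed.
  · have hmu : ε ^ 2 * (1 - 16 * ω ^ 2) = 0 := by
      by_cases h0 : 0 < ε
      · have h5 : |ω| = 1 / 4 := le_antisymm h.omega_le (not_lt.mp fun h6 => hdeg ⟨h0, h6⟩)
        have h6 : ω ^ 2 = 1 / 16 := by rw [← sq_abs, h5]; norm_num
        rw [h6]; norm_num
      · have : ε = 0 := le_antisymm (not_lt.mp h0) h.eps_nonneg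
        rw [this]; norm_num
    rw [hmu] at h3
    have ha : a = 0 := by
      rcases mul_eq_zero.mp h3 with h5 | h5
      · exact h5
      · have h6 : a ^ 2 * landau (ε ^ 2 / 2 + 2) (mSym (waveNumber ε ω ^ 2) 1) a ψ = 0 := by
          linarith
        rcases mul_eq_zero.mp h6 with h7 | h7
        · exact pow_eq_zero_iff (two_ne_zero) |>.mp h7
        · linarith
    refine ⟨a, ψ, h1, h2, ha.ge, ?_⟩
    rw [hmu, ha]; ring

/-- The equation bounds n² times each coefficient by about the coefficient of the reaction term,
since t times the diffusion constant is at least 96/100. -/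
theorem OnBranch.h2Norm_le {ε ω : ℝ} {h : Admissible ε ω} {u : Profile} {a : ℝ}
    {ψ : Profile} (hu : OnBranch h u a ψ) : h2Norm u ≤ 400 * ε := by
  have hn := hu.norm_le
  have he := h.eps_le'
  have he0 := h.eps_nonneg
  have hno := h.nearOnset
  have hj : ∀ j, ‖u j‖ ≤ 4 * ε := fun j => (norm_le_pi_norm u j).trans hn
  have hq : ‖quadPart (ε ^ 2 / 2 + 2) u + cubicPart u‖ ≤ ε := by
    refine (norm_add_le _ _).trans ?_
    have h1 := norm_quadPart_le hno.abs_beta_le hn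
    have h2 := norm_cubicPart_le hn
    have : ε ^ 2 ≤ 1 / 800000 * ε := by nlinarith
    nlinarith
  have hlin : ∀ c : ℝ, |c| ≤ 5 →
      ‖c • u 0 + (4 : ℝ) • u 1 + (quadPart (ε ^ 2 / 2 + 2) u + cubicPart u)‖ ≤ 40 * ε := by
    intro c hc
    refine norm_add₃_le.trans ?_
    rw [norm_smul, norm_smul, Real.norm_eq_abs, Real.norm_eq_abs, abs_of_pos (by norm_num : (0:ℝ) < 4)]
    have := mul_le_mul hc (hj 0) (norm_nonneg _) (by norm_num)
    have := hj 1
    linarith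
  have hb := hno.b_le
  have hb0 := hno.b_nonneg
  have hr : ∀ j, ‖reactionAlong (ε ^ 2) u j‖ ≤ 40 * ε := by
    rw [Fin.forall_fin_two, reactionAlong_zero, reactionAlong_one, norm_neg]
    exact ⟨hlin _ (by rw [abs_of_nonneg] <;> linarith),
      hlin _ (by rw [abs_of_nonneg] <;> linarith)⟩
  have key := h2Norm_le_of_coeff_le (w := u) (f := u) (g := fun j => reactionAlong (ε ^ 2) u j)
    zero_le_one (zero_le_two) hj hr (fun j n => by
      have hm := hu.modeEq j n
      have hD : 4 ≤ diffusion j := by fin_cases j <;> simp [diffusion]; norm_num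
      have ht := hno.le_t
      have h1 : waveNumber ε ω ^ 2 * diffusion j * (n : ℝ) ^ 2 * ‖cc (u j) n‖
          = ‖cc (reactionAlong (ε ^ 2) u j) n‖ := by
        rw [← hm, norm_mul, Complex.norm_real, Real.norm_of_nonneg (by positivity)]
      have h2 : 96 / 100 ≤ waveNumber ε ω ^ 2 * diffusion j := by nlinarith
      have h3 : 96 / 100 * ((n : ℝ) ^ 2 * ‖cc (u j) n‖)
          ≤ waveNumber ε ω ^ 2 * diffusion j * ((n : ℝ) ^ 2 * ‖cc (u j) n‖) := by gcongr
      have h4 : 0 ≤ (n : ℝ) ^ 2 * ‖cc (u j) n‖ := by positivity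
      linarith)
  linarith

theorem OnBranch.abs_landau_sub_le {ε ω : ℝ} {h : Admissible ε ω} {u : Profile} {a : ℝ}
    {ψ : Profile} (hu : OnBranch h u a ψ) :
    |landau (ε ^ 2 / 2 + 2) (mSym (waveNumber ε ω ^ 2) 1) a ψ - 3 / 8|
      ≤ 70000 * sumInv * ε := by
  have h1 := abs_le.mp hu.branch.abs_landau_sub_le'
  have h2 := abs_le.mp h.abs_mSym_add_le
  have h3 := h.abs_quad_le
  have hS := one_le_sumInv
  have h4 := hu.amp_le
  rw [abs_of_nonneg hu.nonneg] at h1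
  have h5 := mul_le_mul_of_nonneg_left h3 (zero_le_one.trans hS)
  have h6 := mul_le_mul_of_nonneg_left h4 (zero_le_one.trans hS)
  have h7 : ε ≤ sumInv * ε := le_mul_of_one_le_left h.eps_nonneg hS
  have h8 := h.eps_nonneg
  rw [abs_le]
  constructor <;> linarith

/-- Let s be the leading amplitude, so (3/8)s² = a²T. Then (3/8)(a - s)(a + s) = a²(3/8 - T), and a²
≤ a(a + s) permits division by a + s. Dividing by the square root instead would lose uniformity as ω
→ ±1/4. -/
theorem OnBranch.abs_amp_sub_le {ε ω : ℝ} {h : Admissible ε ω} {u : Profile} {a : ℝ}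
    {ψ : Profile} (hu : OnBranch h u a ψ) :
    |a - 2 * (ε * √(2 / 3 * (1 - 16 * ω ^ 2)))| ≤ 400000 * sumInv * ε ^ 2 := by
  have hw := h.omega_sq_le
  have he := h.eps_nonneg
  have hS := one_le_sumInv
  set s := 2 * (ε * √(2 / 3 * (1 - 16 * ω ^ 2))) with hs
  have hs0 : 0 ≤ s := by positivity
  have hs2 : s ^ 2 * (3 / 8) = ε ^ 2 * (1 - 16 * ω ^ 2) := by
    rw [hs, mul_pow, mul_pow, Real.sq_sqrt (by linarith)]
    ring
  have hT := hu.abs_landau_sub_le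
  have hamp := hu.amp
  have ha := hu.nonneg
  have hale := hu.amp_le
  set T := landau (ε ^ 2 / 2 + 2) (mSym (waveNumber ε ω ^ 2) 1) a ψ
  rcases (add_nonneg ha hs0).eq_or_lt with h0 | h0
  · have h1 : a = 0 := by linarith
    have h2 : s = 0 := by linarith
    rw [h1, h2]; simp; positivity
  · have h1 : (3 / 8) * (a - s) * (a + s) = a ^ 2 * (3 / 8 - T) := by
      linear_combination hamp - hs2
    have h2 : |a - s| * (a + s) ≤ (8 / 3 * (a * |T - 3 / 8|)) * (a + s) := by
      have h3 : |a - s| * (a + s) = 8 / 3 * (a ^ 2 * |T - 3 / 8|) := by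
        rw [abs_sub_comm T, ← abs_of_nonneg h0.le, ← abs_mul,
          show (a - s) * (a + s) = 8 / 3 * (a ^ 2 * (3 / 8 - T)) by linarith, abs_mul, abs_mul,
          abs_of_nonneg (sq_nonneg a)]
        norm_num
      rw [h3]
      have : 0 ≤ a * |T - 3 / 8| * s := by positivity
      nlinarith
    have h3 := le_of_mul_le_mul_right h2 h0
    have h4 : a * |T - 3 / 8| ≤ (2 * ε) * (70000 * sumInv * ε) :=
      mul_le_mul hale hT (abs_nonneg _) (by linarith)
    have h5 : 0 ≤ sumInv * ε ^ 2 := by positivity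
    nlinarith

theorem leadingProfile_zero (ε ω : ℝ) : leadingProfile ε ω 0
    = (2 * (ε * √(2 / 3 * (1 - 16 * ω ^ 2)))) • cosN 1 := by
  ext x
  simp [leadingProfile, cosN]
  ring

theorem leadingProfile_one (ε ω : ℝ) : leadingProfile ε ω 1
    = (-(ε * √(2 / 3 * (1 - 16 * ω ^ 2)))) • cosN 1 := by
  ext x
  simp [leadingProfile, cosN]

theorem OnBranch.h2Norm_sub_le {ε ω : ℝ} {h : Admissible ε ω} {u : Profile} {a : ℝ}
    {ψ : Profile} (hu : OnBranch h u a ψ) :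
    h2Norm (u - leadingProfile ε ω) ≤ 2000000 * sumInv * ε ^ 2 := by
  have hS := one_le_sumInv
  have he := h.eps_nonneg
  have he' := h.eps_le'
  have hno := h.nearOnset
  have ha := hu.abs_amp_sub_le
  set l := ε * √(2 / 3 * (1 - 16 * ω ^ 2)) with hl
  set m := mSym (waveNumber ε ω ^ 2) 1 with hmdef
  set q := quadPart (ε ^ 2 / 2 + 2) u + cubicPart u with hq
  have hqn : ‖q‖ ≤ 200 * ε ^ 2 := by
    refine (norm_add_le _ _).trans ?_
    have h1 := norm_quadPart_le hno.abs_beta_le hu.norm_le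
    have h2 := norm_cubicPart_le hu.norm_le
    have : ε ^ 3 ≤ ε ^ 2 := by nlinarith [sq_nonneg ε]
    nlinarith
  -- These are the cos ξ components of the error. The second is small because m is within ε of -1/2;
  -- the remainder is the partial inverse of a forcing of size ε².
  let c : Fin 2 → ℝ := ![a - 2 * l, a * m + l]
  have hc : ∀ j, |c j| ≤ 400000 * sumInv * ε ^ 2 := by
    rw [Fin.forall_fin_two]
    refine ⟨ha, ?_⟩
    change |a * m + l| ≤ _
    have h1 : a * m + l = a * (m + 1 / 2) - 1 / 2 * (a - 2 * l) := by ring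
    have h2 : |a * (m + 1 / 2)| ≤ (2 * ε) * ε := by
      rw [abs_mul, abs_of_nonneg hu.nonneg]
      exact mul_le_mul hu.amp_le h.abs_mSym_add_le (abs_nonneg _) (by linarith)
    rw [h1]
    refine (abs_sub _ _).trans ?_
    rw [abs_mul (1 / 2), abs_of_pos (by norm_num : (0 : ℝ) < 1 / 2)]
    have h3 : ε ^ 2 ≤ sumInv * ε ^ 2 := le_mul_of_one_le_left (sq_nonneg _) hS
    nlinarith
  have hueq : ∀ j, (u - leadingProfile ε ω) j = c j • cosN 1 + partialInv hno q j := by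
    have h1 := hu.branch.branchProfile_eq
    rw [← hu.eq] at h1
    rw [Fin.forall_fin_two]
    constructor
    · rw [Pi.sub_apply, leadingProfile_zero, ← hl]
      conv_lhs => rw [h1]
      simp only [critMode, Pi.add_apply, Pi.smul_apply, Matrix.cons_val_zero, c]
      module
    · rw [Pi.sub_apply, leadingProfile_one, ← hl]
      conv_lhs => rw [h1]
      simp only [critMode, Pi.add_apply, Pi.smul_apply, Matrix.cons_val_one,
        Matrix.cons_val_fin_one, c]
      module
  have hpart : ∀ j (n : ℤ), (1 + (n : ℝ) ^ 2) * ‖cc (partialInv hno q j) n‖ ≤ 4 * ‖cc q n‖ := by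
    intro j n
    have hN : (0 : ℝ) < 1 + (n : ℝ) ^ 2 := by positivity
    rw [cc_eq_coef (partialInv_even hno q j), Complex.norm_real, Real.norm_eq_abs]
    have h1 : |coef n q| ≤ ‖cc q n‖ := Complex.abs_re_le_norm _
    have h2 : ∀ s : ℝ, |s| ≤ 4 / (1 + (n : ℝ) ^ 2) →
        (1 + (n : ℝ) ^ 2) * |s * coef n q| ≤ 4 * ‖cc q n‖ := by
      intro s hs
      rw [abs_mul, ← mul_assoc]
      refine mul_le_mul ?_ h1 (abs_nonneg _) (by norm_num)
      rw [le_div_iff₀ hN] at hs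
      linarith
    fin_cases j
    · change _ * |coef n (evenMul (isSmoothing_invSym₀ hno) q)| ≤ _
      rw [coef_evenMul]
      exact h2 _ ((isSmoothing_invSym₀ hno).bound n)
    · change _ * |coef n (evenMul (isSmoothing_invSym₁ hno) q)| ≤ _
      rw [coef_evenMul]
      exact h2 _ ((isSmoothing_invSym₁ hno).bound n)
  have hcos : ∀ n : ℤ, (1 + (n : ℝ) ^ 2) * ‖cc (cosN 1) n‖ = 2 * ‖cc (cosN 1) n‖ := by
    intro n
    rw [cc_cosN]
    by_cases h1 : n = 1
    · subst h1; norm_num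
    · by_cases h2 : n = -1
      · subst h2; norm_num
      · simp [h1, h2]
  have key := h2Norm_le_of_coeff_le (w := u - leadingProfile ε ω) (f := fun j => c j • cosN 1)
    (g := fun _ => q) (zero_le_two) (by norm_num : (0 : ℝ) ≤ 4)
    (F := 400000 * sumInv * ε ^ 2) (G := 200 * ε ^ 2) (fun j => by
      rw [norm_smul, Real.norm_eq_abs]
      have := norm_cosN_le 1
      exact (mul_le_of_le_one_right (abs_nonneg _) this).trans (hc j)) (fun _ => hqn)
    (fun j n => by
      rw [hueq, cc_add, cc_smul]
      have hN : (0 : ℝ) ≤ 1 + (n : ℝ) ^ 2 := by positivity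
      refine (mul_le_mul_of_nonneg_left (norm_add_le _ _) hN).trans ?_
      rw [mul_add]
      refine add_le_add (le_of_eq ?_) (hpart j n)
      rw [norm_mul, mul_left_comm, hcos]
      ring)
  have h3 : ε ^ 2 ≤ sumInv * ε ^ 2 := le_mul_of_one_le_left (sq_nonneg _) hS
  nlinarith [sq_nonneg ε]

theorem OnBranch.isSmallEvenSteady {ε ω : ℝ} {h : Admissible ε ω} {u : Profile} {a : ℝ}
    {ψ : Profile} (hu : OnBranch h u a ψ) {ρ : ℝ} (hρ : 400 * ε < ρ) :
    IsSmallEvenSteady ρ ε ω u where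
  steady := (isSteady_iff ε ω u).mpr hu.modeEq
  small := hu.h2Norm_le.trans_lt hρ
  even := hu.even
  pos := by
    intro h0 h1
    have h2 : ω ^ 2 < 1 / 16 := by
      have := abs_lt.mp h1
      nlinarith
    have h3 : 0 < ε ^ 2 * (1 - 16 * ω ^ 2) := mul_pos (by positivity) (by linarith)
    have h4 : a ≠ 0 := by
      intro h5
      have := hu.amp
      rw [h5] at this
      linarith
    have h5 : 0 < a := lt_of_le_of_ne hu.nonneg h4.symm
    rw [hu.eq, branchProfile_apply_zero]
    exact mul_pos h5 hu.branch.one_add_pos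

/-! ### Spectrum of an operator with a two-dimensional almost-kernel -/

section Abstract

variable {E : Type*} [NormedAddCommGroup E] [NormedSpace ℂ E]

/-- `R` is a bounded two-sided inverse of the partially defined operator `L`. -/
structure IsInv {D : Submodule ℂ E} (L : D →ₗ[ℂ] E) (R : E →L[ℂ] E) : Prop where
  right : ∀ y, ∃ h : R y ∈ D, L ⟨R y, h⟩ = y
  left : ∀ x : D, R (L x) = x

/-- A bounded operator restricted to a subspace. -/
def onDomain (D : Submodule ℂ E) (K : E →L[ℂ] E) : D →ₗ[ℂ] E := K.toLinearMap ∘ₗ D.subtype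

@[simp] theorem onDomain_apply (D : Submodule ℂ E) (K : E →L[ℂ] E) (x : D) :
    onDomain D K x = K x := rfl

theorem mem_opSpectrum_iff (A : E →ₗ.[ℂ] E) (z : ℂ) :
    z ∈ opSpectrum A ↔ ¬ ∃ R, IsInv (A.toFun - z • A.domain.subtype) R := by
  refine not_congr (exists_congr fun R => ?_)
  constructor
  · rintro ⟨h1, h2⟩
    exact ⟨h1, h2⟩
  · rintro ⟨h1, h2⟩
    exact ⟨h1, h2⟩

/-- Neumann series: the inverse is R(1 + KR)⁻¹, and the second factor has norm at most 2. -/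
theorem IsInv.add_bounded [CompleteSpace E] {D : Submodule ℂ E} {L : D →ₗ[ℂ] E} {R : E →L[ℂ] E}
    (h : IsInv L R) (K : E →L[ℂ] E) (hK : ‖K‖ * ‖R‖ ≤ 1 / 2) :
    ∃ R', IsInv (L + onDomain D K) R' ∧ ‖R'‖ ≤ 2 * ‖R‖ := by
  have hn : ‖K * R‖ ≤ 1 / 2 := (norm_mul_le K R).trans hK
  have hlt : ‖-(K * R)‖ < 1 := by rw [norm_neg]; linarith
  set U := Units.oneSub (-(K * R)) hlt
  have hU : (U : E →L[ℂ] E) = 1 + K * R := by simp [U]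
  have h1 : (1 + K * R) * (↑U⁻¹ : E →L[ℂ] E) = 1 := by rw [← hU]; exact U.mul_inv
  have h2 : (↑U⁻¹ : E →L[ℂ] E) * (1 + K * R) = 1 := by rw [← hU]; exact U.inv_mul
  set S : E →L[ℂ] E := ↑U⁻¹
  have hS : ‖S‖ ≤ 2 := by
    have e : S = 1 - K * R * S := by
      rw [add_mul, one_mul] at h1
      exact eq_sub_of_add_eq h1
    have h3 : ‖S‖ ≤ 1 + 1 / 2 * ‖S‖ := by
      conv_lhs => rw [e]
      refine (norm_sub_le _ _).trans (add_le_add ContinuousLinearMap.norm_id_le ?_)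
      exact (norm_mul_le _ _).trans (mul_le_mul_of_nonneg_right hn (norm_nonneg _))
    linarith
  refine ⟨R * S, ⟨fun y => ?_, fun x => ?_⟩, ?_⟩
  · obtain ⟨hm, hL⟩ := h.right (S y)
    refine ⟨hm, ?_⟩
    change L ⟨R (S y), hm⟩ + K (R (S y)) = y
    rw [hL]
    exact congrArg (fun T : E →L[ℂ] E => T y) h1
  · have h3 := congrArg (fun T : E →L[ℂ] E => T (L x)) h2
    have h4 : S (L x + K (R (L x))) = L x := h3
    rw [h.left] at h4
    change R (S (L x + K x)) = x
    rw [h4, h.left]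
  · refine (norm_mul_le _ _).trans ?_
    nlinarith [norm_nonneg R]

/-- The Sherman–Morrison formula, valid for an unbounded operator because R maps into the domain. -/
theorem IsInv.add_rankOne {D : Submodule ℂ E} {L : D →ₗ[ℂ] E} {R : E →L[ℂ] E}
    (h : IsInv L R) (φ : E →L[ℂ] ℂ) (v : E) (he : 1 + φ (R v) ≠ 0) :
    IsInv (L + onDomain D (φ.smulRight v))
      (R - (1 + φ (R v))⁻¹ • (φ.comp R).smulRight (R v)) := by
  constructor
  · intro y
    obtain ⟨h1, h2⟩ := h.right y
    obtain ⟨h3, h4⟩ := h.right v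
    have hmem : R y - ((1 + φ (R v))⁻¹ * φ (R y)) • R v ∈ D :=
      D.sub_mem h1 (D.smul_mem _ h3)
    have e : (R - (1 + φ (R v))⁻¹ • (φ.comp R).smulRight (R v)) y
        = R y - ((1 + φ (R v))⁻¹ * φ (R y)) • R v := by
      simp [smul_smul]
    have e2 : ∀ hm, (⟨(R - (1 + φ (R v))⁻¹ • (φ.comp R).smulRight (R v)) y, hm⟩ : D)
        = ⟨R y, h1⟩ - ((1 + φ (R v))⁻¹ * φ (R y)) • ⟨R v, h3⟩ := fun _ => Subtype.ext e
    refine ⟨by rw [e]; exact hmem, ?_⟩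
    rw [e2]
    simp only [LinearMap.add_apply, map_sub, map_smul, h2, h4, onDomain_apply,
      ContinuousLinearMap.smulRight_apply]
    have : y + φ (R y) • v - ((1 + φ (R v))⁻¹ * φ (R y)) • (v + φ (R v) • v)
        = y + (φ (R y) - (1 + φ (R v))⁻¹ * (1 + φ (R v)) * φ (R y)) • v := by
      module
    rw [this, inv_mul_cancel₀ he]
    simp
  · intro x
    have e : φ (R (L x + φ x • v)) = φ x * (1 + φ (R v)) := by
      rw [map_add, h.left, map_smul, map_add, map_smul, smul_eq_mul]; ring
    change R (L x + φ x • v) - (1 + φ (R v))⁻¹ • φ (R (L x + φ x • v)) • R v = x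
    rw [e, smul_smul, mul_left_comm, inv_mul_cancel₀ he, mul_one, map_add, h.left, map_smul]
    simp

/-- The vector Rv is annihilated by the perturbed operator, and it is nonzero because φ(Rv) = -1. -/
theorem IsInv.not_exists_of_rankOne {D : Submodule ℂ E} {L : D →ₗ[ℂ] E} {R : E →L[ℂ] E}
    (h : IsInv L R) (φ : E →L[ℂ] ℂ) (v : E) (he : 1 + φ (R v) = 0) :
    ¬ ∃ R', IsInv (L + onDomain D (φ.smulRight v)) R' := by
  rintro ⟨R', h'⟩
  obtain ⟨h3, h4⟩ := h.right v
  have h5 := h'.left ⟨R v, h3⟩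
  have h6 : (L + onDomain D (φ.smulRight v)) ⟨R v, h3⟩ = 0 := by
    simp only [LinearMap.add_apply, h4, onDomain_apply, ContinuousLinearMap.smulRight_apply]
    rw [show v + φ (R v) • v = (1 + φ (R v)) • v by module, he, zero_smul]
  rw [h6, map_zero] at h5
  have h7 : R v = 0 := h5.symm
  rw [h7] at he
  simp at he

theorem IsInv.resolvent_identity {D : Submodule ℂ E} {L : D →ₗ[ℂ] E} {z w : ℂ}
    {R R' : E →L[ℂ] E} (h : IsInv (L - z • D.subtype) R) (h' : IsInv (L - w • D.subtype) R')
    (y : E) : R y - R' y = (z - w) • R (R' y) := by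
  obtain ⟨h1, h2⟩ := h'.right y
  have h3 := h.left ⟨R' y, h1⟩
  have h4 : (L - z • D.subtype) ⟨R' y, h1⟩ = y - (z - w) • R' y := by
    have h2' : L ⟨R' y, h1⟩ - w • R' y = y := h2
    change L ⟨R' y, h1⟩ - z • R' y = y - (z - w) • R' y
    have h5 := eq_add_of_sub_eq h2'
    rw [h5]; module
  rw [h4, map_sub, map_smul] at h3
  change R y - (z - w) • R (R' y) = R' y at h3
  exact sub_eq_iff_eq_add'.mpr (sub_eq_iff_eq_add.mp h3)

/-- The data of an operator `A` that becomes uniformly invertible in the half plane `Re z ≥ -1/8`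
after shifting a two-dimensional almost-kernel, spanned by an even vector `vc` and an odd vector
`vs` with respect to a symmetry `J`. -/
structure AlmostKernel (A : E →ₗ.[ℂ] E) (M a η : ℝ) (vc vs : A.domain) (φc φs : E →L[ℂ] ℂ)
    (J : E →L[ℂ] E) : Prop where
  one_le_M : 1 ≤ M
  one_le_a : 1 ≤ a
  eta_nonneg : 0 ≤ η
  small : 16 * a * M ^ 2 * η ≤ 1
  norm_φc : ‖φc‖ ≤ a
  norm_φs : ‖φs‖ ≤ a
  φc_vc : φc vc = 1
  φc_vs : φc vs = 0
  φs_vc : φs vc = 0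
  φs_vs : φs vs = 1
  norm_A_vc : ‖A vc‖ ≤ η
  norm_A_vs : ‖A vs‖ ≤ η
  dual : ∀ x : A.domain, ‖φc (A x)‖ ≤ η * ‖(x : E)‖
  J_mem : ∀ x ∈ A.domain, J x ∈ A.domain
  J_comm : ∀ x : A.domain, A ⟨J x, J_mem x x.2⟩ = J (A x)
  J_vc : J vc = vc
  J_vs : J vs = -vs
  φc_J : ∀ x, φc (J x) = φc x
  φs_J : ∀ x, φs (J x) = -φs x
  inv : ∀ z : ℂ, -(1 / 8) ≤ z.re → ∃ R, ‖R‖ ≤ M ∧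
    IsInv (A.toFun - onDomain _ (φc.smulRight (vc : E)) - onDomain _ (φs.smulRight (vs : E))
      - z • A.domain.subtype) R

namespace AlmostKernel

variable {A : E →ₗ.[ℂ] E} {M a η : ℝ} {vc vs : A.domain} {φc φs : E →L[ℂ] ℂ} {J : E →L[ℂ] E}

/-- The operator with the almost-kernel shifted away. -/
def shifted (A : E →ₗ.[ℂ] E) (vc vs : A.domain) (φc φs : E →L[ℂ] ℂ) : A.domain →ₗ[ℂ] E :=
  A.toFun - onDomain _ (φc.smulRight (vc : E)) - onDomain _ (φs.smulRight (vs : E))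

theorem one_add_ne_zero {z : ℂ} (hz : -(1 / 8) ≤ z.re) : 1 + z ≠ 0 := by
  intro h
  have := congrArg Complex.re h
  simp at this
  linarith

/-- On vc the shifted operator minus z acts as A vc - (1 + z)vc; apply R and then φc. The result
rewrites the Sherman–Morrison denominator as z plus a term of size O(η). -/
theorem one_add_mul_φc (h : AlmostKernel A M a η vc vs φc φs J) {z : ℂ}
    {R : E →L[ℂ] E} (hR : IsInv (shifted A vc vs φc φs - z • A.domain.subtype) R) :
    (1 + z) * (1 + φc (R vc)) = z + φc (R (A vc)) := by
  have h1 := hR.left vc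
  have h2 : (shifted A vc vs φc φs - z • A.domain.subtype) vc
      = A vc - (1 + z) • (vc : E) := by
    change A vc - φc vc • (vc : E) - φs vc • (vs : E) - z • (vc : E) = _
    rw [h.φc_vc, h.φs_vc]; module
  rw [h2, map_sub, map_smul] at h1
  have h3 := congrArg φc h1
  rw [map_sub, map_smul, h.φc_vc, smul_eq_mul] at h3
  linear_combination (-1) * h3

theorem one_add_mul_φs (h : AlmostKernel A M a η vc vs φc φs J) {z : ℂ}
    {R : E →L[ℂ] E} (hR : IsInv (shifted A vc vs φc φs - z • A.domain.subtype) R) :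
    (1 + z) * (1 + φs (R vs)) = z + φs (R (A vs)) := by
  have h1 := hR.left vs
  have h2 : (shifted A vc vs φc φs - z • A.domain.subtype) vs
      = A vs - (1 + z) • (vs : E) := by
    change A vs - φc vs • (vc : E) - φs vs • (vs : E) - z • (vs : E) = _
    rw [h.φc_vs, h.φs_vs]; module
  rw [h2, map_sub, map_smul] at h1
  have h3 := congrArg φs h1
  rw [map_sub, map_smul, h.φs_vs, smul_eq_mul] at h3
  linear_combination (-1) * h3

theorem J_R (h : AlmostKernel A M a η vc vs φc φs J) {z : ℂ}
    {R : E →L[ℂ] E} (hR : IsInv (shifted A vc vs φc φs - z • A.domain.subtype) R) (y : E) :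
    R (J y) = J (R y) := by
  obtain ⟨h1, h2⟩ := hR.right y
  have h3 := hR.left ⟨J (R y), h.J_mem _ h1⟩
  have h4 : (shifted A vc vs φc φs - z • A.domain.subtype) ⟨J (R y), h.J_mem _ h1⟩ = J y := by
    have h2' : A ⟨R y, h1⟩ - φc (R y) • (vc : E) - φs (R y) • (vs : E) - z • R y = y := h2
    have h5 := h.J_comm ⟨R y, h1⟩
    change A ⟨J (R y), h.J_mem _ h1⟩ - φc (J (R y)) • (vc : E) - φs (J (R y)) • (vs : E)
      - z • J (R y) = J y
    rw [h5, h.φc_J, h.φs_J]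
    conv_rhs => rw [← h2']
    simp only [map_sub, map_smul, h.J_vc, h.J_vs]
    module
  rw [h4] at h3
  exact h3

/-- The resolvent commutes with J, so R vc is even, while φs is odd. -/
theorem φs_R_vc (h : AlmostKernel A M a η vc vs φc φs J) {z : ℂ}
    {R : E →L[ℂ] E} (hR : IsInv (shifted A vc vs φc φs - z • A.domain.subtype) R) :
    φs (R vc) = 0 := by
  have h1 := h.J_R hR vc
  rw [h.J_vc] at h1
  have h2 := h.φs_J (R vc)
  rw [← h1] at h2
  have h3 : (2 : ℂ) * φs (R vc) = 0 := by linear_combination h2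
  simpa using h3

/-- A - z is the shifted operator with two rank-one terms added back. Since φs(R vc) = 0, the
associated 2 × 2 matrix is triangular, so invertibility is decided by its two diagonal entries. -/
theorem mem_opSpectrum_iff' (h : AlmostKernel A M a η vc vs φc φs J) {z : ℂ}
    (hz : -(1 / 8) ≤ z.re)
    {R : E →L[ℂ] E} (hR : IsInv (shifted A vc vs φc φs - z • A.domain.subtype) R) :
    z ∈ opSpectrum A ↔ z + φc (R (A vc)) = 0 ∨ z + φs (R (A vs)) = 0 := by
  rw [← h.one_add_mul_φc hR, ← h.one_add_mul_φs hR, mul_eq_zero, mul_eq_zero,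
    or_iff_right (one_add_ne_zero hz), or_iff_right (one_add_ne_zero hz), mem_opSpectrum_iff]
  have hsc := h.φs_R_vc hR
  have e : A.toFun - z • A.domain.subtype = shifted A vc vs φc φs - z • A.domain.subtype
      + onDomain _ (φc.smulRight (vc : E)) + onDomain _ (φs.smulRight (vs : E)) := by
    rw [shifted]; abel
  have e' : A.toFun - z • A.domain.subtype = shifted A vc vs φc φs - z • A.domain.subtype
      + onDomain _ (φs.smulRight (vs : E)) + onDomain _ (φc.smulRight (vc : E)) := by
    rw [shifted]; abel
  constructor
  · intro hns
    by_contra! hcon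
    apply hns
    have h1 := hR.add_rankOne φc vc hcon.1
    rw [e]
    have h2 : φs ((R - (1 + φc (R vc))⁻¹ • (φc.comp R).smulRight (R vc)) vs) = φs (R vs) := by
      simp [hsc]
    exact ⟨_, h1.add_rankOne φs vs (by rw [h2]; exact hcon.2)⟩
  · intro hor
    by_cases hc : 1 + φc (R vc) = 0
    · rintro ⟨R', hR'⟩
      obtain ⟨h3, h4⟩ := hR.right vc
      have h5 := hR'.left ⟨R vc, h3⟩
      rw [e] at h5
      simp only [LinearMap.add_apply, h4, onDomain_apply, ContinuousLinearMap.smulRight_apply,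
        hsc, zero_smul, add_zero] at h5
      rw [show (vc : E) + φc (R vc) • (vc : E) = (1 + φc (R vc)) • (vc : E) by module, hc,
        zero_smul, map_zero] at h5
      rw [← h5] at hc
      simp at hc
    · have hs := hor.resolve_left hc
      have h1 := hR.add_rankOne φc vc hc
      have h2 : φs ((R - (1 + φc (R vc))⁻¹ • (φc.comp R).smulRight (R vc)) vs) = φs (R vs) := by
        simp [hsc]
      rw [e]
      exact h1.not_exists_of_rankOne φs vs (by rw [h2]; exact hs)

theorem norm_φ_R_R_le (h : AlmostKernel A M a η vc vs φc φs J) {φ : E →L[ℂ] ℂ} (hφ : ‖φ‖ ≤ a)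
    {R R' : E →L[ℂ] E} (hR : ‖R‖ ≤ M) (hR' : ‖R'‖ ≤ M) {y : E} (hy : ‖y‖ ≤ η) :
    ‖φ (R (R' y))‖ ≤ 1 / 2 := by
  have hM := h.one_le_M
  have ha := h.one_le_a
  have h1 : ‖R' y‖ ≤ M * η := R'.le_of_opNorm_le_of_le hR' hy
  have h2 : ‖R (R' y)‖ ≤ M * (M * η) := R.le_of_opNorm_le_of_le hR h1
  have h3 : ‖φ (R (R' y))‖ ≤ a * (M * (M * η)) := φ.le_of_opNorm_le_of_le hφ h2
  have := h.small
  linarith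

theorem norm_φ_R_le (h : AlmostKernel A M a η vc vs φc φs J) {φ : E →L[ℂ] ℂ} (hφ : ‖φ‖ ≤ a)
    {R : E →L[ℂ] E} (hR : ‖R‖ ≤ M) {y : E} (hy : ‖y‖ ≤ η) :
    ‖φ (R y)‖ ≤ 1 / 8 := by
  have hM := h.one_le_M
  have ha := h.one_le_a
  have h2 : ‖R y‖ ≤ M * η := R.le_of_opNorm_le_of_le hR hy
  have h3 : ‖φ (R y)‖ ≤ a * (M * η) := φ.le_of_opNorm_le_of_le hφ h2
  have h4 := h.small
  have h5 : a * (M * η) ≤ a * (M ^ 2 * η) := by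
    have := h.eta_nonneg
    gcongr
    nlinarith
  linarith

/-- By the resolvent identity the difference carries a factor z - w, and smallness of aM²η bounds
the rest by 1/2. This gives both the contraction for the even eigenvalue and uniqueness of zeros. -/
theorem norm_sub_le_of_char (h : AlmostKernel A M a η vc vs φc φs J) {φ : E →L[ℂ] ℂ}
    (hφ : ‖φ‖ ≤ a) {y : E} (hy : ‖y‖ ≤ η) {z w : ℂ} {R R' : E →L[ℂ] E} (hRM : ‖R‖ ≤ M)
    (hRM' : ‖R'‖ ≤ M) (hR : IsInv (shifted A vc vs φc φs - z • A.domain.subtype) R)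
    (hR' : IsInv (shifted A vc vs φc φs - w • A.domain.subtype) R') :
    ‖φ (R y) - φ (R' y)‖ ≤ 1 / 2 * ‖z - w‖ := by
  rw [← map_sub, hR.resolvent_identity hR', map_smul, norm_smul, mul_comm]
  exact mul_le_mul_of_nonneg_right (h.norm_φ_R_R_le hφ hRM hRM' hy) (norm_nonneg _)

/-- Comparison of the characteristic function at an approximate eigenvalue. -/
theorem norm_char_le (h : AlmostKernel A M a η vc vs φc φs J) {z : ℂ}
    {R : E →L[ℂ] E} (hRM : ‖R‖ ≤ M)
    (hR : IsInv (shifted A vc vs φc φs - z • A.domain.subtype) R) (W : A.domain)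
    (hW : φs W = 0) :
    ‖φc W‖ * ‖z + φc (R (A vc))‖
      ≤ ‖z * φc W - φc (A W)‖ + η * M * (‖A W‖ + ‖z‖ * ‖(W : E)‖) := by
  -- Applying φc to the resolvent equation and using that φc ∘ A is small shows that (1 + z)φc(Ry)
  -- is -φc(y) up to O(η). This extra η on top of the residual of W is what yields third order
  -- accuracy.
  have key : ∀ y, ∃ r : ℂ, ‖r‖ ≤ η * (M * ‖y‖) ∧ (1 + z) * φc (R y) = r - φc y := by
    intro y
    obtain ⟨h1, h2⟩ := hR.right y
    refine ⟨φc (A ⟨R y, h1⟩), ?_, ?_⟩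
    · refine (h.dual _).trans ?_
      exact mul_le_mul_of_nonneg_left (R.le_of_opNorm_le hRM y) h.eta_nonneg
    · have h2' : A ⟨R y, h1⟩ - φc (R y) • (vc : E) - φs (R y) • (vs : E) - z • R y = y := h2
      have h3 := congrArg φc h2'
      simp only [map_sub, map_smul, h.φc_vc, h.φc_vs, smul_eq_mul] at h3
      linear_combination (-1) * h3
  have h1 := hR.left W
  have h2 : (shifted A vc vs φc φs - z • A.domain.subtype) W
      = A W - φc W • (vc : E) - z • (W : E) := by
    change A W - φc W • (vc : E) - φs W • (vs : E) - z • (W : E) = _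
    rw [hW]; module
  rw [h2] at h1
  have h3 := congrArg φc h1
  simp only [map_sub, map_smul, smul_eq_mul] at h3
  obtain ⟨r₁, hr₁, e₁⟩ := key (A W)
  obtain ⟨r₂, hr₂, e₂⟩ := key W
  have e3 : φc W * (z + φc (R (A vc))) = (z * φc W - φc (A W)) + (r₁ - z * r₂) := by
    rw [← h.one_add_mul_φc hR]
    linear_combination (-(1 + z)) * h3 + e₁ - z * e₂
  rw [← norm_mul, e3]
  refine (norm_add_le _ _).trans ?_
  gcongr
  refine (norm_sub_le _ _).trans ?_
  rw [norm_mul]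
  have := mul_le_mul_of_nonneg_left hr₂ (norm_nonneg z)
  linarith

/-- An odd approximate kernel of arbitrary accuracy forces the odd characteristic function to
vanish at `0`. -/
theorem φs_char_zero (h : AlmostKernel A M a η vc vs φc φs J)
    {R : E →L[ℂ] E} (hR : IsInv (shifted A vc vs φc φs - (0 : ℂ) • A.domain.subtype) R)
    (happrox : ∀ d > (0 : ℝ), ∃ w : A.domain, (w : E) ≠ 0 ∧ φc w = 0 ∧ ‖A w‖ ≤ d * ‖(w : E)‖) :
    (0 : ℂ) + φs (R (A vs)) = 0 := by
  rw [← h.one_add_mul_φs hR, add_zero, one_mul]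
  by_contra hne
  set o := 1 + φs (R vs) with ho
  have hopos : 0 < ‖o‖ := norm_pos_iff.mpr hne
  -- If the odd function did not vanish at 0, A would satisfy ‖w‖ ≤ C‖Aw‖ for all w with φc w = 0;
  -- accuracy 1/(2(C + 1)) contradicts this.
  set C := ‖R‖ + ‖φs‖ * ‖R‖ / ‖o‖ * ‖R vs‖ with hC
  have hC0 : 0 ≤ C := by positivity
  obtain ⟨w, hw0, hwc, hAw⟩ := happrox (1 / (2 * (C + 1))) (by positivity)
  have h1 := hR.left w
  have h2 : (shifted A vc vs φc φs - (0 : ℂ) • A.domain.subtype) w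
      = A w - φs w • (vs : E) := by
    change A w - φc w • (vc : E) - φs w • (vs : E) - (0 : ℂ) • (w : E) = _
    rw [hwc]; module
  rw [h2, map_sub, map_smul] at h1
  have h3 := congrArg φs h1
  simp only [map_sub, map_smul, smul_eq_mul] at h3
  have h4 : φs w * o = φs (R (A w)) := by rw [ho]; linear_combination (-1) * h3
  have h5 : ‖φs w‖ ≤ ‖φs‖ * ‖R‖ / ‖o‖ * ‖A w‖ := by
    have : ‖φs w‖ * ‖o‖ ≤ ‖φs‖ * (‖R‖ * ‖A w‖) := by
      rw [← norm_mul, h4]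
      exact (φs.le_opNorm _).trans (mul_le_mul_of_nonneg_left (R.le_opNorm _) (norm_nonneg _))
    rw [div_mul_eq_mul_div, le_div_iff₀ hopos]
    linarith
  have h6 : ‖(w : E)‖ ≤ C * ‖A w‖ := by
    rw [← h1]
    refine (norm_sub_le _ _).trans ?_
    rw [norm_smul, hC, add_mul]
    have := mul_le_mul_of_nonneg_right h5 (norm_nonneg (R vs))
    have := R.le_opNorm (A w)
    linarith
  have hw : 0 < ‖(w : E)‖ := norm_pos_iff.mpr hw0
  have h7 : ‖(w : E)‖ ≤ C * (1 / (2 * (C + 1)) * ‖(w : E)‖) :=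
    h6.trans (mul_le_mul_of_nonneg_left hAw hC0)
  have h8 : C * (1 / (2 * (C + 1))) ≤ 1 / 2 := by
    rw [mul_one_div, div_le_div_iff₀ (by positivity) (by norm_num)]
    linarith
  nlinarith

/-- The spectrum of an operator with an almost-kernel: apart from two eigenvalues near `0` it lies
in `Re z < -1/8`. -/
theorem spectrum_eq (h : AlmostKernel A M a η vc vs φc φs J) {lam : ℂ} (hlam : -(1 / 8) ≤ lam.re)
    (W : A.domain) (hWs : φs W = 0) (hWc : 1 / 2 ≤ ‖φc W‖)
    (happrox : ∀ R : E →L[ℂ] E, IsInv (shifted A vc vs φc φs - (0 : ℂ) • A.domain.subtype) R →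
      (0 : ℂ) + φs (R (A vs)) = 0) :
    ∃ (S : Set ℂ) (l : ℂ), opSpectrum A = S ∪ {l, 0} ∧
      ‖l - lam‖ ≤ 4 * (‖lam * φc W - φc (A W)‖ + η * M * (‖A W‖ + ‖lam‖ * ‖(W : E)‖)) ∧
      ∀ z ∈ S, z.re < -(1 / 8) := by
  have hex : ∀ z : ℂ, ∃ R : E →L[ℂ] E, -(1 / 8) ≤ z.re → ‖R‖ ≤ M ∧
      IsInv (shifted A vc vs φc φs - z • A.domain.subtype) R := by
    intro z
    by_cases hz : -(1 / 8) ≤ z.re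
    · obtain ⟨R, h1, h2⟩ := h.inv z hz
      exact ⟨R, fun _ => ⟨h1, h2⟩⟩
    · exact ⟨0, fun h => absurd h hz⟩
  choose R hR using hex
  have hball : ∀ z : ℂ, ‖z‖ ≤ 1 / 8 → -(1 / 8) ≤ z.re := fun z hz =>
    (neg_le_neg hz).trans (abs_le.mp (Complex.abs_re_le_norm z)).1
  -- The even eigenvalue is the fixed point of z ↦ -φc(R_z A vc). The radius 1/8 keeps the disc
  -- inside the half plane where R_z is controlled.
  obtain ⟨l, hl, hfix⟩ := exists_fixedPoint_of_norm_le (fun z => -φc (R z (A vc)))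
    (by norm_num : (0 : ℝ) ≤ 1 / 8)
    (fun z hz => by
      rw [norm_neg]
      exact h.norm_φ_R_le h.norm_φc (hR z (hball z hz)).1 h.norm_A_vc)
    (fun z w hz hw => by
      rw [neg_sub_neg, norm_sub_rev]
      exact h.norm_sub_le_of_char h.norm_φc h.norm_A_vc (hR z (hball z hz)).1
        (hR w (hball w hw)).1 (hR z (hball z hz)).2 (hR w (hball w hw)).2)
  have hl0 : l + φc (R l (A vc)) = 0 := by
    have : -φc (R l (A vc)) = l := hfix
    linear_combination (-1) * this
  have h00 : -(1 / 8) ≤ (0 : ℂ).re := by norm_num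
  have hs0 := happrox (R 0) (hR 0 h00).2
  have hlre := hball l hl
  -- Removing the values l and 0 is harmless even if l = 0; only set equality is claimed. The factor
  -- 4 in the distance bound combines |φc W| ≥ 1/2 with the 1/2-Lipschitz correction.
  refine ⟨opSpectrum A \ {l, 0}, l, ?_, ?_, ?_⟩
  · rw [Set.sdiff_union_self, Set.union_eq_self_of_subset_right]
    intro z hz
    rcases hz with hz | hz
    · rw [hz, h.mem_opSpectrum_iff' hlre (hR l hlre).2]
      exact Or.inl hl0
    · rw [Set.mem_singleton_iff.mp hz, h.mem_opSpectrum_iff' h00 (hR 0 h00).2]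
      exact Or.inr hs0
  · have h1 := h.norm_char_le (hR lam hlam).1 (hR lam hlam).2 W hWs
    have h2 := h.norm_sub_le_of_char h.norm_φc h.norm_A_vc (hR lam hlam).1 (hR l hlre).1
      (hR lam hlam).2 (hR l hlre).2
    have h3 : ‖lam - l‖ ≤ ‖lam + φc (R lam (A vc))‖
        + ‖φc (R lam (A vc)) - φc (R l (A vc))‖ := by
      have : lam - l = (lam + φc (R lam (A vc))) - (φc (R lam (A vc)) - φc (R l (A vc))) := by
        linear_combination (-1) * hl0
      rw [this]
      exact norm_sub_le _ _
    have h4 : 1 / 2 * ‖lam + φc (R lam (A vc))‖ ≤ ‖φc W‖ * ‖lam + φc (R lam (A vc))‖ :=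
      mul_le_mul_of_nonneg_right hWc (norm_nonneg _)
    rw [norm_sub_rev]
    linarith
  · intro z hz
    by_contra! hre
    obtain ⟨hz1, hz2⟩ := hz
    rw [h.mem_opSpectrum_iff' hre (hR z hre).2] at hz1
    apply hz2
    have huniq : ∀ {φ : E →L[ℂ] ℂ} {y : E} {w : ℂ}, ‖φ‖ ≤ a → ‖y‖ ≤ η → -(1 / 8) ≤ w.re →
        z + φ (R z y) = 0 → w + φ (R w y) = 0 → z = w := by
      intro φ y w hφ hy hw h1 h2
      have h3 := h.norm_sub_le_of_char hφ hy (hR z hre).1 (hR w hw).1 (hR z hre).2 (hR w hw).2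
      have h4 : φ (R z y) - φ (R w y) = -(z - w) := by linear_combination h1 - h2
      rw [h4, norm_neg] at h3
      have h5 : ‖z - w‖ = 0 := le_antisymm (by linarith) (norm_nonneg _)
      exact sub_eq_zero.mp (norm_eq_zero.mp h5)
    rcases hz1 with h1 | h1
    · exact Or.inl (huniq h.norm_φc h.norm_A_vc hlre h1 hl0)
    · exact Or.inr (huniq h.norm_φs h.norm_A_vs h00 h1 hs0)

end AlmostKernel

end Abstract

/-! ### Multipliers, multiplication and reflection on L² -/

theorem ext_repr {f g : L2per} (h : ∀ n, fourierBasis.repr f n = fourierBasis.repr g n) :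
    f = g := by
  apply fourierBasis.repr.injective
  ext n
  exact h n

theorem memℓp_mul_bounded {s : ℤ → ℂ} {C : ℝ} (hs : ∀ n, ‖s n‖ ≤ C) (f : L2per) :
    Memℓp (fun n => s n * fourierBasis.repr f n) 2 := by
  have h2 : (0 : ℝ) < (2 : ℝ≥0∞).toReal := by norm_num
  have hf := lp.memℓp (fourierBasis.repr f)
  rw [memℓp_gen_iff h2] at hf ⊢
  refine Summable.of_nonneg_of_le (fun n => by positivity) (fun n => ?_) (hf.mul_left (C ^ (2 : ℝ≥0∞).toReal))
  have hC : 0 ≤ C := (norm_nonneg _).trans (hs n)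
  rw [← Real.mul_rpow hC (norm_nonneg _), norm_mul]
  exact Real.rpow_le_rpow (by positivity) (mul_le_mul_of_nonneg_right (hs n) (norm_nonneg _)) h2.le

theorem norm_le_of_repr_le {f g : L2per} {C : ℝ} (hC : 0 ≤ C)
    (h : ∀ n, ‖fourierBasis.repr g n‖ ≤ C * ‖fourierBasis.repr f n‖) : ‖g‖ ≤ C * ‖f‖ := by
  have h1 := hasSum_sq_repr g
  have h2 := (hasSum_sq_repr f).mul_left (C ^ 2)
  have h3 : ‖g‖ ^ 2 ≤ C ^ 2 * ‖f‖ ^ 2 := by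
    refine hasSum_le (fun n => ?_) h1 h2
    rw [← mul_pow]
    exact pow_le_pow_left₀ (norm_nonneg _) (h n) 2
  rw [← mul_pow] at h3
  exact le_of_sq_le_sq h3 (by positivity)

/-- The Fourier multiplier on `L²` with bounded symbol `s`. -/
def fourierMul (s : ℤ → ℂ) (C : ℝ) (hs : ∀ n, ‖s n‖ ≤ C) : L2per →L[ℂ] L2per :=
  LinearMap.mkContinuous
    { toFun := fun f => fourierBasis.repr.symm ⟨_, memℓp_mul_bounded hs f⟩
      map_add' := fun f g => by
        refine ext_repr fun n => ?_
        simp [mul_add]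
        rfl
      map_smul' := fun c f => by
        refine ext_repr fun n => ?_
        simp
        ring } C
    (fun f => norm_le_of_repr_le ((norm_nonneg _).trans (hs 0)) fun n => by
      simp only [LinearMap.coe_mk, AddHom.coe_mk, LinearIsometryEquiv.apply_symm_apply, norm_mul]
      exact mul_le_mul_of_nonneg_right (hs n) (norm_nonneg _))

theorem repr_fourierMul (s : ℤ → ℂ) (C : ℝ) (hs : ∀ n, ‖s n‖ ≤ C) (f : L2per) (n : ℤ) :
    fourierBasis.repr (fourierMul s C hs f) n = s n * fourierBasis.repr f n := by
  simp [fourierMul]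

theorem norm_fourierMul_le (s : ℤ → ℂ) (C : ℝ) (hs : ∀ n, ‖s n‖ ≤ C) (f : L2per) :
    ‖fourierMul s C hs f‖ ≤ C * ‖f‖ := by
  refine norm_le_of_repr_le ((norm_nonneg _).trans (hs 0)) fun n => ?_
  rw [repr_fourierMul, norm_mul]
  exact mul_le_mul_of_nonneg_right (hs n) (norm_nonneg _)

/-- The Fourier multiplier on `L²` pairs with a matrix-valued symbol. -/
def matrixMul (S : ℤ → Matrix (Fin 2) (Fin 2) ℂ) (C : ℝ) (hS : ∀ i j n, ‖S n i j‖ ≤ C) :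
    L2perVec →L[ℂ] L2perVec :=
  ContinuousLinearMap.pi fun i => ∑ j, (fourierMul (fun n => S n i j) C (hS i j)).comp
    (ContinuousLinearMap.proj j)

theorem matrixMul_apply (S : ℤ → Matrix (Fin 2) (Fin 2) ℂ) (C : ℝ)
    (hS : ∀ i j n, ‖S n i j‖ ≤ C) (V : L2perVec) (i : Fin 2) :
    matrixMul S C hS V i = ∑ j, fourierMul (fun n => S n i j) C (hS i j) (V j) := by
  simp [matrixMul]

theorem repr_matrixMul (S : ℤ → Matrix (Fin 2) (Fin 2) ℂ) (C : ℝ)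
    (hS : ∀ i j n, ‖S n i j‖ ≤ C) (V : L2perVec) (i : Fin 2) (n : ℤ) :
    fourierBasis.repr (matrixMul S C hS V i) n
      = S n i 0 * fourierBasis.repr (V 0) n + S n i 1 * fourierBasis.repr (V 1) n := by
  rw [matrixMul_apply, Fin.sum_univ_two, map_add, lp.coeFn_add, Pi.add_apply, repr_fourierMul,
    repr_fourierMul]

theorem norm_matrixMul_le (S : ℤ → Matrix (Fin 2) (Fin 2) ℂ) (C : ℝ)
    (hS : ∀ i j n, ‖S n i j‖ ≤ C) : ‖matrixMul S C hS‖ ≤ 2 * C := by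
  have hC : 0 ≤ C := (norm_nonneg _).trans (hS 0 0 0)
  refine ContinuousLinearMap.opNorm_le_bound _ (by positivity) fun V => ?_
  rw [pi_norm_le_iff_of_nonneg (by positivity)]
  intro i
  rw [matrixMul_apply, Fin.sum_univ_two]
  refine (norm_add_le _ _).trans ?_
  have h0 := (norm_fourierMul_le (fun n => S n i 0) C (hS i 0) (V 0)).trans
    (mul_le_mul_of_nonneg_left (norm_le_pi_norm V 0) hC)
  have h1 := (norm_fourierMul_le (fun n => S n i 1) C (hS i 1) (V 1)).trans
    (mul_le_mul_of_nonneg_left (norm_le_pi_norm V 1) hC)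
  linarith

theorem norm_one_add_sq (n : ℤ) : ‖1 + (n : ℂ) ^ 2‖ = 1 + (n : ℝ) ^ 2 := by
  have : 1 + (n : ℂ) ^ 2 = ((1 + (n : ℝ) ^ 2 : ℝ) : ℂ) := by push_cast; ring
  rw [this, Complex.norm_real, Real.norm_of_nonneg (by positivity)]

theorem fourierMul_mem_H2per (s : ℤ → ℂ) (C : ℝ) (hs : ∀ n, ‖s n‖ ≤ C) {C' : ℝ}
    (hs' : ∀ n, ‖s n‖ ≤ C' / (1 + (n : ℝ) ^ 2)) (f : L2per) : fourierMul s C hs f ∈ H2per := by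
  have hb : ∀ n : ℤ, ‖(1 + (n : ℂ) ^ 2) * s n‖ ≤ C' := by
    intro n
    have hN : (0 : ℝ) < 1 + (n : ℝ) ^ 2 := by positivity
    have := hs' n
    rw [le_div_iff₀ hN] at this
    rw [norm_mul, norm_one_add_sq]
    linarith
  change Memℓp (fun n : ℤ => (1 + (n : ℂ) ^ 2) * fourierBasis.repr (fourierMul s C hs f) n) 2
  convert memℓp_mul_bounded hb f using 2 with n
  rw [repr_fourierMul, mul_assoc]

theorem matrixMul_mem (S : ℤ → Matrix (Fin 2) (Fin 2) ℂ) (C : ℝ)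
    (hS : ∀ i j n, ‖S n i j‖ ≤ C) {C' : ℝ}
    (hS' : ∀ i j n, ‖S n i j‖ ≤ C' / (1 + (n : ℝ) ^ 2)) (V : L2perVec) :
    matrixMul S C hS V ∈ Submodule.pi Set.univ (fun _ : Fin 2 => H2per) := by
  intro i _
  rw [matrixMul_apply]
  exact Submodule.sum_mem _ fun j _ => fourierMul_mem_H2per _ _ _ (hS' i j) _

theorem coeFn_toLp_infty (c : C(Circ, ℝ)) :
    (ContinuousMap.toLp ∞ AddCircle.haarAddCircle ℂ (toComplex c) : Lp ℂ ∞ _)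
      =ᵐ[AddCircle.haarAddCircle] fun x => (c x : ℂ) :=
  ContinuousMap.coeFn_toLp (p := ∞) (𝕜 := ℂ) AddCircle.haarAddCircle (toComplex c)

theorem coeFn_toL2 (c : C(Circ, ℝ)) :
    toL2 c =ᵐ[AddCircle.haarAddCircle] fun x => (c x : ℂ) :=
  ContinuousMap.coeFn_toLp (p := 2) (𝕜 := ℂ) AddCircle.haarAddCircle (toComplex c)

theorem coeFn_mulL2 (c : C(Circ, ℝ)) (f : L2per) :
    mulL2 c f =ᵐ[AddCircle.haarAddCircle] fun x => (c x : ℂ) * f x := by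
  have h1 := (ContinuousLinearMap.mul ℂ ℂ).coeFn_holder (r := 2)
    (ContinuousMap.toLp ∞ AddCircle.haarAddCircle ℂ (toComplex c)) f
  have h2 := coeFn_toLp_infty c
  have h3 : mulL2 c f = (ContinuousLinearMap.mul ℂ ℂ).holder 2
    (ContinuousMap.toLp ∞ AddCircle.haarAddCircle ℂ (toComplex c)) f := rfl
  rw [h3]
  filter_upwards [h1, h2] with x hx1 hx2
  rw [hx1, hx2]
  rfl

theorem norm_mulL2_le (c : C(Circ, ℝ)) (f : L2per) : ‖mulL2 c f‖ ≤ ‖c‖ * ‖f‖ := by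
  have hn := norm_nonneg c
  refine Lp.norm_le_mul_norm_of_ae_le_mul ?_
  filter_upwards [coeFn_mulL2 c f] with x hx
  rw [hx, norm_mul, Complex.norm_real]
  exact mul_le_mul_of_nonneg_right (c.norm_coe_le_norm x) (norm_nonneg _)

theorem mulL2_add (c d : C(Circ, ℝ)) (f : L2per) : mulL2 (c + d) f = mulL2 c f + mulL2 d f := by
  refine Lp.ext ?_
  filter_upwards [coeFn_mulL2 (c + d) f, coeFn_mulL2 c f, coeFn_mulL2 d f,
    Lp.coeFn_add (mulL2 c f) (mulL2 d f)] with x h1 h2 h3 h4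
  rw [h1, h4, Pi.add_apply, h2, h3, ContinuousMap.add_apply]
  push_cast
  ring

theorem mulL2_neg (c : C(Circ, ℝ)) (f : L2per) : mulL2 (-c) f = -mulL2 c f := by
  refine Lp.ext ?_
  filter_upwards [coeFn_mulL2 (-c) f, coeFn_mulL2 c f, Lp.coeFn_neg (mulL2 c f)] with x h1 h2 h4
  rw [h1, h4, Pi.neg_apply, h2, ContinuousMap.neg_apply]
  push_cast
  ring

theorem mulL2_const (r : ℝ) (f : L2per) : mulL2 (ContinuousMap.const _ r) f = (r : ℂ) • f := by
  refine Lp.ext ?_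
  filter_upwards [coeFn_mulL2 (ContinuousMap.const _ r) f, Lp.coeFn_smul (r : ℂ) f] with x h1 h2
  rw [h1, h2]
  rfl

theorem mulL2_toL2 (c d : C(Circ, ℝ)) : mulL2 c (toL2 d) = toL2 (c * d) := by
  refine Lp.ext ?_
  filter_upwards [coeFn_mulL2 c (toL2 d), coeFn_toL2 d, coeFn_toL2 (c * d)] with x h1 h2 h3
  rw [h1, h2, h3, ContinuousMap.mul_apply]
  push_cast
  rfl

/-- The reflection `f ↦ f(-·)` on `L²`. -/
def reflectL2 : L2per →L[ℂ] L2per :=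
  (Lp.compMeasurePreservingₗᵢ ℂ (fun x : Circ => -x)
    (Measure.measurePreserving_neg AddCircle.haarAddCircle)).toContinuousLinearMap

theorem coeFn_reflectL2 (f : L2per) :
    reflectL2 f =ᵐ[AddCircle.haarAddCircle] fun x => f (-x) :=
  Lp.coeFn_compMeasurePreserving f (Measure.measurePreserving_neg AddCircle.haarAddCircle)

theorem repr_reflectL2 (f : L2per) (n : ℤ) :
    fourierBasis.repr (reflectL2 f) n = fourierBasis.repr f (-n) := by
  rw [fourierBasis_repr, fourierBasis_repr, fourierCoeff, fourierCoeff,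
    ← integral_neg_eq_self (fun x : Circ => fourier (-(-n)) x • f x)]
  refine integral_congr_ae ?_
  filter_upwards [coeFn_reflectL2 f] with x hx
  rw [hx]
  simp [fourier_apply]

theorem reflectL2_mulL2 {c : C(Circ, ℝ)} (hc : ∀ x, c (-x) = c x) (f : L2per) :
    mulL2 c (reflectL2 f) = reflectL2 (mulL2 c f) := by
  refine Lp.ext ?_
  have h4 := (Measure.measurePreserving_neg (AddCircle.haarAddCircle : Measure Circ)).quasiMeasurePreserving.ae
    (coeFn_mulL2 c f)
  filter_upwards [coeFn_mulL2 c (reflectL2 f), coeFn_reflectL2 f, coeFn_reflectL2 (mulL2 c f),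
    h4] with x h1 h2 h3 h4
  rw [h1, h2, h3, h4, hc]

theorem reflectL2_mem {f : L2per} (hf : f ∈ H2per) : reflectL2 f ∈ H2per := by
  have hf' : Memℓp (fun n : ℤ => (1 + (n : ℂ) ^ 2) * fourierBasis.repr f n) 2 := hf
  change Memℓp (fun n : ℤ => (1 + (n : ℂ) ^ 2) * fourierBasis.repr (reflectL2 f) n) 2
  have h2 : (0 : ℝ) < (2 : ℝ≥0∞).toReal := by norm_num
  rw [memℓp_gen_iff h2] at hf' ⊢
  convert (Equiv.neg ℤ).summable_iff.mpr hf' using 2 with n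
  simp [repr_reflectL2]

/-- The componentwise reflection. -/
def reflectVec : L2perVec →L[ℂ] L2perVec :=
  ContinuousLinearMap.pi fun i => reflectL2.comp (ContinuousLinearMap.proj i)

theorem reflectVec_apply (V : L2perVec) (i : Fin 2) : reflectVec V i = reflectL2 (V i) := rfl

/-! ### Critical vectors and their dual functionals -/

/-- The `n`-th Fourier coefficient as a bounded functional. -/
def reprL (n : ℤ) : L2per →L[ℂ] ℂ :=
  LinearMap.mkContinuous
    { toFun := fun f => fourierBasis.repr f n
      map_add' := fun f g => by simp
      map_smul' := fun c f => by simp } 1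
    (fun f => by rw [one_mul]; exact norm_repr_le f n)

theorem reprL_apply (n : ℤ) (f : L2per) : reprL n f = fourierBasis.repr f n := rfl

/-- The functional `V ↦ ℓ · (V(1) + s V(-1)) / 3` with `ℓ = (2, 1)`. -/
def critFun (s : ℂ) : L2perVec →L[ℂ] ℂ :=
  (1 / 3 : ℂ) • ((2 : ℂ) • (reprL 1 + s • reprL (-1)).comp (ContinuousLinearMap.proj 0)
    + (reprL 1 + s • reprL (-1)).comp (ContinuousLinearMap.proj 1))

theorem critFun_apply (s : ℂ) (V : L2perVec) : critFun s V
    = 1 / 3 * (2 * (fourierBasis.repr (V 0) 1 + s * fourierBasis.repr (V 0) (-1))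
      + (fourierBasis.repr (V 1) 1 + s * fourierBasis.repr (V 1) (-1))) := by
  simp [critFun, reprL_apply]
  ring

theorem norm_repr_add_le {s : ℂ} (hs : ‖s‖ = 1) (V : L2perVec) (j : Fin 2) :
    ‖fourierBasis.repr (V j) 1 + s * fourierBasis.repr (V j) (-1)‖ ≤ 2 * ‖V‖ := by
  refine (norm_add_le _ _).trans ?_
  rw [norm_mul, hs, one_mul]
  have h1 := (norm_repr_le (V j) 1).trans (norm_le_pi_norm V j)
  have h2 := (norm_repr_le (V j) (-1)).trans (norm_le_pi_norm V j)
  linarith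

theorem norm_critFun_le {s : ℂ} (hs : ‖s‖ = 1) : ‖critFun s‖ ≤ 2 := by
  refine ContinuousLinearMap.opNorm_le_bound _ (by norm_num) fun V => ?_
  rw [critFun_apply, norm_mul]
  have h0 := norm_repr_add_le hs V 0
  have h1 := norm_repr_add_le hs V 1
  have h2 := norm_add_le (2 * (fourierBasis.repr (V 0) 1 + s * fourierBasis.repr (V 0) (-1)))
    (fourierBasis.repr (V 1) 1 + s * fourierBasis.repr (V 1) (-1))
  rw [norm_mul, Complex.norm_two] at h2
  have h3 : ‖(1 / 3 : ℂ)‖ = 1 / 3 := by norm_num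
  rw [h3]
  linarith

/-- The vector `(x, y) (e^{iξ} + s e^{-iξ}) / 2`. -/
def modeVec (s x y : ℂ) : L2perVec :=
  ![(x / 2) • (fourierLp 2 1 + s • fourierLp 2 (-1)),
    (y / 2) • (fourierLp 2 1 + s • fourierLp 2 (-1))]

theorem repr_modeVec_zero (s x y : ℂ) (n : ℤ) : fourierBasis.repr (modeVec s x y 0) n
    = x / 2 * ((if n = 1 then 1 else 0) + s * (if n = -1 then 1 else 0)) := by
  simp only [modeVec, Matrix.cons_val_zero, map_smul, map_add, lp.coeFn_smul, lp.coeFn_add,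
    Pi.smul_apply, Pi.add_apply, smul_eq_mul, repr_fourierLp]

theorem repr_modeVec_one (s x y : ℂ) (n : ℤ) : fourierBasis.repr (modeVec s x y 1) n
    = y / 2 * ((if n = 1 then 1 else 0) + s * (if n = -1 then 1 else 0)) := by
  simp only [modeVec, Matrix.cons_val_one, Matrix.cons_val_fin_one, map_smul, map_add,
    lp.coeFn_smul, lp.coeFn_add,
    Pi.smul_apply, Pi.add_apply, smul_eq_mul, repr_fourierLp]

theorem norm_modeVec_le {s x y : ℂ} (hs : ‖s‖ = 1) {C : ℝ} (hx : ‖x‖ ≤ C) (hy : ‖y‖ ≤ C) :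
    ‖modeVec s x y‖ ≤ C := by
  have hC : 0 ≤ C := (norm_nonneg _).trans hx
  have hf : ∀ n : ℤ, ‖(fourierLp 2 n : L2per)‖ = 1 := fun n => orthonormal_fourier.1 n
  have h1 : ‖(fourierLp 2 1 + s • fourierLp 2 (-1) : L2per)‖ ≤ 2 := by
    refine (norm_add_le _ _).trans ?_
    rw [norm_smul, hs, hf, hf]; norm_num
  have h2 : ∀ w : ℂ, ‖w‖ ≤ C → ‖(w / 2) • (fourierLp 2 1 + s • fourierLp 2 (-1) : L2per)‖ ≤ C := by
    intro w hw
    rw [norm_smul, norm_div, Complex.norm_two]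
    nlinarith [norm_nonneg w]
  rw [pi_norm_le_iff_of_nonneg hC, Fin.forall_fin_two]
  exact ⟨h2 x hx, h2 y hy⟩

theorem fourierLp_mem (n : ℤ) : (fourierLp 2 n : L2per) ∈ H2per := by
  change Memℓp (fun m : ℤ => (1 + (m : ℂ) ^ 2) * fourierBasis.repr (fourierLp 2 n : L2per) m) 2
  have h2 : (0 : ℝ) < (2 : ℝ≥0∞).toReal := by norm_num
  rw [memℓp_gen_iff h2]
  refine summable_of_ne_finset_zero (s := {n}) fun m hm => ?_
  have : m ≠ n := by simpa using hm
  rw [repr_fourierLp, if_neg this]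
  simp

theorem modeVec_mem (s x y : ℂ) :
    modeVec s x y ∈ Submodule.pi Set.univ (fun _ : Fin 2 => H2per) := by
  have h : (fourierLp 2 1 + s • fourierLp 2 (-1) : L2per) ∈ H2per :=
    H2per.add_mem (fourierLp_mem 1) (H2per.smul_mem _ (fourierLp_mem (-1)))
  intro i _
  fin_cases i
  · exact H2per.smul_mem _ h
  · exact H2per.smul_mem _ h

theorem ext_vec {V W : L2perVec} (h0 : ∀ n, fourierBasis.repr (V 0) n = fourierBasis.repr (W 0) n)
    (h1 : ∀ n, fourierBasis.repr (V 1) n = fourierBasis.repr (W 1) n) : V = W := by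
  funext j
  fin_cases j
  · exact ext_repr h0
  · exact ext_repr h1

/-! ### Uniform resolvent bounds for the shifted constant-coefficient operator -/

/-- For a 2 × 2 symbol with p minus the trace and q the determinant, this bounds the characteristic
polynomial below on the whole half plane. The growth in |z| is needed because z also occurs in the
entries of the adjugate. -/
theorem quadratic_lower_bound {z : ℂ} {p q N : ℝ} (hN : 1 ≤ N) (hp : N / 2 ≤ p) (hp' : p ≤ 6 * N)
    (hq : N ^ 2 ≤ q) (hz : -(1 / 8) ≤ z.re) :
    N * (‖z‖ + N) ≤ 20 * ‖z ^ 2 + p * z + q‖ := by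
  set x := z.re with hx
  set y := z.im with hy
  have hnz : ‖z‖ ≤ |x| + |y| := Complex.norm_le_abs_re_add_abs_im z
  have hre : (z ^ 2 + p * z + q).re = x ^ 2 - y ^ 2 + p * x + q := by
    simp [pow_two, Complex.mul_re, ← hx, ← hy]
  have him : (z ^ 2 + p * z + q).im = y * (2 * x + p) := by
    simp [pow_two, Complex.mul_im, ← hx, ← hy]; ring
  have h1 : x ^ 2 - y ^ 2 + p * x + q ≤ ‖z ^ 2 + p * z + q‖ := by
    rw [← hre]; exact Complex.re_le_norm _
  have h2 : |y| * |2 * x + p| ≤ ‖z ^ 2 + p * z + q‖ := by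
    rw [← abs_mul, ← him]; exact Complex.abs_im_le_norm _
  have h3 : N * (‖z‖ + N) ≤ N * (|x| + |y| + N) := by gcongr
  have hy0 := abs_nonneg y
  have hysq := sq_abs y
  have hN2 : N ≤ N ^ 2 := by nlinarith
  -- Near the real axis the real part dominates, because q ≥ N² exceeds the losses y² and |px|;
  -- otherwise the imaginary part y(2x + p) is large.
  rcases le_or_gt (|y|) (N / 3) with hcase | hcase
  · have h4 : y ^ 2 ≤ N ^ 2 / 9 := by rw [← hysq]; nlinarith
    rcases le_or_gt 0 x with hx0 | hx0
    · rw [abs_of_nonneg hx0] at h3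
      have h5 : 0 ≤ p * x := mul_nonneg (by linarith) hx0
      nlinarith [sq_nonneg (x - N), mul_le_mul_of_nonneg_left hcase (by linarith : 0 ≤ N)]
    · rw [abs_of_neg hx0] at h3
      have h5 : -(3 / 4 * N) ≤ p * x := by nlinarith
      nlinarith [mul_le_mul_of_nonneg_left hcase (by linarith : 0 ≤ N)]
  · rcases le_or_gt 0 x with hx0 | hx0
    · rw [abs_of_nonneg hx0] at h3
      rw [abs_of_nonneg (by linarith : 0 ≤ 2 * x + p)] at h2
      have h5 : |y| * (2 * x + N / 2) ≤ |y| * (2 * x + p) := by gcongr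
      nlinarith [mul_nonneg hx0 (by linarith : 0 ≤ 3 * |y| - N)]
    · rw [abs_of_neg hx0] at h3
      rw [abs_of_nonneg (by linarith : 0 ≤ 2 * x + p)] at h2
      have h5 : |y| * (N / 4) ≤ |y| * (2 * x + p) := by
        apply mul_le_mul_of_nonneg_left _ hy0
        linarith
      nlinarith

/-- The indicator of the critical modes `±1`. -/
def critInd (n : ℤ) : ℝ := if n = 1 ∨ n = -1 then 1 else 0

/-- The symbol of the linearization at the trivial state, shifted on the critical modes. -/
def shiftSym (b t : ℝ) (n : ℤ) : Matrix (Fin 2) (Fin 2) ℝ :=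
  !![b + 3 - 4 * (t * (n : ℝ) ^ 2) - 4 / 3 * critInd n, 4 - 2 / 3 * critInd n;
    -(b + 4) + 2 / 3 * critInd n, -4 - 16 * (t * (n : ℝ) ^ 2) + 1 / 3 * critInd n]

theorem int_cases (n : ℤ) : n = 0 ∨ (n = 1 ∨ n = -1) ∨ (4 : ℝ) ≤ (n : ℝ) ^ 2 := by
  by_cases h0 : n = 0
  · exact Or.inl h0
  · by_cases h1 : n = 1 ∨ n = -1
    · exact Or.inr (Or.inl h1)
    · push Not at h1
      exact Or.inr (Or.inr (four_le_sq h0 h1.1 h1.2))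

theorem critInd_of_four_le {n : ℤ} (h : (4 : ℝ) ≤ (n : ℝ) ^ 2) : critInd n = 0 := by
  refine if_neg ?_
  rintro (h1 | h1) <;> rw [h1] at h <;> norm_num at h

theorem abs_shiftSym_le {b t : ℝ} (h : NearOnset b t) (n : ℤ) (i j : Fin 2) :
    |shiftSym b t n i j| ≤ 5 * (1 + (n : ℝ) ^ 2) := by
  obtain ⟨hb0, hb, ht, ht'⟩ := h
  have hn := sq_nonneg (n : ℝ)
  have h1 : t * (n : ℝ) ^ 2 ≤ 26 / 100 * (n : ℝ) ^ 2 := by gcongr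
  have h2 : 0 ≤ t * (n : ℝ) ^ 2 := by positivity
  have hc : 0 ≤ critInd n ∧ critInd n ≤ 1 := by
    unfold critInd; split_ifs <;> norm_num
  rw [abs_le]
  fin_cases i <;> fin_cases j <;> simp [shiftSym] <;> constructor <;> linarith

/-- In the modes ±1 the shift moves the critical eigenvalue from 0 to -1 at onset and keeps the
stable one at -6. In the other modes no shift is needed. -/
theorem shiftSym_trace_det {b t : ℝ} (h : NearOnset b t) (n : ℤ) :
    (1 + (n : ℝ) ^ 2) / 2 ≤ -(shiftSym b t n 0 0 + shiftSym b t n 1 1) ∧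
    -(shiftSym b t n 0 0 + shiftSym b t n 1 1) ≤ 6 * (1 + (n : ℝ) ^ 2) ∧
    (1 + (n : ℝ) ^ 2) ^ 2 ≤ shiftSym b t n 0 0 * shiftSym b t n 1 1
      - shiftSym b t n 0 1 * shiftSym b t n 1 0 := by
  obtain ⟨hb0, hb, ht, ht'⟩ := h
  have e00 : shiftSym b t n 0 0 = b + 3 - 4 * (t * (n : ℝ) ^ 2) - 4 / 3 * critInd n := rfl
  have e01 : shiftSym b t n 0 1 = 4 - 2 / 3 * critInd n := rfl
  have e10 : shiftSym b t n 1 0 = -(b + 4) + 2 / 3 * critInd n := rfl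
  have e11 : shiftSym b t n 1 1 = -4 - 16 * (t * (n : ℝ) ^ 2) + 1 / 3 * critInd n := rfl
  rw [e00, e01, e10, e11]
  rcases int_cases n with hn | hn | hn
  · subst hn
    simp only [critInd]
    norm_num
    refine ⟨?_, ?_, ?_⟩ <;> linarith
  · have h1 : (n : ℝ) ^ 2 = 1 := by rcases hn with h | h <;> rw [h] <;> norm_num
    have h2 : critInd n = 1 := if_pos hn
    rw [h1, h2]
    refine ⟨by linarith, by linarith, ?_⟩
    nlinarith [mul_nonneg (by linarith : 0 ≤ 1 / 100 - b) (by linarith : 0 ≤ t)]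
  · rw [critInd_of_four_le hn]
    set y := (n : ℝ) ^ 2
    have h1 : t * y ≤ 26 / 100 * y := by gcongr
    have h2 : 24 / 100 * y ≤ t * y := by gcongr
    set κ := t * y
    refine ⟨by linarith, by linarith, ?_⟩
    have h3 : (92 / 100 * y - 2) ≤ 4 * κ - 2 := by linarith
    have h4 : b * κ ≤ 1 / 100 * κ := by
      apply mul_le_mul_of_nonneg_right hb; linarith
    nlinarith [mul_nonneg (by linarith : 0 ≤ κ - 24 / 100 * y) (by linarith : 0 ≤ y - 4),
      mul_nonneg (by linarith : 0 ≤ κ - 24 / 100 * y) (by linarith : 0 ≤ κ - 24 / 100 * y),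
      mul_nonneg (by linarith : 0 ≤ y - 4) (by linarith : 0 ≤ y - 4)]

/-- The determinant of the shifted symbol minus `z`. -/
def symDet (b t : ℝ) (z : ℂ) (n : ℤ) : ℂ :=
  (shiftSym b t n 0 0 - z) * (shiftSym b t n 1 1 - z) - shiftSym b t n 0 1 * shiftSym b t n 1 0

theorem symDet_lower_bound {b t : ℝ} (h : NearOnset b t) {z : ℂ} (hz : -(1 / 8) ≤ z.re) (n : ℤ) :
    (1 + (n : ℝ) ^ 2) * (‖z‖ + (1 + (n : ℝ) ^ 2)) ≤ 20 * ‖symDet b t z n‖ := by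
  obtain ⟨h1, h2, h3⟩ := shiftSym_trace_det h n
  have h4 := quadratic_lower_bound (by nlinarith [sq_nonneg (n : ℝ)] : (1 : ℝ) ≤ 1 + (n : ℝ) ^ 2)
    h1 h2 h3 hz
  convert h4 using 3
  rw [symDet]
  push_cast
  ring

theorem symDet_ne_zero {b t : ℝ} (h : NearOnset b t) {z : ℂ} (hz : -(1 / 8) ≤ z.re) (n : ℤ) :
    symDet b t z n ≠ 0 := by
  intro h0
  have h1 := symDet_lower_bound h hz n
  rw [h0, norm_zero, mul_zero] at h1
  have : 0 < (1 + (n : ℝ) ^ 2) * (‖z‖ + (1 + (n : ℝ) ^ 2)) := by positivity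
  linarith

/-- The inverse of the shifted symbol minus `z`. -/
def invSym (b t : ℝ) (z : ℂ) (n : ℤ) : Matrix (Fin 2) (Fin 2) ℂ :=
  !![(shiftSym b t n 1 1 - z) / symDet b t z n, -(shiftSym b t n 0 1) / symDet b t z n;
    -(shiftSym b t n 1 0) / symDet b t z n, (shiftSym b t n 0 0 - z) / symDet b t z n]

/-- The bound does not depend on z, and its decay in n is what places the image of the multiplier in
H². -/
theorem norm_invSym_le {b t : ℝ} (h : NearOnset b t) {z : ℂ} (hz : -(1 / 8) ≤ z.re)
    (i j : Fin 2) (n : ℤ) : ‖invSym b t z n i j‖ ≤ 100 / (1 + (n : ℝ) ^ 2) := by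
  have hN : (0 : ℝ) < 1 + (n : ℝ) ^ 2 := by positivity
  have hd := symDet_lower_bound h hz n
  have hd0 : 0 < ‖symDet b t z n‖ := norm_pos_iff.mpr (symDet_ne_zero h hz n)
  have key : ∀ w : ℂ, ‖w‖ ≤ 5 * (1 + (n : ℝ) ^ 2) + ‖z‖ →
      ‖w / symDet b t z n‖ ≤ 100 / (1 + (n : ℝ) ^ 2) := by
    intro w hw
    rw [norm_div, div_le_div_iff₀ hd0 hN]
    have h0 := norm_nonneg z
    calc ‖w‖ * (1 + (n : ℝ) ^ 2) ≤ (5 * (1 + (n : ℝ) ^ 2) + ‖z‖) * (1 + (n : ℝ) ^ 2) := by gcongr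
      _ ≤ 5 * ((1 + (n : ℝ) ^ 2) * (‖z‖ + (1 + (n : ℝ) ^ 2))) := by nlinarith
      _ ≤ _ := by linarith
  have hreal : ∀ i j, ‖((shiftSym b t n i j : ℝ) : ℂ)‖ ≤ 5 * (1 + (n : ℝ) ^ 2) := by
    intro i j
    rw [Complex.norm_real]
    exact abs_shiftSym_le h n i j
  have hz0 := norm_nonneg z
  fin_cases i <;> fin_cases j
  · exact key _ ((norm_sub_le _ _).trans (by linarith [hreal 1 1]))
  · exact key _ (by rw [norm_neg]; linarith [hreal 0 1])
  · exact key _ (by rw [norm_neg]; linarith [hreal 1 0])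
  · exact key _ ((norm_sub_le _ _).trans (by linarith [hreal 0 0]))

theorem norm_invSym_le' {b t : ℝ} (h : NearOnset b t) {z : ℂ} (hz : -(1 / 8) ≤ z.re)
    (i j : Fin 2) (n : ℤ) : ‖invSym b t z n i j‖ ≤ 100 := by
  refine (norm_invSym_le h hz i j n).trans ?_
  exact div_le_self (by norm_num) (by nlinarith [sq_nonneg (n : ℝ)])

/-! ### The Bloch operator as a small perturbation of a Fourier multiplier -/

/-- The part of the Jacobian along `u` that multiplies the first component, without its value at
the trivial state. -/
def jacPart₀ (b : ℝ) (u : Profile) : C(Circ, ℝ) :=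
  (b + 4) • u 0 + (4 : ℝ) • u 1 + (2 : ℝ) • (u 0 * u 1)

/-- The part of the Jacobian along `u` that multiplies the second component, without its value at
the trivial state. -/
def jacPart₁ (u : Profile) : C(Circ, ℝ) := (4 : ℝ) • u 0 + u 0 * u 0

theorem jacobianAlong_eq (b : ℝ) (u : Profile) :
    jacobianAlong b u 0 0 = ContinuousMap.const _ (b + 3) + jacPart₀ b u ∧
    jacobianAlong b u 0 1 = ContinuousMap.const _ 4 + jacPart₁ u ∧
    jacobianAlong b u 1 0 = ContinuousMap.const _ (-(b + 4)) + -jacPart₀ b u ∧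
    jacobianAlong b u 1 1 = ContinuousMap.const _ (-4) + -jacPart₁ u := by
  refine ⟨?_, ?_, ?_, ?_⟩ <;> ext x <;>
    simp [jacobianAlong, reactionJacobian, jacPart₀, jacPart₁] <;> ring

/-- The scalar part of the perturbation of the linearization along `u`. -/
def pertScalar (b : ℝ) (u : Profile) : L2perVec →L[ℂ] L2per :=
  (mulL2 (jacPart₀ b u)).comp (ContinuousLinearMap.proj 0)
    + (mulL2 (jacPart₁ u)).comp (ContinuousLinearMap.proj 1)

theorem pertScalar_apply (b : ℝ) (u : Profile) (V : L2perVec) :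
    pertScalar b u V = mulL2 (jacPart₀ b u) (V 0) + mulL2 (jacPart₁ u) (V 1) := rfl

/-- The perturbation of the linearization along `u`. -/
def pertOp (b : ℝ) (u : Profile) : L2perVec →L[ℂ] L2perVec :=
  ContinuousLinearMap.pi (Fin.cons (pertScalar b u) (fun _ => -pertScalar b u))

theorem pertOp_zero (b : ℝ) (u : Profile) (V : L2perVec) : pertOp b u V 0 = pertScalar b u V := rfl

theorem pertOp_one (b : ℝ) (u : Profile) (V : L2perVec) : pertOp b u V 1 = -pertScalar b u V := rfl

theorem norm_pertOp_le (b : ℝ) (u : Profile) {C : ℝ} (hC : ‖jacPart₀ b u‖ + ‖jacPart₁ u‖ ≤ C) :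
    ‖pertOp b u‖ ≤ C := by
  have hC0 : 0 ≤ C := (by positivity : (0 : ℝ) ≤ ‖jacPart₀ b u‖ + ‖jacPart₁ u‖).trans hC
  refine ContinuousLinearMap.opNorm_le_bound _ hC0 fun V => ?_
  have h : ‖pertScalar b u V‖ ≤ C * ‖V‖ := by
    rw [pertScalar_apply]
    refine (norm_add_le _ _).trans ?_
    have h0 := (norm_mulL2_le (jacPart₀ b u) (V 0)).trans
      (mul_le_mul_of_nonneg_left (norm_le_pi_norm V 0) (norm_nonneg _))
    have h1 := (norm_mulL2_le (jacPart₁ u) (V 1)).trans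
      (mul_le_mul_of_nonneg_left (norm_le_pi_norm V 1) (norm_nonneg _))
    have h2 := mul_le_mul_of_nonneg_right hC (norm_nonneg V)
    linarith
  rw [pi_norm_le_iff_of_nonneg (by positivity), Fin.forall_fin_two, pertOp_zero, pertOp_one,
    norm_neg]
  exact ⟨h, h⟩

theorem blochOp_apply (u : Profile) (ε ω : ℝ) (x : (blochOp u ε ω 0).domain) (j : Fin 2) :
    blochOp u ε ω 0 x j = ((waveNumber ε ω ^ 2 * diffusion j : ℝ) : ℂ) •
            blochD2 0 ⟨(x : L2perVec) j, x.2 j (Set.mem_univ j)⟩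
          + ∑ i, mulL2 (jacobianAlong (ε ^ 2) u j i) ((x : L2perVec) i) := rfl

theorem repr_blochOp_zero (u : Profile) (ε ω : ℝ) (x : (blochOp u ε ω 0).domain) (n : ℤ) :
    fourierBasis.repr (blochOp u ε ω 0 x 0) n
      = ((ε ^ 2 + 3 - 4 * (waveNumber ε ω ^ 2 * (n : ℝ) ^ 2) : ℝ) : ℂ)
          * fourierBasis.repr ((x : L2perVec) 0) n
        + 4 * fourierBasis.repr ((x : L2perVec) 1) n
        + fourierBasis.repr (pertOp (ε ^ 2) u x 0) n := by
  have hd : diffusion 0 = 4 := rfl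
  rw [blochOp_apply, Fin.sum_univ_two, (jacobianAlong_eq _ u).1, (jacobianAlong_eq _ u).2.1,
    mulL2_add, mulL2_add, mulL2_const, mulL2_const, pertOp_zero, pertScalar_apply, hd]
  simp only [map_add, map_smul, lp.coeFn_add, lp.coeFn_smul, Pi.add_apply, Pi.smul_apply,
    repr_blochD2, smul_eq_mul]
  push_cast
  ring

theorem repr_blochOp_one (u : Profile) (ε ω : ℝ) (x : (blochOp u ε ω 0).domain) (n : ℤ) :
    fourierBasis.repr (blochOp u ε ω 0 x 1) n
      = -(ε ^ 2 + 4) * fourierBasis.repr ((x : L2perVec) 0) n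
        + ((-4 - 16 * (waveNumber ε ω ^ 2 * (n : ℝ) ^ 2) : ℝ) : ℂ)
          * fourierBasis.repr ((x : L2perVec) 1) n
        + fourierBasis.repr (pertOp (ε ^ 2) u x 1) n := by
  have hd : diffusion 1 = 16 := rfl
  rw [blochOp_apply, Fin.sum_univ_two, (jacobianAlong_eq _ u).2.2.1, (jacobianAlong_eq _ u).2.2.2,
    mulL2_add, mulL2_add, mulL2_const, mulL2_const, mulL2_neg, mulL2_neg, pertOp_one,
    pertScalar_apply, hd]
  simp only [map_add, map_smul, map_neg, lp.coeFn_add, lp.coeFn_smul, lp.coeFn_neg, Pi.add_apply,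
    Pi.smul_apply, Pi.neg_apply, repr_blochD2, smul_eq_mul]
  push_cast
  ring

/-- The even (`s = 1`) or odd (`s = -1`) almost-kernel vector, in the domain. -/
def critVec (u : Profile) (ε ω : ℝ) (s : ℂ) : (blochOp u ε ω 0).domain :=
  ⟨modeVec s 2 (-1), modeVec_mem s 2 (-1)⟩

theorem critFun_modeVec (s s' x y : ℂ) :
    critFun s (modeVec s' x y) = (1 + s * s') / 2 * ((2 * x + y) / 3) := by
  rw [critFun_apply]
  simp only [repr_modeVec_zero, repr_modeVec_one]
  norm_num
  ring

/-- The even and odd rank-one projections together act as the same rank-one matrix on mode 1 and on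
mode -1, so the shift remains a Fourier multiplier. -/
theorem repr_rankTwo_zero (V : L2perVec) (n : ℤ) :
    fourierBasis.repr ((critFun 1 V • modeVec 1 2 (-1) + critFun (-1) V • modeVec (-1) 2 (-1)) 0) n
      = critInd n * (4 / 3 * fourierBasis.repr (V 0) n + 2 / 3 * fourierBasis.repr (V 1) n) := by
  simp only [Pi.add_apply, Pi.smul_apply, map_add, map_smul, lp.coeFn_add, lp.coeFn_smul,
    repr_modeVec_zero, critFun_apply, smul_eq_mul, critInd]
  by_cases h1 : n = 1
  · subst h1; norm_num; ring
  · by_cases h2 : n = -1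
    · subst h2; norm_num; ring
    · simp [h1, h2]

theorem repr_rankTwo_one (V : L2perVec) (n : ℤ) :
    fourierBasis.repr ((critFun 1 V • modeVec 1 2 (-1) + critFun (-1) V • modeVec (-1) 2 (-1)) 1) n
      = -critInd n * (2 / 3 * fourierBasis.repr (V 0) n + 1 / 3 * fourierBasis.repr (V 1) n) := by
  simp only [Pi.add_apply, Pi.smul_apply, map_add, map_smul, lp.coeFn_add, lp.coeFn_smul,
    repr_modeVec_one, critFun_apply, smul_eq_mul, critInd]
  by_cases h1 : n = 1
  · subst h1; norm_num; ring
  · by_cases h2 : n = -1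
    · subst h2; norm_num; ring
    · simp [h1, h2]

/-- The unperturbed shifted operator has the explicit resolvent with symbol `invSym`. -/
theorem isInv_unperturbed (u : Profile) {ε ω : ℝ} (h : NearOnset (ε ^ 2) (waveNumber ε ω ^ 2))
    {z : ℂ} (hz : -(1 / 8) ≤ z.re) :
    IsInv (AlmostKernel.shifted (blochOp u ε ω 0) (critVec u ε ω 1) (critVec u ε ω (-1))
        (critFun 1) (critFun (-1)) - z • (blochOp u ε ω 0).domain.subtype
        - onDomain _ (pertOp (ε ^ 2) u))
      (matrixMul (invSym (ε ^ 2) (waveNumber ε ω ^ 2) z) 100 (norm_invSym_le' h hz)) := by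
  set L := AlmostKernel.shifted (blochOp u ε ω 0) (critVec u ε ω 1) (critVec u ε ω (-1))
        (critFun 1) (critFun (-1)) - z • (blochOp u ε ω 0).domain.subtype
        - onDomain _ (pertOp (ε ^ 2) u)
  have e00 : ∀ n, ((shiftSym (ε ^ 2) (waveNumber ε ω ^ 2) n 0 0 : ℝ) : ℂ)
      = ε ^ 2 + 3 - 4 * (waveNumber ε ω ^ 2 * (n : ℂ) ^ 2) - 4 / 3 * critInd n := fun n => by simp [shiftSym]
  have e01 : ∀ n, ((shiftSym (ε ^ 2) (waveNumber ε ω ^ 2) n 0 1 : ℝ) : ℂ) = 4 - 2 / 3 * critInd n := fun n => by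
    simp [shiftSym]
  have e10 : ∀ n, ((shiftSym (ε ^ 2) (waveNumber ε ω ^ 2) n 1 0 : ℝ) : ℂ) = -(ε ^ 2 + 4) + 2 / 3 * critInd n := fun n => by
    simp [shiftSym]
  have e11 : ∀ n, ((shiftSym (ε ^ 2) (waveNumber ε ω ^ 2) n 1 1 : ℝ) : ℂ)
      = -4 - 16 * (waveNumber ε ω ^ 2 * (n : ℂ) ^ 2) + 1 / 3 * critInd n := fun n => by simp [shiftSym]
  have hLapp : ∀ x, L x = blochOp u ε ω 0 x
      - (critFun 1 (x : L2perVec) • modeVec 1 2 (-1)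
        + critFun (-1) (x : L2perVec) • modeVec (-1) 2 (-1))
      - z • (x : L2perVec) - pertOp (ε ^ 2) u x := by
    intro x
    have : L x = blochOp u ε ω 0 x - critFun 1 (x : L2perVec) • modeVec 1 2 (-1)
        - critFun (-1) (x : L2perVec) • modeVec (-1) 2 (-1) - z • (x : L2perVec)
        - pertOp (ε ^ 2) u x := rfl
    rw [this]; abel
  have h0 : ∀ x n, fourierBasis.repr (L x 0) n
      = (shiftSym (ε ^ 2) (waveNumber ε ω ^ 2) n 0 0 - z) * fourierBasis.repr ((x : L2perVec) 0) n
        + shiftSym (ε ^ 2) (waveNumber ε ω ^ 2) n 0 1 * fourierBasis.repr ((x : L2perVec) 1) n := by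
    intro x n
    rw [hLapp, Pi.sub_apply, Pi.sub_apply, Pi.sub_apply, Pi.smul_apply, map_sub, map_sub, map_sub,
      map_smul]
    simp only [lp.coeFn_sub, lp.coeFn_smul, Pi.sub_apply, Pi.smul_apply, repr_rankTwo_zero,
      repr_blochOp_zero, smul_eq_mul, e00, e01]
    push_cast
    ring
  have h1 : ∀ x n, fourierBasis.repr (L x 1) n
      = shiftSym (ε ^ 2) (waveNumber ε ω ^ 2) n 1 0 * fourierBasis.repr ((x : L2perVec) 0) n
        + (shiftSym (ε ^ 2) (waveNumber ε ω ^ 2) n 1 1 - z) * fourierBasis.repr ((x : L2perVec) 1) n := by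
    intro x n
    rw [hLapp, Pi.sub_apply, Pi.sub_apply, Pi.sub_apply, Pi.smul_apply, map_sub, map_sub, map_sub,
      map_smul]
    simp only [lp.coeFn_sub, lp.coeFn_smul, Pi.sub_apply, Pi.smul_apply, repr_rankTwo_one,
      repr_blochOp_one, smul_eq_mul, e10, e11]
    push_cast
    ring
  have i00 : ∀ n, invSym (ε ^ 2) (waveNumber ε ω ^ 2) z n 0 0 = (shiftSym (ε ^ 2) (waveNumber ε ω ^ 2) n 1 1 - z) / symDet (ε ^ 2) (waveNumber ε ω ^ 2) z n := fun _ => rfl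
  have i01 : ∀ n, invSym (ε ^ 2) (waveNumber ε ω ^ 2) z n 0 1 = -(shiftSym (ε ^ 2) (waveNumber ε ω ^ 2) n 0 1) / symDet (ε ^ 2) (waveNumber ε ω ^ 2) z n := fun _ => rfl
  have i10 : ∀ n, invSym (ε ^ 2) (waveNumber ε ω ^ 2) z n 1 0 = -(shiftSym (ε ^ 2) (waveNumber ε ω ^ 2) n 1 0) / symDet (ε ^ 2) (waveNumber ε ω ^ 2) z n := fun _ => rfl
  have i11 : ∀ n, invSym (ε ^ 2) (waveNumber ε ω ^ 2) z n 1 1 = (shiftSym (ε ^ 2) (waveNumber ε ω ^ 2) n 0 0 - z) / symDet (ε ^ 2) (waveNumber ε ω ^ 2) z n := fun _ => rfl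
  constructor
  · intro y
    refine ⟨matrixMul_mem _ _ _ (norm_invSym_le h hz) y, ext_vec (fun n => ?_) (fun n => ?_)⟩
    · have hd := symDet_ne_zero h hz n
      simp only [h0, repr_matrixMul, i00, i01, i10, i11]
      field_simp
      rw [symDet]
      ring
    · have hd := symDet_ne_zero h hz n
      simp only [h1, repr_matrixMul, i00, i01, i10, i11]
      field_simp
      rw [symDet]
      ring
  · intro x
    refine ext_vec (fun n => ?_) (fun n => ?_)
    · have hd := symDet_ne_zero h hz n
      simp only [h0, h1, repr_matrixMul, i00, i01]
      field_simp
      rw [symDet]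
      ring
    · have hd := symDet_ne_zero h hz n
      simp only [h0, h1, repr_matrixMul, i10, i11]
      field_simp
      rw [symDet]
      ring

/-! ### The almost-kernel of the Bloch operator -/

theorem reflectVec_mem {V : L2perVec} (hV : V ∈ Submodule.pi Set.univ (fun _ : Fin 2 => H2per)) :
    reflectVec V ∈ Submodule.pi Set.univ (fun _ : Fin 2 => H2per) :=
  fun i hi => reflectL2_mem (hV i hi)

theorem pertScalar_reflectVec {b : ℝ} {u : Profile} (hu : ∀ j x, u j (-x) = u j x) (V : L2perVec) :
    pertScalar b u (reflectVec V) = reflectL2 (pertScalar b u V) := by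
  have h0 : ∀ x, jacPart₀ b u (-x) = jacPart₀ b u x := by intro x; simp [jacPart₀, hu]
  have h1 : ∀ x, jacPart₁ u (-x) = jacPart₁ u x := by intro x; simp [jacPart₁, hu]
  rw [pertScalar_apply, pertScalar_apply, map_add, reflectVec_apply, reflectVec_apply,
    reflectL2_mulL2 h0, reflectL2_mulL2 h1]

theorem pertOp_reflectVec {b : ℝ} {u : Profile} (hu : ∀ j x, u j (-x) = u j x) (V : L2perVec)
    (j : Fin 2) (n : ℤ) : fourierBasis.repr (pertOp b u (reflectVec V) j) n
      = fourierBasis.repr (pertOp b u V j) (-n) := by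
  fin_cases j
  · change fourierBasis.repr (pertScalar b u (reflectVec V)) n
      = fourierBasis.repr (pertScalar b u V) (-n)
    rw [pertScalar_reflectVec hu, repr_reflectL2]
  · change fourierBasis.repr (-pertScalar b u (reflectVec V)) n
      = fourierBasis.repr (-pertScalar b u V) (-n)
    rw [pertScalar_reflectVec hu, ← map_neg reflectL2, repr_reflectL2]

theorem blochOp_reflectVec {u : Profile} (hu : ∀ j x, u j (-x) = u j x) (ε ω : ℝ)
    (x : (blochOp u ε ω 0).domain) :
    blochOp u ε ω 0 ⟨reflectVec x, reflectVec_mem x.2⟩ = reflectVec (blochOp u ε ω 0 x) := by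
  refine ext_vec (fun n => ?_) (fun n => ?_)
  · rw [repr_blochOp_zero, reflectVec_apply, repr_reflectL2, repr_blochOp_zero]
    simp only [reflectVec_apply, repr_reflectL2, pertOp_reflectVec hu]
    push_cast
    ring
  · rw [repr_blochOp_one, reflectVec_apply, repr_reflectL2, repr_blochOp_one]
    simp only [reflectVec_apply, repr_reflectL2, pertOp_reflectVec hu]
    push_cast
    ring

theorem reflectVec_modeVec {s : ℂ} (hs : s * s = 1) (x y : ℂ) :
    reflectVec (modeVec s x y) = s • modeVec s x y := by
  have hn : ∀ n : ℤ, (-n = 1 ↔ n = -1) ∧ (-n = -1 ↔ n = 1) := fun n => by constructor <;> omega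
  refine ext_vec (fun n => ?_) (fun n => ?_)
  · rw [reflectVec_apply, repr_reflectL2, Pi.smul_apply, map_smul]
    simp only [lp.coeFn_smul, Pi.smul_apply, repr_modeVec_zero, hn, smul_eq_mul]
    linear_combination (-(x / 2) * (if n = -1 then 1 else 0)) * hs
  · rw [reflectVec_apply, repr_reflectL2, Pi.smul_apply, map_smul]
    simp only [lp.coeFn_smul, Pi.smul_apply, repr_modeVec_one, hn, smul_eq_mul]
    linear_combination (-(y / 2) * (if n = -1 then 1 else 0)) * hs

theorem critFun_reflectVec {s : ℂ} (hs : s * s = 1) (V : L2perVec) :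
    critFun s (reflectVec V) = s * critFun s V := by
  simp only [critFun_apply, reflectVec_apply, repr_reflectL2, neg_neg]
  linear_combination (-(1 / 3) * (2 * fourierBasis.repr (V 0) (-1) + fourierBasis.repr (V 1) (-1)))
    * hs

theorem norm_jacPart_add_le {b : ℝ} (hb0 : 0 ≤ b) (hb : b ≤ 1 / 100) {u : Profile} {r : ℝ}
    (hr : r ≤ 1 / 100) (hu : ‖u‖ ≤ r) : ‖jacPart₀ b u‖ + ‖jacPart₁ u‖ ≤ 15 * r := by
  have hr0 : 0 ≤ r := (norm_nonneg _).trans hu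
  have hj := fun j => (norm_le_pi_norm u j).trans hu
  have h01 := norm_mul_le_of_le' (hj 0) (hj 1)
  have h00 := norm_mul_le_of_le' (hj 0) (hj 0)
  have h1 : ‖jacPart₀ b u‖ ≤ (b + 4) * r + 4 * r + 2 * (r * r) := by
    refine norm_add₃_le.trans ?_
    rw [norm_smul, norm_smul, norm_smul, Real.norm_of_nonneg (by linarith),
      Real.norm_of_nonneg (by norm_num), Real.norm_of_nonneg (by norm_num)]
    gcongr
    · exact hj 0
    · exact hj 1
  have h2 : ‖jacPart₁ u‖ ≤ 4 * r + r * r := by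
    refine (norm_add_le _ _).trans ?_
    rw [norm_smul, Real.norm_of_nonneg (by norm_num)]
    gcongr
    exact hj 0
  nlinarith

theorem OnBranch.norm_pertOp_le {ε ω : ℝ} {h : Admissible ε ω} {u : Profile} {a : ℝ}
    {ψ : Profile} (hu : OnBranch h u a ψ) : ‖pertOp (ε ^ 2) u‖ ≤ 60 * ε := by
  have h1 := h.eps_le'
  have h2 := norm_jacPart_add_le h.nearOnset.b_nonneg h.nearOnset.b_le (by linarith) hu.norm_le
  exact Brusselator.norm_pertOp_le _ _ (by linarith)

/-- At b = 0 and t = 1/4 both multiplier entries vanish, since (2, -1) is then the kernel vector of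
the symbol at n = ±1. -/
theorem blochOp_critVec (u : Profile) (ε ω : ℝ) (s : ℂ) :
    blochOp u ε ω 0 (critVec u ε ω s)
      = modeVec s ((2 * (ε ^ 2 + 3 - 4 * waveNumber ε ω ^ 2) - 4 : ℝ) : ℂ)
          ((-2 * (ε ^ 2 + 4) + 4 + 16 * waveNumber ε ω ^ 2 : ℝ) : ℂ)
        + pertOp (ε ^ 2) u (modeVec s 2 (-1)) := by
  refine ext_vec (fun n => ?_) (fun n => ?_)
  · rw [repr_blochOp_zero, Pi.add_apply, map_add]
    simp only [critVec, lp.coeFn_add, Pi.add_apply, repr_modeVec_zero, repr_modeVec_one]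
    congr 1
    by_cases h1 : n = 1
    · subst h1; norm_num; ring
    · by_cases h2 : n = -1
      · subst h2; norm_num; ring
      · simp [h1, h2]
  · rw [repr_blochOp_one, Pi.add_apply, map_add]
    simp only [critVec, lp.coeFn_add, Pi.add_apply, repr_modeVec_zero, repr_modeVec_one]
    congr 1
    by_cases h1 : n = 1
    · subst h1; norm_num; ring
    · by_cases h2 : n = -1
      · subst h2; norm_num; ring
      · simp [h1, h2]

theorem OnBranch.norm_blochOp_critVec_le {ε ω : ℝ} {h : Admissible ε ω} {u : Profile} {a : ℝ}
    {ψ : Profile} (hu : OnBranch h u a ψ) {s : ℂ} (hs : ‖s‖ = 1) :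
    ‖blochOp u ε ω 0 (critVec u ε ω s)‖ ≤ 130 * ε := by
  have he := h.eps_nonneg
  have he' := h.eps_le'
  have ht := abs_le.mp h.abs_sub_le
  have hsq : ε ^ 2 ≤ 1 / 800000 * ε := by nlinarith
  rw [blochOp_critVec]
  refine (norm_add_le _ _).trans ?_
  have h1 : ‖modeVec s ((2 * (ε ^ 2 + 3 - 4 * waveNumber ε ω ^ 2) - 4 : ℝ) : ℂ)
      ((-2 * (ε ^ 2 + 4) + 4 + 16 * waveNumber ε ω ^ 2 : ℝ) : ℂ)‖ ≤ 9 * ε := by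
    refine norm_modeVec_le hs ?_ ?_
    · rw [Complex.norm_real, Real.norm_eq_abs, abs_le]
      constructor <;> nlinarith [sq_nonneg ε]
    · rw [Complex.norm_real, Real.norm_eq_abs, abs_le]
      constructor <;> nlinarith [sq_nonneg ε]
  have h2 : ‖modeVec s 2 (-1)‖ ≤ 2 := norm_modeVec_le hs (by simp) (by simp)
  have h3 := (pertOp (ε ^ 2) u).le_of_opNorm_le_of_le hu.norm_pertOp_le h2
  linarith

/-- The row (2, 1) is the left kernel of that symbol at onset, so the explicit coefficients on the
right vanish there. This supplies the `dual` bound. -/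
theorem critFun_blochOp (u : Profile) (ε ω : ℝ) (x : (blochOp u ε ω 0).domain) :
    critFun 1 (blochOp u ε ω 0 x) = 1 / 3 *
      (((ε ^ 2 + 2 - 8 * waveNumber ε ω ^ 2 : ℝ) : ℂ) * (fourierBasis.repr ((x : L2perVec) 0) 1
          + 1 * fourierBasis.repr ((x : L2perVec) 0) (-1))
        + ((4 - 16 * waveNumber ε ω ^ 2 : ℝ) : ℂ) * (fourierBasis.repr ((x : L2perVec) 1) 1
          + 1 * fourierBasis.repr ((x : L2perVec) 1) (-1)))
      + critFun 1 (pertOp (ε ^ 2) u x) := by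
  rw [critFun_apply, critFun_apply]
  simp only [repr_blochOp_zero, repr_blochOp_one]
  push_cast
  ring

theorem OnBranch.norm_critFun_blochOp_le {ε ω : ℝ} {h : Admissible ε ω} {u : Profile} {a : ℝ}
    {ψ : Profile} (hu : OnBranch h u a ψ) (x : (blochOp u ε ω 0).domain) :
    ‖critFun 1 (blochOp u ε ω 0 x)‖ ≤ 130 * ε * ‖(x : L2perVec)‖ := by
  have he := h.eps_nonneg
  have he' := h.eps_le'
  have ht := abs_le.mp h.abs_sub_le
  have hsq : ε ^ 2 ≤ 1 / 800000 * ε := by nlinarith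
  have hone : ‖(1 : ℂ)‖ = 1 := norm_one
  rw [critFun_blochOp]
  refine (norm_add_le _ _).trans ?_
  have h1 : ‖((ε ^ 2 + 2 - 8 * waveNumber ε ω ^ 2 : ℝ) : ℂ)‖ ≤ 5 * ε := by
    rw [Complex.norm_real, Real.norm_eq_abs, abs_le]
    constructor <;> nlinarith [sq_nonneg ε]
  have h2 : ‖((4 - 16 * waveNumber ε ω ^ 2 : ℝ) : ℂ)‖ ≤ 8 * ε := by
    rw [Complex.norm_real, Real.norm_eq_abs, abs_le]
    constructor <;> linarith
  have h3 := norm_repr_add_le hone (x : L2perVec) 0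
  have h4 := norm_repr_add_le hone (x : L2perVec) 1
  have h5 := (critFun 1).le_of_opNorm_le_of_le (norm_critFun_le hone)
    ((pertOp (ε ^ 2) u).le_of_opNorm_le hu.norm_pertOp_le x)
  rw [norm_mul]
  have h6 : ‖(1 / 3 : ℂ)‖ = 1 / 3 := by norm_num
  rw [h6]
  have h7 := norm_add_le (((ε ^ 2 + 2 - 8 * waveNumber ε ω ^ 2 : ℝ) : ℂ)
      * (fourierBasis.repr ((x : L2perVec) 0) 1 + 1 * fourierBasis.repr ((x : L2perVec) 0) (-1)))
    (((4 - 16 * waveNumber ε ω ^ 2 : ℝ) : ℂ) * (fourierBasis.repr ((x : L2perVec) 1) 1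
          + 1 * fourierBasis.repr ((x : L2perVec) 1) (-1)))
  rw [norm_mul, norm_mul] at h7
  have h8 := mul_le_mul h1 h3 (norm_nonneg _) (by linarith)
  have h9 := mul_le_mul h2 h4 (norm_nonneg _) (by linarith)
  have h10 : 0 ≤ ε * ‖(x : L2perVec)‖ := by positivity
  linarith

theorem OnBranch.almostKernel {ε ω : ℝ} {h : Admissible ε ω} {u : Profile} {a : ℝ}
    {ψ : Profile} (hu : OnBranch h u a ψ) (hε : ε ≤ 1 / 1000000000) :
    AlmostKernel (blochOp u ε ω 0) 400 2 (130 * ε) (critVec u ε ω 1) (critVec u ε ω (-1))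
      (critFun 1) (critFun (-1)) reflectVec where
  one_le_M := by norm_num
  one_le_a := by norm_num
  eta_nonneg := by linarith [h.eps_nonneg]
  -- Here 16·2·400²·130 is below 10⁹, which is where the extra restriction on ε comes from.
  small := by linarith
  norm_φc := norm_critFun_le (by simp)
  norm_φs := norm_critFun_le (by simp)
  φc_vc := by rw [critVec, critFun_modeVec]; norm_num
  φc_vs := by rw [critVec, critFun_modeVec]; norm_num
  φs_vc := by rw [critVec, critFun_modeVec]; norm_num
  φs_vs := by rw [critVec, critFun_modeVec]; norm_num
  norm_A_vc := hu.norm_blochOp_critVec_le (by simp)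
  norm_A_vs := hu.norm_blochOp_critVec_le (by simp)
  dual := hu.norm_critFun_blochOp_le
  J_mem := fun _ hx => reflectVec_mem hx
  J_comm := blochOp_reflectVec hu.even ε ω
  J_vc := by
    have := reflectVec_modeVec (s := 1) (by norm_num) 2 (-1)
    rw [one_smul] at this
    exact this
  J_vs := by
    have := reflectVec_modeVec (s := -1) (by norm_num) 2 (-1)
    rw [neg_one_smul] at this
    exact this
  φc_J := fun x => by rw [critFun_reflectVec (by norm_num), one_mul]
  φs_J := fun x => by rw [critFun_reflectVec (by norm_num), neg_one_mul]
  inv := by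
    intro z hz
    have h1 := isInv_unperturbed u h.nearOnset hz
    have h2 := norm_matrixMul_le _ _ (norm_invSym_le' h.nearOnset hz)
    have h3 := hu.norm_pertOp_le
    have h4 := mul_le_mul h3 h2 (norm_nonneg _) (by linarith [h.eps_nonneg])
    -- The unperturbed resolvent has norm at most 200; the Neumann series doubles it, giving M =
    -- 400.
    obtain ⟨R, h5, h6⟩ := h1.add_bounded (pertOp (ε ^ 2) u) (h4.trans (by linarith))
    refine ⟨R, h6.trans (by linarith), ?_⟩
    rw [sub_add_cancel] at h5
    exact h5

/-! ### Forced profiles and translations -/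

/-- A profile as an element of `L²_per([0, 2π], ℂ²)`. -/
def toVec (w : Profile) : L2perVec := fun j => toL2 (w j)

theorem norm_toVec_le {w : Profile} {r : ℝ} (hw : ‖w‖ ≤ r) : ‖toVec w‖ ≤ r := by
  rw [pi_norm_le_iff_of_nonneg ((norm_nonneg _).trans hw)]
  exact fun j => (norm_toL2_le _).trans ((norm_le_pi_norm w j).trans hw)

/-- The Fourier modes of `w` solve the linearization at the trivial state with forcing
`(q, -q)`. -/
structure IsForced (b t : ℝ) (w : Profile) (q : C(Circ, ℝ)) : Prop where
  zero : ∀ n : ℤ, ((t * 4 * (n : ℝ) ^ 2 : ℝ) : ℂ) * cc (w 0) n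
    = cc ((b + 3) • w 0 + (4 : ℝ) • w 1 + q) n
  one : ∀ n : ℤ, ((t * 16 * (n : ℝ) ^ 2 : ℝ) : ℂ) * cc (w 1) n
    = cc (-((b + 4) • w 0 + (4 : ℝ) • w 1 + q)) n

theorem IsForced.sub {b t : ℝ} {w w' : Profile} {q q' : C(Circ, ℝ)} (h : IsForced b t w q)
    (h' : IsForced b t w' q') : IsForced b t (w - w') (q - q') where
  zero n := by
    have h1 := h.zero n
    have h2 := h'.zero n
    simp only [Pi.sub_apply, cc_add, cc_sub, cc_smul] at h1 h2 ⊢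
    linear_combination h1 - h2
  one n := by
    have h1 := h.one n
    have h2 := h'.one n
    simp only [Pi.sub_apply, cc_add, cc_sub, cc_smul, cc_neg] at h1 h2 ⊢
    linear_combination h1 - h2

/-- The scalar that the linearization along `u` produces from a forced profile. -/
def residual (b : ℝ) (u w : Profile) (q : C(Circ, ℝ)) : C(Circ, ℝ) :=
  jacPart₀ b u * w 0 + jacPart₁ u * w 1 - q

theorem IsForced.mem {ε ω : ℝ} {w : Profile} {q : C(Circ, ℝ)}
    (hw : IsForced (ε ^ 2) (waveNumber ε ω ^ 2) w q) (u : Profile) :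
    toVec w ∈ (blochOp u ε ω 0).domain := by
  have hk := pow_pos (waveNumber_pos ε ω) 2
  have h : ∀ j, toL2 (w j) ∈ H2per := by
    rw [Fin.forall_fin_two]
    exact ⟨toL2_mem_H2per (mul_pos hk (by norm_num)) hw.zero,
      toL2_mem_H2per (mul_pos hk (by norm_num)) hw.one⟩
  exact fun j _ => h j

theorem smul_blochD2_eq {c g : C(Circ, ℝ)} {r : ℝ} (hc : toL2 c ∈ H2per)
    (h : ∀ n : ℤ, ((r * (n : ℝ) ^ 2 : ℝ) : ℂ) * cc c n = cc g n) :
    (r : ℂ) • blochD2 0 ⟨toL2 c, hc⟩ = toL2 (-g) := by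
  refine ext_repr fun n => ?_
  change _ = cc (-g) n
  rw [map_smul, cc_neg, ← h n, cc]
  simp only [lp.coeFn_smul, Pi.smul_apply, repr_blochD2, smul_eq_mul]
  push_cast
  ring

/-- The forcing replaces the constant-coefficient part of the linearization, so only zeroth order
terms remain. No derivative of a profile has to be estimated afterwards. -/
theorem IsForced.blochOp_eq {ε ω : ℝ} {w : Profile} {q : C(Circ, ℝ)}
    (hw : IsForced (ε ^ 2) (waveNumber ε ω ^ 2) w q) (u : Profile) :
    blochOp u ε ω 0 ⟨toVec w, hw.mem u⟩
      = toVec ![residual (ε ^ 2) u w q, -residual (ε ^ 2) u w q] := by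
  obtain ⟨j1, j2, j3, j4⟩ := jacobianAlong_eq (ε ^ 2) u
  have h : ∀ j, blochOp u ε ω 0 ⟨toVec w, hw.mem u⟩ j
      = toVec ![residual (ε ^ 2) u w q, -residual (ε ^ 2) u w q] j := by
    rw [Fin.forall_fin_two]
    constructor
    · have e := smul_blochD2_eq (g := (ε ^ 2 + 3) • w 0 + (4 : ℝ) • w 1 + q)
        (r := waveNumber ε ω ^ 2 * diffusion 0) (hw.mem u 0 (Set.mem_univ 0)) hw.zero
      rw [blochOp_apply, Fin.sum_univ_two, j1, j2]
      refine (congrArg₂ (· + ·) e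
        (congrArg₂ (· + ·) (mulL2_toL2 _ (w 0)) (mulL2_toL2 _ (w 1)))).trans ?_
      rw [← toL2_add, ← toL2_add]
      change toL2 _ = toL2 (residual (ε ^ 2) u w q)
      congr 1
      ext x
      simp [residual]
      ring
    · have e := smul_blochD2_eq (g := -((ε ^ 2 + 4) • w 0 + (4 : ℝ) • w 1 + q))
        (r := waveNumber ε ω ^ 2 * diffusion 1) (hw.mem u 1 (Set.mem_univ 1)) hw.one
      rw [blochOp_apply, Fin.sum_univ_two, j3, j4]
      refine (congrArg₂ (· + ·) e
        (congrArg₂ (· + ·) (mulL2_toL2 _ (w 0)) (mulL2_toL2 _ (w 1)))).trans ?_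
      rw [← toL2_add, ← toL2_add]
      change toL2 _ = toL2 (-residual (ε ^ 2) u w q)
      congr 1
      ext x
      simp [residual]
      ring
  exact funext h

/-- Translation of a function on the circle. -/
def translate (θ : Circ) (c : C(Circ, ℝ)) : C(Circ, ℝ) := ⟨fun x => c (x + θ), by fun_prop⟩

theorem translate_zero (c : C(Circ, ℝ)) : translate 0 c = c := by ext x; simp [translate]

theorem continuous_translate (c : C(Circ, ℝ)) : Continuous (fun θ => translate θ c) :=
  (ContinuousMap.curry ⟨fun p : Circ × Circ => c (p.2 + p.1), by fun_prop⟩).continuous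

theorem cc_translate (θ : Circ) (c : C(Circ, ℝ)) (n : ℤ) :
    cc (translate θ c) n = fourier n θ * cc c n := by
  rw [cc_eq_integral, cc_eq_integral, ← integral_const_mul,
    ← integral_add_right_eq_self (fun x : Circ => fourier n θ * (fourier (-n) x * (c x : ℂ))) θ]
  congr 1
  ext x
  have h1 : (fourier (-n) (x + θ) : ℂ) = fourier (-n) x * fourier (-n) θ := by
    simp only [fourier_apply, smul_add, AddCircle.toCircle_add, Circle.coe_mul]
  have h2 : (fourier n θ : ℂ) * fourier (-n) θ = 1 := by
    rw [← fourier_add, add_neg_cancel, fourier_zero]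
  rw [h1]
  change fourier (-n) x * (c (x + θ) : ℂ) = _
  linear_combination (-(fourier (-n) x * (c (x + θ) : ℂ))) * h2

/-- Translation of a profile. -/
def translateProfile (θ : Circ) (w : Profile) : Profile := fun j => translate θ (w j)

theorem IsForced.translate {b t : ℝ} {w : Profile} {q : C(Circ, ℝ)} (h : IsForced b t w q)
    (θ : Circ) : IsForced b t (translateProfile θ w) (translate θ q) where
  zero n := by
    have h1 := h.zero n
    simp only [translateProfile, cc_add, cc_smul, cc_translate] at h1 ⊢
    linear_combination fourier n θ * h1
  one n := by
    have h1 := h.one n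
    simp only [translateProfile, cc_add, cc_smul, cc_neg, cc_translate] at h1 ⊢
    linear_combination fourier n θ * h1

theorem isForced_of_coef {b t : ℝ} {w : Profile} {q : C(Circ, ℝ)}
    (hw : ∀ j x, w j (-x) = w j x) (hq : ∀ x, q (-x) = q x)
    (h : ∀ n : ℤ,
      (4 * (t * (n : ℝ) ^ 2) * coef n (w 0) = (b + 3) * coef n (w 0) + 4 * coef n (w 1)
        + coef n q ∧
      16 * (t * (n : ℝ) ^ 2) * coef n (w 1) = -((b + 4) * coef n (w 0) + 4 * coef n (w 1)
        + coef n q))) : IsForced b t w q where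
  zero n := by
    have h1 := congrArg (fun r : ℝ => (r : ℂ)) (h n).1
    simp only [cc_add, cc_smul, cc_eq_coef (hw 0), cc_eq_coef (hw 1), cc_eq_coef hq]
    push_cast at h1 ⊢
    linear_combination h1
  one n := by
    have h1 := congrArg (fun r : ℝ => (r : ℂ)) (h n).2
    simp only [cc_neg, cc_add, cc_smul, cc_eq_coef (hw 0), cc_eq_coef (hw 1), cc_eq_coef hq]
    push_cast at h1 ⊢
    linear_combination h1

/-! ### Even and odd test vectors and the co-periodic spectrum -/

/-- The profile on the branch divided by its amplitude. -/
def shape (t a : ℝ) (ψ : Profile) : Profile := critMode (mSym t 1) + a • ψ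

/-- The forcing of the rescaled profile. -/
def shapeForcing (b a : ℝ) (Φ : Profile) : C(Circ, ℝ) :=
  a • (quadPart (b / 2 + 2) Φ + a • cubicPart Φ)

section OnBranch

variable {ε ω : ℝ} {h : Admissible ε ω} {u : Profile} {a : ℝ} {ψ : Profile}

theorem OnBranch.eq_smul_shape (hu : OnBranch h u a ψ) :
    u = a • shape (waveNumber ε ω ^ 2) a ψ := hu.eq

theorem OnBranch.shape_even (hu : OnBranch h u a ψ) (j : Fin 2) (x : Circ) :
    shape (waveNumber ε ω ^ 2) a ψ j (-x) = shape (waveNumber ε ω ^ 2) a ψ j x := by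
  have h1 : ψ j (-x) = ψ j x := by
    rw [← hu.branch.fixed]; exact partialInv_even h.nearOnset _ j x
  simp [shape, critMode_even, h1]

/-- Uses a²T = μ itself, not its multiple by a, and therefore holds at a = 0, where the profile
equation carries no information about Φ. -/
theorem OnBranch.isForced_shape (hu : OnBranch h u a ψ) :
    IsForced (ε ^ 2) (waveNumber ε ω ^ 2) (shape (waveNumber ε ω ^ 2) a ψ)
      (shapeForcing (ε ^ 2) a (shape (waveNumber ε ω ^ 2) a ψ)) := by
  have he := hu.shape_even
  have hq : shapeForcing (ε ^ 2) a (shape (waveNumber ε ω ^ 2) a ψ)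
      = a • scaledNonlin (ε ^ 2 / 2 + 2) (mSym (waveNumber ε ω ^ 2) 1) a ψ := rfl
  refine isForced_of_coef he ?_ ((forced_modes_iff h.nearOnset he _).mpr ⟨1, ?_, ?_⟩)
  · intro x
    simp [shapeForcing, quadPart, cubicPart, he]
  · rw [hq, map_smul, hu.branch.fixed, one_smul, shape]
  · rw [hq, map_smul, smul_eq_mul, dSym_one_eq]
    linear_combination a * two_mul_coef_one_scaledNonlin (ε ^ 2 / 2 + 2)
      (mSym (waveNumber ε ω ^ 2) 1) a ψ - hu.amp

/-- Euler's identity: linearizing a form of degree d at u = aΦ in direction Φ gives d times its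
value over a, and subtracting the forcing leaves factor 1 for the quadratic part and 2 for the
cubic. -/
theorem OnBranch.residual_shape (hu : OnBranch h u a ψ) :
    residual (ε ^ 2) u (shape (waveNumber ε ω ^ 2) a ψ)
        (shapeForcing (ε ^ 2) a (shape (waveNumber ε ω ^ 2) a ψ))
      = a • quadPart (ε ^ 2 / 2 + 2) (shape (waveNumber ε ω ^ 2) a ψ)
        + (2 * a ^ 2) • cubicPart (shape (waveNumber ε ω ^ 2) a ψ) := by
  rw [hu.eq_smul_shape]
  ext x
  simp [residual, shapeForcing, quadPart, cubicPart, jacPart₀, jacPart₁]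
  ring

theorem OnBranch.norm_smul_correction_le (hu : OnBranch h u a ψ) : ‖a • ψ‖ ≤ 2 * ε := by
  rw [norm_smul, Real.norm_of_nonneg hu.nonneg]
  have := mul_le_mul hu.amp_le hu.branch.norm_le (norm_nonneg _)
    (by linarith [h.eps_nonneg] : 0 ≤ 2 * ε)
  linarith

theorem OnBranch.norm_shape_le (hu : OnBranch h u a ψ) :
    ‖shape (waveNumber ε ω ^ 2) a ψ‖ ≤ 2 :=
  norm_critMode_add_le (abs_mSym_le h.nearOnset one_ne_zero)
    (hu.branch.abs_le.trans (ampMax_le.trans (by norm_num))) hu.branch.norm_le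

theorem OnBranch.abs_coef_shape_sub_le (hu : OnBranch h u a ψ) :
    |coef 1 (shape (waveNumber ε ω ^ 2) a ψ 0) - 1 / 2| ≤ 2 * ε ∧
    |coef 1 (shape (waveNumber ε ω ^ 2) a ψ 1) + 1 / 4| ≤ 3 * ε := by
  have h1 := fun j => (abs_coef_le 1 ((a • ψ) j)).trans
    ((norm_le_pi_norm (a • ψ) j).trans hu.norm_smul_correction_le)
  have e0 : shape (waveNumber ε ω ^ 2) a ψ 0 = cosN 1 + (a • ψ) 0 := rfl
  have e1 : shape (waveNumber ε ω ^ 2) a ψ 1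
      = mSym (waveNumber ε ω ^ 2) 1 • cosN 1 + (a • ψ) 1 := rfl
  have h2 := abs_le.mp h.abs_mSym_add_le
  have h3 := abs_le.mp (h1 0)
  have h4 := abs_le.mp (h1 1)
  have hc : coef 1 (cosN 1) = 1 / 2 := by rw [coef_cosN_one, if_pos (Or.inl rfl)]
  have he := h.eps_nonneg
  rw [e0, e1, map_add, map_add, map_smul, hc, smul_eq_mul, abs_le, abs_le]
  refine ⟨⟨?_, ?_⟩, ?_, ?_⟩ <;> linarith

/-- A second factor ε comes from the quadratic term: it is O(ε) at φ and changes by O(ε) from φ to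
Φ. -/
theorem OnBranch.norm_residual_le (hu : OnBranch h u a ψ) :
    ‖residual (ε ^ 2) u (shape (waveNumber ε ω ^ 2) a ψ)
        (shapeForcing (ε ^ 2) a (shape (waveNumber ε ω ^ 2) a ψ))‖ ≤ 200 * ε ^ 2 := by
  have he := h.eps_nonneg
  have ha := hu.amp_le
  have ha0 := hu.nonneg
  have hn := hu.norm_shape_le
  rw [hu.residual_shape]
  refine (norm_add_le _ _).trans ?_
  rw [norm_smul, norm_smul, Real.norm_of_nonneg ha0, Real.norm_of_nonneg (by positivity)]
  have h1 : ‖quadPart (ε ^ 2 / 2 + 2) (shape (waveNumber ε ω ^ 2) a ψ)‖ ≤ 61 * ε := by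
    have h2 := norm_quadPart_sub_le h.nearOnset.abs_beta_le hn
      ((norm_critMode_le (abs_mSym_le h.nearOnset one_ne_zero)).trans one_le_two)
    rw [show shape (waveNumber ε ω ^ 2) a ψ - critMode (mSym (waveNumber ε ω ^ 2) 1) = a • ψ from
      add_sub_cancel_left _ _] at h2
    have h3 := (norm_quadPart_critMode_le (ε ^ 2 / 2 + 2) (mSym (waveNumber ε ω ^ 2) 1)).trans
      h.abs_quad_le
    have h4 := norm_le_norm_sub_add
      (quadPart (ε ^ 2 / 2 + 2) (shape (waveNumber ε ω ^ 2) a ψ))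
      (quadPart (ε ^ 2 / 2 + 2) (critMode (mSym (waveNumber ε ω ^ 2) 1)))
    have h5 := hu.norm_smul_correction_le
    linarith
  have h2 := norm_cubicPart_le hn
  have h3 := mul_le_mul ha h1 (norm_nonneg _) (by linarith)
  have h4 : 2 * a ^ 2 ≤ 8 * ε ^ 2 := by nlinarith
  have h5 := mul_le_mul h4 h2 (norm_nonneg _) (by positivity)
  nlinarith

/-- Inserting μ = a²T cancels the cubic parts exactly and leaves -a times the first coefficient of
the quadratic part at Φ. Extracting another a leaves a²·O(‖ψ‖ + a‖ψ‖²), hence O(ε³). -/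
theorem OnBranch.abs_coef_residual_add_le (hu : OnBranch h u a ψ) :
    |coef 1 (residual (ε ^ 2) u (shape (waveNumber ε ω ^ 2) a ψ)
        (shapeForcing (ε ^ 2) a (shape (waveNumber ε ω ^ 2) a ψ))) + ε ^ 2 * (1 - 16 * ω ^ 2)|
      ≤ 84000 * sumInv * ε ^ 3 := by
  have he := h.eps_nonneg
  have ha := hu.amp_le
  have ha0 := hu.nonneg
  have hψ := hu.norm_correction_le
  have hS := one_le_sumInv
  have h1 := two_mul_coef_one_scaledNonlin (ε ^ 2 / 2 + 2) (mSym (waveNumber ε ω ^ 2) 1) a ψ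
  have h2 := coef_one_quadPart_add (ε ^ 2 / 2 + 2) (mSym (waveNumber ε ω ^ 2) 1) a ψ
  have h3 : coef 1 (residual (ε ^ 2) u (shape (waveNumber ε ω ^ 2) a ψ)
      (shapeForcing (ε ^ 2) a (shape (waveNumber ε ω ^ 2) a ψ))) + ε ^ 2 * (1 - 16 * ω ^ 2)
      = -(a ^ 2 * coef 1 (polarPart (ε ^ 2 / 2 + 2) (critMode (mSym (waveNumber ε ω ^ 2) 1)) ψ
          + a • quadPart (ε ^ 2 / 2 + 2) ψ)) := by
    rw [hu.residual_shape, ← hu.amp]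
    rw [scaledNonlin, map_add, map_smul, smul_eq_mul] at h1
    simp only [shape, map_add, map_smul, smul_eq_mul] at h2 ⊢
    linear_combination a * h1 - a * h2
  have hβ := h.nearOnset.abs_beta_le
  have h4 := norm_polarPart_le hβ (norm_critMode_le (abs_mSym_le h.nearOnset one_ne_zero)) hψ
  have h5 : ‖a • quadPart (ε ^ 2 / 2 + 2) ψ‖ ≤ 7 * (1000 * sumInv * ε) := by
    have h6 := norm_quadPart_le hβ (le_refl ‖ψ‖)
    have h7 := hu.branch.norm_le
    have h8 : a ≤ 1 := by linarith [h.eps_le']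
    rw [norm_smul, Real.norm_of_nonneg ha0]
    have h9 : ‖ψ‖ ^ 2 ≤ ‖ψ‖ := by nlinarith [norm_nonneg ψ]
    have := mul_le_of_le_one_left (norm_nonneg (quadPart (ε ^ 2 / 2 + 2) ψ)) h8
    linarith
  rw [h3, abs_neg, abs_mul, abs_of_nonneg (sq_nonneg a)]
  have h6 := (abs_coef_le 1 _).trans ((norm_add_le _ _).trans (add_le_add h4 h5))
  have h7 : a ^ 2 ≤ 4 * ε ^ 2 := by nlinarith
  have h8 := mul_le_mul h7 h6 (abs_nonneg _) (by positivity)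
  refine h8.trans (le_of_eq ?_)
  ring

theorem critFun_toVec_of_even {w : Profile} (hw : ∀ j x, w j (-x) = w j x) (s : ℂ) :
    critFun s (toVec w) = (1 + s) / 3 * ((2 * coef 1 (w 0) + coef 1 (w 1) : ℝ) : ℂ) := by
  have h1 : ∀ j (n : ℤ), fourierBasis.repr (toVec w j) n = (coef n (w j) : ℂ) :=
    fun j n => cc_eq_coef (hw j) n
  rw [critFun_apply]
  simp only [h1, coef_neg_index]
  push_cast
  ring

theorem norm_vec_pair (c : C(Circ, ℝ)) {r : ℝ} (hc : ‖c‖ ≤ r) : ‖(![c, -c] : Profile)‖ ≤ r := by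
  rw [pi_norm_le_iff_of_nonneg ((norm_nonneg _).trans hc), Fin.forall_fin_two]
  exact ⟨hc, by simpa using hc⟩

/-- Translates of the rescaled profile give odd approximate kernels of any accuracy. -/
theorem OnBranch.exists_odd_approx (hu : OnBranch h u a ψ) {d : ℝ} (hd : 0 < d) :
    ∃ w : (blochOp u ε ω 0).domain, (w : L2perVec) ≠ 0 ∧ critFun 1 w = 0 ∧
      ‖blochOp u ε ω 0 w‖ ≤ d * ‖(w : L2perVec)‖ := by
  set Φ := shape (waveNumber ε ω ^ 2) a ψ with hΦ
  have heq : u = a • Φ := hu.eq_smul_shape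
  have heven := hu.shape_even
  -- γ₀ and γ₁ are the Jacobian parts at u minus the divided differences of the nonlinearity between
  -- the translates of Φ by θ and -θ. At θ = 0 the divided differences become derivatives, so both
  -- vanish there and stay small nearby by continuity.
  let γ₀ : Circ → C(Circ, ℝ) := fun θ => jacPart₀ (ε ^ 2) u
    - (a • ((ε ^ 2 / 2 + 2) • (translate θ (Φ 0) + translate (-θ) (Φ 0))
        + (4 : ℝ) • translate θ (Φ 1))
      + a ^ 2 • ((translate θ (Φ 0) + translate (-θ) (Φ 0)) * translate θ (Φ 1)))
  let γ₁ : Circ → C(Circ, ℝ) := fun θ => jacPart₁ u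
    - ((4 * a) • translate (-θ) (Φ 0) + a ^ 2 • (translate (-θ) (Φ 0) * translate (-θ) (Φ 0)))
  have hcont : Continuous fun t : ℝ => ‖γ₀ (t : Circ)‖ + ‖γ₁ (t : Circ)‖ := by
    have hco : Continuous fun t : ℝ => (t : Circ) := AddCircle.continuous_mk' _
    have hp : ∀ j, Continuous fun t : ℝ => translate (t : Circ) (Φ j) :=
      fun j => (continuous_translate (Φ j)).comp hco
    have hm : ∀ j, Continuous fun t : ℝ => translate (-(t : Circ)) (Φ j) :=
      fun j => (continuous_translate (Φ j)).comp hco.neg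
    have hp0 := hp 0
    have hp1 := hp 1
    have hm0 := hm 0
    simp only [γ₀, γ₁]
    fun_prop
  have hzero : ‖γ₀ ((0 : ℝ) : Circ)‖ + ‖γ₁ ((0 : ℝ) : Circ)‖ = 0 := by
    have e0 : γ₀ ((0 : ℝ) : Circ) = 0 := by
      simp only [γ₀, AddCircle.coe_zero, neg_zero, translate_zero, heq]
      ext x
      simp [jacPart₀]
      ring
    have e1 : γ₁ ((0 : ℝ) : Circ) = 0 := by
      simp only [γ₁, AddCircle.coe_zero, neg_zero, translate_zero, heq]
      ext x
      simp [jacPart₁]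
      ring
    rw [e0, e1, norm_zero, add_zero]
  have hev : ∀ᶠ t : ℝ in nhds 0, ‖γ₀ (t : Circ)‖ + ‖γ₁ (t : Circ)‖ < d := by
    refine hcont.continuousAt.eventually_lt continuousAt_const ?_
    rw [hzero]; exact hd
  obtain ⟨r, hr, hball⟩ := Metric.eventually_nhds_iff.mp hev
  -- The bound by 1 keeps t below π, so sin t > 0 and the first Fourier coefficient of w is nonzero.
  obtain ⟨t, ht0, ht1⟩ := exists_between (lt_min hr zero_lt_one)
  have hsmall : ‖γ₀ (t : Circ)‖ + ‖γ₁ (t : Circ)‖ < d := by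
    refine hball ?_
    rw [Real.dist_eq, sub_zero, abs_of_pos ht0]
    exact ht1.trans_le (min_le_left _ _)
  set θ : Circ := (t : Circ)
  have hforced := (hu.isForced_shape.translate θ).sub (hu.isForced_shape.translate (-θ))
  rw [← hΦ] at hforced
  set w : Profile := translateProfile θ Φ - translateProfile (-θ) Φ with hw
  have hcc : ∀ j (n : ℤ), fourierBasis.repr (toVec w j) n
      = (fourier n θ - fourier n (-θ)) * (coef n (Φ j) : ℂ) := by
    intro j n
    change cc (translate θ (Φ j) - translate (-θ) (Φ j)) n = _
    rw [cc_sub, cc_translate, cc_translate, cc_eq_coef (heven j)]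
    ring
  have hflip : ∀ x : Circ, (fourier (-1) x : ℂ) = fourier 1 (-x) := by
    intro x; simp [fourier_apply]
  refine ⟨⟨toVec w, hforced.mem u⟩, ?_, ?_, ?_⟩
  · intro h0
    have h0' : toVec w = 0 := h0
    have h1 := hcc 0 1
    rw [h0'] at h1
    have h2 : coef 1 (Φ 0) ≠ 0 := by
      intro h3
      have := abs_le.mp hu.abs_coef_shape_sub_le.1
      rw [← hΦ, h3] at this
      linarith [h.eps_le']
    have h3 : (fourier 1 θ : ℂ) - fourier 1 (-θ) ≠ 0 := by
      intro h4
      have h5 : (fourier 1 θ : ℂ).im = Real.sin t := by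
        have : (fourier 1 θ : ℂ) = Complex.exp (t * Complex.I) := by
          have hpi : (π : ℂ) ≠ 0 := by exact_mod_cast Real.pi_ne_zero
          simp only [θ, fourier_coe_apply]
          congr 1
          push_cast
          field_simp
        rw [this, Complex.exp_ofReal_mul_I_im]
      have h6 : (fourier 1 (-θ) : ℂ) = (starRingEnd ℂ) (fourier 1 θ) := by
        rw [← hflip, fourier_neg]
      rw [h6] at h4
      have h7 := congrArg Complex.im h4
      rw [Complex.sub_im, Complex.conj_im, h5, Complex.zero_im] at h7
      have h8 := Real.sin_pos_of_pos_of_lt_pi ht0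
        ((ht1.trans_le (min_le_right _ _)).trans (by linarith [Real.pi_gt_three]))
      linarith
    have h4 : (fourierBasis.repr ((0 : L2perVec) 0)) 1 = 0 := by simp
    rw [h4] at h1
    exact mul_ne_zero h3 (by exact_mod_cast h2) h1.symm
  · rw [critFun_apply]
    simp only [hcc, hflip, neg_neg, coef_neg_index]
    ring
  · rw [hforced.blochOp_eq u]
    -- The difference of the two forcings factors through w, so A w is bounded by the size of γ₀ and
    -- γ₁ times w itself, with no division by θ.
    have hres : residual (ε ^ 2) u w
        (translate θ (shapeForcing (ε ^ 2) a Φ) - translate (-θ) (shapeForcing (ε ^ 2) a Φ))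
        = γ₀ θ * w 0 + γ₁ θ * w 1 := by
      ext x
      simp [residual, γ₀, γ₁, hw, shapeForcing, quadPart, cubicPart, translate, translateProfile]
      ring
    rw [hres]
    have hbound : ‖toL2 (γ₀ θ * w 0 + γ₁ θ * w 1)‖ ≤ d * ‖toVec w‖ := by
      rw [toL2_add, ← mulL2_toL2, ← mulL2_toL2]
      refine (norm_add_le _ _).trans ?_
      have h0 := (norm_mulL2_le (γ₀ θ) (toL2 (w 0))).trans
        (mul_le_mul_of_nonneg_left (norm_le_pi_norm (toVec w) 0) (norm_nonneg _))
      have h1 := (norm_mulL2_le (γ₁ θ) (toL2 (w 1))).trans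
        (mul_le_mul_of_nonneg_left (norm_le_pi_norm (toVec w) 1) (norm_nonneg _))
      have h2 := mul_le_mul_of_nonneg_right hsmall.le (norm_nonneg (toVec w))
      linarith
    rw [pi_norm_le_iff_of_nonneg (by positivity), Fin.forall_fin_two]
    refine ⟨hbound, ?_⟩
    change ‖toL2 (-(γ₀ θ * w 0 + γ₁ θ * w 1))‖ ≤ _
    rw [toL2_neg, norm_neg]
    exact hbound

/-- The co-periodic spectrum of the linearization about the bifurcating profile. -/
theorem OnBranch.spectrum_eq (hu : OnBranch h u a ψ) (hε : ε ≤ 1 / 1000000000) :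
    ∃ (S : Set ℂ) (l : ℂ), opSpectrum (blochOp u ε ω 0) = S ∪ {l, 0} ∧
      ‖l - ((-(4 / 3) * (1 - 16 * ω ^ 2) * ε ^ 2 : ℝ) : ℂ)‖ ≤ 100000000 * sumInv * ε ^ 3 ∧
      ∀ z ∈ S, z.re < -(1 / 8) := by
  have he := h.eps_nonneg
  have hS := one_le_sumInv
  have hK := hu.almostKernel hε
  have hf := hu.isForced_shape
  have hc := hu.abs_coef_shape_sub_le
  have hd := hu.abs_coef_residual_add_le
  have hdn := hu.norm_residual_le
  have heven := hu.shape_even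
  have hn := hu.norm_shape_le
  set Φ := shape (waveNumber ε ω ^ 2) a ψ with hΦ
  set D := residual (ε ^ 2) u Φ (shapeForcing (ε ^ 2) a Φ) with hD
  set lam : ℝ := -(4 / 3) * (1 - 16 * ω ^ 2) * ε ^ 2 with hlam
  have hom := h.omega_sq_le
  have hsq : ε ^ 2 ≤ 1 / 100 := by nlinarith
  have hlam_abs : |lam| ≤ 4 / 3 * ε ^ 2 := by
    rw [abs_le]
    constructor <;> nlinarith [sq_nonneg ε, sq_nonneg ω, mul_nonneg (sq_nonneg ω) (sq_nonneg ε)]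
  -- The factor 2 normalizes φc W to 1 + O(ε): on Φ the functional is (2/3)(2·1/2 - 1/4) = 1/2 at
  -- leading order.
  set W : (blochOp u ε ω 0).domain := (2 : ℂ) • ⟨toVec Φ, hf.mem u⟩ with hW
  have hWv : (W : L2perVec) = (2 : ℂ) • toVec Φ := rfl
  have hAW : blochOp u ε ω 0 W = (2 : ℂ) • toVec ![D, -D] := by
    rw [hW, LinearPMap.map_smul, hf.blochOp_eq u]
  have hWnorm : ‖(W : L2perVec)‖ ≤ 4 := by
    rw [hWv, norm_smul]
    have := norm_toVec_le hn
    norm_num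
    linarith
  have hAWnorm : ‖blochOp u ε ω 0 W‖ ≤ 400 * ε ^ 2 := by
    rw [hAW, norm_smul]
    have := norm_toVec_le (norm_vec_pair D hdn)
    norm_num
    linarith
  have hWs : critFun (-1) W = 0 := by
    rw [hWv, map_smul, critFun_toVec_of_even heven]
    simp
  have hWc : critFun 1 W = ((4 / 3 * (2 * coef 1 (Φ 0) + coef 1 (Φ 1)) : ℝ) : ℂ) := by
    rw [hWv, map_smul, critFun_toVec_of_even heven]
    push_cast
    rw [smul_eq_mul]
    ring
  have hDeven : ∀ x, D (-x) = D x := by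
    intro x
    have hue := hu.even
    simp [hD, residual, jacPart₀, jacPart₁, shapeForcing, quadPart, cubicPart, heven, hue]
  have hAWc : critFun 1 (blochOp u ε ω 0 W) = ((4 / 3 * coef 1 D : ℝ) : ℂ) := by
    rw [hAW, map_smul, critFun_toVec_of_even (w := ![D, -D])
      (by rw [Fin.forall_fin_two]; exact ⟨hDeven, fun x => by simp [hDeven]⟩)]
    simp only [Matrix.cons_val_zero, Matrix.cons_val_one, map_neg, smul_eq_mul]
    push_cast
    ring
  have hc0 := abs_le.mp hc.1
  have hc1 := abs_le.mp hc.2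
  have hWc1 : |4 / 3 * (2 * coef 1 (Φ 0) + coef 1 (Φ 1)) - 1| ≤ 10 * ε := by
    rw [abs_le]
    constructor <;> linarith
  obtain ⟨S, l, h1, h2, h3⟩ := hK.spectrum_eq (lam := (lam : ℂ))
    (by rw [Complex.ofReal_re]; linarith [(abs_le.mp hlam_abs).1]) W hWs
    (by
      rw [hWc, Complex.norm_real, Real.norm_eq_abs]
      exact le_abs.mpr (Or.inl (by linarith [(abs_le.mp hWc1).1])))
    (fun R hR => hK.φs_char_zero hR fun d hd => hu.exists_odd_approx hd)
  refine ⟨S, l, h1, h2.trans ?_, h3⟩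
  have h4 : ‖(lam : ℂ) * critFun 1 W - critFun 1 (blochOp u ε ω 0 W)‖
      ≤ 4 / 3 * ε ^ 2 * (10 * ε) + 4 / 3 * (84000 * sumInv * ε ^ 3) := by
    rw [hWc, hAWc, ← Complex.ofReal_mul, ← Complex.ofReal_sub, Complex.norm_real,
      Real.norm_eq_abs]
    have e : lam * (4 / 3 * (2 * coef 1 (Φ 0) + coef 1 (Φ 1))) - 4 / 3 * coef 1 D
        = lam * (4 / 3 * (2 * coef 1 (Φ 0) + coef 1 (Φ 1)) - 1)
          - 4 / 3 * (coef 1 D + ε ^ 2 * (1 - 16 * ω ^ 2)) := by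
      rw [hlam]; ring
    rw [e]
    refine (abs_sub _ _).trans (add_le_add ?_ ?_)
    · rw [abs_mul]
      exact mul_le_mul hlam_abs hWc1 (abs_nonneg _) (by positivity)
    · rw [abs_mul, abs_of_pos (by norm_num : (0 : ℝ) < 4 / 3)]
      exact mul_le_mul_of_nonneg_left hd (by norm_num)
  have h5 : ‖(lam : ℂ)‖ * ‖(W : L2perVec)‖ ≤ 4 / 3 * ε ^ 2 * 4 := by
    rw [Complex.norm_real, Real.norm_eq_abs]
    exact mul_le_mul hlam_abs hWnorm (norm_nonneg _) (by positivity)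
  -- Here η = 130ε multiplies quantities of size ε², so this part of the error is already O(ε³).
  have h6 : 130 * ε * 400 * (‖blochOp u ε ω 0 W‖ + ‖(lam : ℂ)‖ * ‖(W : L2perVec)‖)
      ≤ 130 * ε * 400 * (406 * ε ^ 2) :=
    mul_le_mul_of_nonneg_left (by nlinarith [sq_nonneg ε]) (by positivity)
  have h7 : ε ^ 3 ≤ sumInv * ε ^ 3 := le_mul_of_one_le_left (by positivity) hS
  have h8 : 0 ≤ ε ^ 3 := by positivity
  linarith

end OnBranch

end Brusselator

end

/-! ### Choice of the constants and conclusion -/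

theorem proposition3p2 :
    ∃ ρ > (0 : ℝ), ∃ ε₀ > (0 : ℝ),
      (∀ ε ∈ Set.Ico 0 ε₀, ∀ ω ∈ Set.Icc (-(1 / 4) : ℝ) (1 / 4),
        ∃! u : Brusselator.Profile, Brusselator.IsSmallEvenSteady ρ ε ω u) ∧
      (∃ C : ℝ, ∀ ε ∈ Set.Ico 0 ε₀, ∀ ω ∈ Set.Icc (-(1 / 4) : ℝ) (1 / 4),
        ∀ u : Brusselator.Profile, Brusselator.IsSmallEvenSteady ρ ε ω u →
          Brusselator.h2Norm (u - Brusselator.leadingProfile ε ω) ≤ C * ε ^ 2) ∧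
      ∃ ε₁ ∈ Set.Ioc 0 ε₀, ∃ δ > (0 : ℝ), ∃ C : ℝ,
        ∀ ε ∈ Set.Ico 0 ε₁, ∀ ω ∈ Set.Icc (-(1 / 4) : ℝ) (1 / 4),
          ∀ u : Brusselator.Profile, Brusselator.IsSmallEvenSteady ρ ε ω u →
            ∃ (S : Set ℂ) (lam₁ lam₂ : ℂ),
              Brusselator.opSpectrum (Brusselator.blochOp u ε ω 0) = S ∪ {lam₁, lam₂} ∧
              ‖lam₁ - ((-(4 / 3) * (1 - 16 * ω ^ 2) * ε ^ 2 : ℝ) : ℂ)‖ ≤ C * ε ^ 3 ∧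
              lam₂ = 0 ∧
              ∀ z ∈ S, z.re < -δ := by
  have hadm : ∀ ε ∈ Set.Ico 0 (Brusselator.radius / 400),
      ∀ ω ∈ Set.Icc (-(1 / 4) : ℝ) (1 / 4), Brusselator.Admissible ε ω := by
    intro ε hε ω hω
    refine ⟨hε.1, ?_, abs_le.mpr ⟨by linarith [hω.1], hω.2⟩⟩
    have h1 : Brusselator.radius ≤ Brusselator.ampMax / 2 := by
      have hS := Brusselator.one_le_sumInv
      rw [Brusselator.radius]
      exact div_le_div_of_nonneg_left Brusselator.ampMax_pos.le two_pos (by linarith)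
    linarith [hε.2, Brusselator.radius_pos]
  have hpos : 0 < Brusselator.radius / 400 := div_pos Brusselator.radius_pos (by norm_num)
  -- The divisor 400 is the constant in the H² bound of the branch, so the solution lies in the ball
  -- of classification; the minimum with 10⁻⁹ is needed only for the spectral statement.
  refine ⟨Brusselator.radius, Brusselator.radius_pos, Brusselator.radius / 400, hpos,
    fun ε hε ω hω => ?_, ⟨2000000 * Brusselator.sumInv, fun ε hε ω hω u hu => ?_⟩,
    min (Brusselator.radius / 400) (1 / 1000000000),
    ⟨lt_min hpos (by norm_num), min_le_left _ _⟩, 1 / 8, by norm_num,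
    100000000 * Brusselator.sumInv, fun ε hε ω hω u hu => ?_⟩
  · have h := hadm ε hε ω hω
    obtain ⟨u, a, ψ, hu⟩ := Brusselator.exists_onBranch h
    refine ⟨u, hu.isSmallEvenSteady (by linarith [hε.2]), fun u' hu' => ?_⟩
    obtain ⟨a', ψ', h'⟩ := hu'.exists_onBranch h
    exact h'.unique hu
  · obtain ⟨a, ψ, h'⟩ := hu.exists_onBranch (hadm ε hε ω hω)
    exact h'.h2Norm_sub_le
  · obtain ⟨a, ψ, h'⟩ := hu.exists_onBranch
      (hadm ε ⟨hε.1, hε.2.trans_le (min_le_left _ _)⟩ ω hω)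
    obtain ⟨S, l, h1, h2, h3⟩ := h'.spectrum_eq (hε.2.le.trans (min_le_right _ _))
    exact ⟨S, l, 0, h1, h2, rfl, h3⟩
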